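/- Let $M=\{\rho\ge 0\}\subset\mathbb{R}^2$ be compact, with $\rho\in C^\infty(\mathbb{R}^2,\mathbb{R})$ and $d\rho\neq 0$ on $\{\rho=0\}=\partial M$. Let $g$ be a Riemannian metric on $M$, smooth up to $\partial M$ (global coordinates on an oriented surface, for instance isothermal ones), with a smooth orthonormal frame $(e_1,e_2)$, which fixes the orientation (in isothermal coordinates, $g=e^{2\lambda}(dx^2+dy^2)$, take $e_1=e^{-\lambda}\partial_x$, $e_2=e^{-\lambda}\partial_y$). Let $\kappa$ be the Gaussian curvature and $dM$ the area measure. On the unit circle bundle $SM=\{(x,\theta)\}$, where $(x,\theta)$ stands for the unit vector $\cos\theta\, e_1(x)+\sin\theta\, e_2(x)$, let $X$ be the geodesic vector field, $V=\partial_\theta$, $X_\perp=[X,V]$ and $d\Sigma^3=dM\,d\theta$. Let $\varphi_t(x,\theta)=(\gamma_{x,\theta}(t),\alpha_{x,\theta}(t))$ be the geodesic flow (with $\alpha_{x,\theta}$ the continuous angle of the velocity, $\alpha_{x,\theta}(0)=\theta$), $\tau(x,\theta)$ the exit time from $M$, and $a,b$ the solutions of $\ddot y+\kappa(\gamma_{x,\theta}(t))\,y=0$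 along $\gamma_{x,\theta}$ with $a(0)=1,\ \dot a(0)=0$ and $b(0)=0,\ \dot b(0)=1$. Assume that $(M,g)$ is simple: $\partial M$ is strictly convex (positive definite second fundamental form), all geodesics leave $M$ in finite time, and for every $x\in M$ the exponential map $t(\cos\theta\, e_1+\sin\theta\, e_2)\mapsto\gamma_{x,\theta}(t)$, $0\le t\le\tau(x,\theta)$, is a diffeomorphism onto $M$ (a bijection onto $M$ without conjugate points, i.e. $b(x,\theta,t)\ne 0$ for $0<t\le\tau(x,\theta)$). For $k\in\mathbb{Z}$ let $H_k\subset L^2(SM,d\Sigma^3)$ be the eigenspace of $-iV$ for the eigenvalue $k$, that is, the set of $L^2$ functions of the form $e^{ik\theta}\tilde f(x)$. Let $\Omega_k=\ker(\partial_\theta-ik)\cap C^\infty(SM)$, and let $u_k(x,\theta)=\frac{e^{ik\theta}}{2\pi}\int_0^{2\pi}u(x,s)e^{-iks}\,ds$ be the $k$-th Fourier component of a function $u$ on $SM$. Let $C_0^\infty(M)$ be the set of smooth complex functions with compact support in the interior of $M$. Let $h\in\Omega_1$ be nowhere vanishing on $SM$ and let $k\in\mathbb{Z}$. Then for $f\in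 h^kC_0^\infty(M)$ the function $u^f(x,\theta)=\int_0^{\tau(x,\theta)}f(\varphi_t(x,\theta))\,dt$ is smooth on $SM$, satisfies $Xu^f=-f$, and vanishes at all boundary vectors that do not point strictly into $M$. The operator $$W_kf=(X_\perp u^f)_k,\qquad f\in h^kC_0^\infty(M)\subset H_k,$$ takes values in $\Omega_k$ and extends to a smoothing operator $W_k:H_k\to\Omega_k$, that is, to a linear operator that is bounded from the $L^2$ norm to every $C^n(SM)$ norm. More precisely, there is a function $\mathcal{K}_k\in C^\infty(M\times M)$ such that the extension is $$W_k(e^{ik\theta}\tilde f)(x,\theta)=e^{ik\theta}\int_M \mathcal{K}_k(x,y)\,\tilde f(y)\,dM_y ,\qquad e^{ik\theta}\tilde f\in H_k.$$ For all $(x,\theta)\in SM$ and $0<t<\tau(x,\theta)$, the quotient $a/b$ is differentiable in $\theta$ and $$\mathcal{K}_k(x,\gamma_{x,\theta}(t))=-\frac{1}{2\pi}\,\frac{q_k(x,\theta,t)}{b(x,\theta,t)},\qquad q_k=\Big(-\partial_\theta\Big(\frac ab\Big)+ik\,\frac{a-1}{b}\Big)e^{ik(\alpha_{x,\theta}(t)-\theta)}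 .$$ -/

import Mathlib

open Set Filter Topology MeasureTheory
open scoped ContDiff

noncomputable section

/-- Global coordinates `(x, y)`. -/
abbrev Plane : Type := ℝ × ℝ

/-- A compact oriented Riemannian surface with smooth boundary `M = {ρ ≥ 0}`, given in a global
coordinate chart: an arbitrary Riemannian metric `g` on `M` (smooth up to the boundary, i.e. with
smooth coefficients near `M`), together with a smooth orthonormal frame `(e₁, e₂)` of `g` on `M`,
which fixes the orientation and the direction from which angles are measured.
(In isothermal coordinates, `g = e^{2λ}(dx² + dy²)`, one takes `e₁ = e^{-λ}∂_x`,
`e₂ = e^{-λ}∂_y`.) -/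
structure RiemSurface where
  rho : Plane → ℝ
  g : Plane → Plane →L[ℝ] Plane →L[ℝ] ℝ
  e₁ : Plane → Plane
  e₂ : Plane → Plane
  rho_smooth : ContDiff ℝ ∞ rho
  g_smooth : ContDiff ℝ ∞ g
  e₁_smooth : ContDiff ℝ ∞ e₁
  e₂_smooth : ContDiff ℝ ∞ e₂
  compact : IsCompact {x | 0 ≤ rho x}
  boundary_regular : ∀ x, rho x = 0 → fderiv ℝ rho x ≠ 0
  g_symm : ∀ x, 0 ≤ rho x → ∀ v w, g x v w = g x w v
  g_pos : ∀ x, 0 ≤ rho x → ∀ v, v ≠ 0 → 0 < g x v v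
  norm_e₁ : ∀ x, 0 ≤ rho x → g x (e₁ x) (e₁ x) = 1
  norm_e₂ : ∀ x, 0 ≤ rho x → g x (e₂ x) (e₂ x) = 1
  orthogonal : ∀ x, 0 ≤ rho x → g x (e₁ x) (e₂ x) = 0

namespace RiemSurface

variable (S : RiemSurface)

/-- The surface with its boundary. -/
def M : Set Plane := {x | 0 ≤ S.rho x}

/-- The unit circle bundle `SM`. The pair `(x, θ)` stands for the unit vector
`cos θ e₁(x) + sin θ e₂(x)`. Functions on `SM` are written as functions of `(x, θ)`, of which only
the values on this set matter; they are `2π`-periodic in `θ`. -/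
def SM : Set (Plane × ℝ) := S.M ×ˢ univ

/-- The area density `√(det g)` in the coordinates. -/
def areaDensity (x : Plane) : ℝ :=
  Real.sqrt (S.g x (1, 0) (1, 0) * S.g x (0, 1) (0, 1) - S.g x (1, 0) (0, 1) ^ 2)

/-- The Riemannian area measure `dM` on `M`. -/
def area : Measure Plane :=
  (volume.restrict S.M).withDensity fun x => ENNReal.ofReal (S.areaDensity x)

/-- The volume measure `dΣ³ = dM dθ` on `SM`. -/
def liouville : Measure (Plane × ℝ) :=
  S.area.prod (volume.restrict (Ioc 0 (2 * Real.pi)))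

/-- Structure functions of the frame: `[e₁, e₂] = c₁ e₁ + c₂ e₂`. By the Koszul formula the
connection form of the Levi-Civita connection is `g(∇_{e_i} e₁, e₂) = -c_i`. -/
def c₁ (x : Plane) : ℝ := S.g x (VectorField.lieBracket ℝ S.e₁ S.e₂ x) (S.e₁ x)

/-- The second structure function, see `c₁`. -/
def c₂ (x : Plane) : ℝ := S.g x (VectorField.lieBracket ℝ S.e₁ S.e₂ x) (S.e₂ x)

/-- Gaussian curvature, by Cartan's structure equation
`κ = e₁(c₂) - e₂(c₁) - c₁² - c₂²`
(equal to `-e^{-2λ}(∂_x²λ + ∂_y²λ)` in isothermal coordinates). -/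
def curvature (x : Plane) : ℝ :=
  fderiv ℝ S.c₂ x (S.e₁ x) - fderiv ℝ S.c₁ x (S.e₂ x) - S.c₁ x ^ 2 - S.c₂ x ^ 2

/-- The geodesic vector field `X` on `SM`. A curve `(γ(t), α(t))` is an integral curve iff
`γ' = cos α e₁ + sin α e₂` and `∇_{γ'} γ' = 0`, the latter being `α' = c₁ cos α + c₂ sin α`. -/
def X (p : Plane × ℝ) : Plane × ℝ :=
  (Real.cos p.2 • S.e₁ p.1 + Real.sin p.2 • S.e₂ p.1,
    Real.cos p.2 * S.c₁ p.1 + Real.sin p.2 * S.c₂ p.1)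

/-- The vertical vector field `V = ∂_θ`. -/
def V (_ : Plane × ℝ) : Plane × ℝ := (0, 1)

/-- `X_⊥ = [X, V]`. -/
def Xperp : Plane × ℝ → Plane × ℝ := VectorField.lieBracket ℝ S.X V

/-- The derivative `Y u` of a function on `SM` along a vector field `Y`
(at boundary points: the derivative within `SM`). -/
def along (Y : Plane × ℝ → Plane × ℝ) (u : Plane × ℝ → ℂ) (p : Plane × ℝ) : ℂ :=
  fderivWithin ℝ u S.SM p (Y p)

/-- `X ρ`: the derivative of the boundary defining function in the direction `(x, θ)`. It has the
sign of `⟨v, ν⟩`, `ν` the inner normal, at boundary points. -/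
def Xrho (p : Plane × ℝ) : ℝ := fderiv ℝ S.rho p.1 (S.X p).1

/-- The set `∂₋SM` of boundary vectors that do not point strictly into `M`. -/
def outflux : Set (Plane × ℝ) := {p | S.rho p.1 = 0 ∧ S.Xrho p ≤ 0}

/-- `c = (γ, α)` is, on the time interval `[0, T]`, the lift to `SM` of the unit speed geodesic
with initial data `(x, θ)`, and that geodesic stays in `M` during `[0, T]`. -/
def IsGeodesicOn (p : Plane × ℝ) (T : ℝ) (c : ℝ → Plane × ℝ) : Prop :=
  0 ≤ T ∧ c 0 = p ∧ ∀ s ∈ Icc 0 T, c s ∈ S.SM ∧ HasDerivWithinAt c (S.X (c s)) (Icc 0 T) s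

/-- The times up to which the geodesic with initial data `(x, θ)` stays in `M`. -/
def survivalTimes (p : Plane × ℝ) : Set ℝ := {T | ∃ c, S.IsGeodesicOn p T c}

/-- The exit time `τ(x, θ)`. -/
def exitTime (p : Plane × ℝ) : ℝ := sSup (S.survivalTimes p)

open Classical in
/-- The geodesic flow `φ_t(x, θ) = (γ_{x,θ}(t), α_{x,θ}(t))`, for `0 ≤ t ≤ τ(x, θ)`. The angle
`α_{x,θ}` of the velocity is the continuous one with `α_{x,θ}(0) = θ`. -/
def flow (p : Plane × ℝ) (t : ℝ) : Plane × ℝ :=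
  if h : ∃ c, S.IsGeodesicOn p t c then h.choose t else p

/-- `y` solves the Jacobi equation `y'' + κ(γ_{x,θ}) y = 0` on `[0, τ(x, θ)]`,
with `y(0) = y₀` and `y'(0) = y₁`. -/
def IsJacobi (p : Plane × ℝ) (y₀ y₁ : ℝ) (y : ℝ → ℝ) : Prop :=
  ∃ y' : ℝ → ℝ, y 0 = y₀ ∧ y' 0 = y₁ ∧ ∀ s ∈ Icc 0 (S.exitTime p),
    HasDerivWithinAt y (y' s) (Icc 0 (S.exitTime p)) s ∧
    HasDerivWithinAt y' (-S.curvature (S.flow p s).1 * y s) (Icc 0 (S.exitTime p)) s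

open Classical in
/-- The solution of the Jacobi equation on `[0, τ(x, θ)]`. -/
def jacobi (y₀ y₁ : ℝ) (p : Plane × ℝ) (t : ℝ) : ℝ :=
  if h : ∃ y, S.IsJacobi p y₀ y₁ y then h.choose t else 0

/-- `a'' + κ(γ) a = 0`, `a(0) = 1`, `a'(0) = 0`. -/
def a (p : Plane × ℝ) (t : ℝ) : ℝ := S.jacobi 1 0 p t

/-- `b'' + κ(γ) b = 0`, `b(0) = 0`, `b'(0) = 1`. -/
def b (p : Plane × ℝ) (t : ℝ) : ℝ := S.jacobi 0 1 p t

/-- Simple surfaces: the boundary is strictly convex and, for every `x ∈ M`, the exponential map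
`exp_x`, on the vectors `t (cos θ e₁ + sin θ e₂)` with `0 ≤ t ≤ τ(x, θ)`, is a diffeomorphism
onto `M`. -/
structure IsSimple : Prop where
  /-- `X(Xρ) < 0` on vectors tangent to the boundary: the second fundamental form of the boundary
  is positive definite. -/
  strictly_convex : ∀ p, S.rho p.1 = 0 → S.Xrho p = 0 → fderiv ℝ S.Xrho p (S.X p) < 0
  nontrapping : ∀ p ∈ S.SM, BddAbove (S.survivalTimes p)
  /-- No conjugate points: the differential of `exp_x` is invertible. -/
  no_conjugate : ∀ p ∈ S.SM, ∀ t, 0 < t → t ≤ S.exitTime p → S.b p t ≠ 0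
  /-- `exp_x` takes the value `x` only at the zero vector. -/
  no_loop : ∀ p ∈ S.SM, ∀ t, 0 < t → t ≤ S.exitTime p → (S.flow p t).1 ≠ p.1
  /-- `exp_x` is a bijection from the nonzero vectors onto `M \ {x}`. -/
  exp_bijective : ∀ x ∈ S.M, ∀ y ∈ S.M, y ≠ x →
    ∃! v : ℝ × ℝ, v.1 ∈ Ico 0 (2 * Real.pi) ∧ 0 < v.2 ∧ v.2 ≤ S.exitTime (x, v.1) ∧
      (S.flow (x, v.1) v.2).1 = y

/-- `u^f(x, θ) = ∫₀^{τ(x,θ)} f(φ_t(x, θ)) dt`, the solution of `X u = -f` that vanishes on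
`∂₋SM`. -/
def transport (f : Plane × ℝ → ℂ) (p : Plane × ℝ) : ℂ :=
  ∫ t in (0 : ℝ)..S.exitTime p, f (S.flow p t)

/-- The Fourier component `u_k(x, θ) = e^{ikθ} (1/2π) ∫₀^{2π} u(x, s) e^{-iks} ds`. -/
def fourierPart (k : ℤ) (u : Plane × ℝ → ℂ) (p : Plane × ℝ) : ℂ :=
  Complex.exp (Complex.I * k * p.2) *
    ((1 / (2 * Real.pi) : ℂ) *
      ∫ s in (0 : ℝ)..(2 * Real.pi), u (p.1, s) * Complex.exp (-(Complex.I * k * s)))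

/-- `W_k f = (X_⊥ u^f)_k`. -/
def W (k : ℤ) (f : Plane × ℝ → ℂ) : Plane × ℝ → ℂ :=
  fourierPart k (S.along S.Xperp (S.transport f))

/-- `q_k = (-∂_θ(a/b) + i k (a - 1)/b) e^{ik(α_{x,θ}(t) - θ)}`. -/
def q (k : ℤ) (p : Plane × ℝ) (t : ℝ) : ℂ :=
  (-((deriv (fun s : ℝ => S.a (p.1, s) t / S.b (p.1, s) t) p.2 : ℝ) : ℂ) +
      Complex.I * k * (((S.a p t - 1) / S.b p t : ℝ) : ℂ)) *
    Complex.exp (Complex.I * k * (((S.flow p t).2 - p.2 : ℝ) : ℂ))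

/-- Smooth functions with compact support in the interior of `M`. -/
def C0inf : Set (Plane → ℂ) :=
  {φ | ContDiff ℝ ∞ φ ∧ HasCompactSupport φ ∧ tsupport φ ⊆ interior S.M}

/-- `Ω_k = ker(∂_θ - ik) ∩ C^∞(SM)`. -/
def Omega (k : ℤ) : Submodule ℂ (Plane × ℝ → ℂ) where
  carrier := {u | ContDiffOn ℝ ∞ u S.SM ∧
    ∀ p ∈ S.SM, HasDerivAt (fun s : ℝ => u (p.1, s)) (Complex.I * k * u p) p.2}
  zero_mem' := ⟨contDiffOn_const, fun p _ => by
    simpa using hasDerivAt_const p.2 (0 : ℂ)⟩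
  add_mem' := fun {u v} hu hv => ⟨hu.1.add hv.1, fun p hp => by
    have := (hu.2 p hp).fun_add (hv.2 p hp)
    simpa only [Pi.add_apply, mul_add] using this⟩
  smul_mem' := fun z u hu => ⟨hu.1.const_smul z, fun p hp => by
    have := (hu.2 p hp).fun_const_smul z
    simpa only [Pi.smul_apply, smul_eq_mul, mul_left_comm z] using this⟩

/-- `F ∈ L²(SM)` is the function `e^{ikθ} φ(x)`. -/
def IsMode (k : ℤ) (F : Plane × ℝ → ℂ) (φ : Plane → ℂ) : Prop :=
  F =ᵐ[S.liouville] fun p => Complex.exp (Complex.I * k * p.2) * φ p.1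

/-- `H_k`: the eigenspace of `-i∂_θ` in `L²(SM)` for the eigenvalue `k`, which consists of the
`L²` functions of the form `e^{ikθ} φ(x)`. -/
def H (k : ℤ) : Submodule ℂ (Lp ℂ 2 S.liouville) where
  carrier := {F | ∃ φ : Plane → ℂ, S.IsMode k F φ}
  zero_mem' := ⟨0, by
    filter_upwards [Lp.coeFn_zero ℂ 2 S.liouville] with p hp
    simpa using hp⟩
  add_mem' := fun {F G} ⟨φ, hφ⟩ ⟨ψ, hψ⟩ => ⟨φ + ψ, by
    filter_upwards [Lp.coeFn_add F G, hφ, hψ] with p hp h1 h2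
    simp only [hp, Pi.add_apply, h1, h2, mul_add]⟩
  smul_mem' := fun z F ⟨φ, hφ⟩ => ⟨z • φ, by
    filter_upwards [Lp.coeFn_smul z F, hφ] with p hp h1
    simp only [hp, Pi.smul_apply, h1, smul_eq_mul, mul_left_comm z]⟩

end RiemSurface

end

-- The mechanism is an integration by parts in the angle. In the frame X, X_⊥, V the linearized
-- geodesic flow is governed by the Jacobi functions: the structure equation [X, X_⊥] = -κV gives
-- dφ_t(V) = -b X_⊥ + b' V and dφ_t(X_⊥) = a X_⊥ - a' V (`hasDerivAt_coef_dFlow`, `dFlow_vertical`,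
-- `dFlow_Xperp`). For f in H_k one has Vf = ikf. Eliminating X_⊥f and using the Wronskian ab' - a'b
-- = 1, the integrand of X_⊥u^f is ik(f∘φ_t)/b - (a/b) ∂_θ(f∘φ_t). The k-th Fourier coefficient
-- integrates this against e^{-ikθ}; for fixed t the θ-derivative is moved from f∘φ_t onto e^{-ikθ}
-- a/b, and what remains is -q_k times the amplitude of f (`IsSimple.fderiv_Xperp_eq`,
-- `IsSimple.integral_angle`). No derivative of f survives. Since exponential polar coordinates are
-- global on a simple surface and dM = b dt dθ in them (`IsSimple.integral_area_polar`), the result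
-- is an integral over M with kernel -(1/2π) q_k/b (`IsSimple.W_modeFun`).
--
-- The remaining point is that this kernel is smooth on M × M. Away from the diagonal the polar
-- coordinates of y around x depend smoothly on (x, y), by the inverse function theorem and the
-- absence of conjugate points (`IsSimple.exists_local_kernel_offDiag`). At the diagonal, (a -
-- 1)/t², b/t and (b/t - 1)/t² are smooth functions of x and of the initial velocity v = t(cos θ,
-- sin θ), because they solve a system that is regular at v = 0 (`exists_polar_normal_form`). Thus
-- a/b = 1/t + tR(x, v) with R smooth; ∂_θ annihilates the singular term, and all remaining powers
-- of t cancel in q_k/b (`IsSimple.nearKernel_eq`). A partition of unity glues the local kernels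
-- (`IsSimple.exists_kernel`). A smooth kernel over a compact domain is smoothing, with bounds on
-- every derivative by the L² norm.
--
-- Geodesics are defined only inside M, so X is replaced by a bounded, globally Lipschitz extension
-- with a smooth global flow (`exists_smooth_flow`). Strict convexity makes the exit time
-- continuous. Nothing better is needed, because f vanishes near the end points of all geodesics and
-- the upper limit in u^f can be frozen locally (`IsSimple.eventually_transport_eq`).

universe u

/-! ### Smoothness of superposition operators on spaces of continuous functions. -/

section Postcomp

variable {K : Type*} [TopologicalSpace K] [CompactSpace K]

/-- Pointwise application of a continuous family of operators to a continuous map. -/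
noncomputable def pointwiseApply {E F : Type u} [NormedAddCommGroup E] [NormedSpace ℝ E]
    [NormedAddCommGroup F] [NormedSpace ℝ F] :
    C(K, E →L[ℝ] F) →L[ℝ] C(K, E) →L[ℝ] C(K, F) :=
  LinearMap.mkContinuous₂
    (LinearMap.mk₂ ℝ
      (fun (A : C(K, E →L[ℝ] F)) (h : C(K, E)) =>
        (⟨fun x => A x (h x), A.continuous.clm_apply h.continuous⟩ : C(K, F)))
      (fun A B h => by ext; simp) (fun c A h => by ext; simp)
      (fun A h h' => by ext; simp) (fun c A h => by ext; simp)) 1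
    (fun A h => by
      rw [ContinuousMap.norm_le _ (by positivity)]
      intro x
      simp only [LinearMap.mk₂_apply, ContinuousMap.coe_mk, one_mul]
      exact (A x).le_of_opNorm_le_of_le (A.norm_coe_le_norm x) (h.norm_coe_le_norm x))

@[simp] theorem pointwiseApply_apply {E F : Type u} [NormedAddCommGroup E] [NormedSpace ℝ E]
    [NormedAddCommGroup F] [NormedSpace ℝ F] (A : C(K, E →L[ℝ] F)) (h : C(K, E)) (x : K) :
    pointwiseApply A h x = A x (h x) := rfl

/-- Continuity of composition in the compact-open topology replaces uniform continuity of g near the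
compact range of u; no local compactness of E is needed. -/
theorem exists_dist_postcomp_lt {E G : Type*} [NormedAddCommGroup E] [NormedAddCommGroup G]
    {g : E → G} (hg : Continuous g) (u : C(K, E)) {ε : ℝ} (hε : 0 < ε) :
    ∃ δ > 0, ∀ v : C(K, E), dist v u < δ → ∀ x, dist (g (v x)) (g (u x)) < ε := by
  obtain ⟨δ, hδ, h⟩ := Metric.eventually_nhds_iff_ball.1
    (((ContinuousMap.continuous_postcomp (X := K) (⟨g, hg⟩ : C(E, G))).tendsto u).eventually
      (Metric.ball_mem_nhds _ hε))
  exact ⟨δ, hδ, fun v hv x => (ContinuousMap.dist_apply_le_dist x).trans_lt (h v hv)⟩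

/-- The mean value inequality bounds the remainder at each x by the oscillation of Df near u(x),
which is small uniformly in x. -/
theorem hasFDerivAt_postcomp {E F : Type u} [NormedAddCommGroup E] [NormedSpace ℝ E]
    [NormedAddCommGroup F] [NormedSpace ℝ F] {f : E → F} (hf : Differentiable ℝ f)
    (hc : Continuous f) (hf' : Continuous (fderiv ℝ f)) (u : C(K, E)) :
    HasFDerivAt (fun v : C(K, E) => (⟨f, hc⟩ : C(E, F)).comp v)
      (pointwiseApply ((⟨fderiv ℝ f, hf'⟩ : C(E, E →L[ℝ] F)).comp u)) u := by
  rw [hasFDerivAt_iff_isLittleO_nhds_zero, Asymptotics.isLittleO_iff]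
  intro c hc0
  obtain ⟨δ, hδ, H⟩ := exists_dist_postcomp_lt hf' u hc0
  filter_upwards [Metric.ball_mem_nhds (0 : C(K, E)) hδ] with h hh
  rw [mem_ball_zero_iff] at hh
  rw [ContinuousMap.norm_le _ (by positivity)]
  intro x
  have hx : ‖h x‖ < δ := (h.norm_coe_le_norm x).trans_lt hh
  have key := (convex_ball (u x) δ).norm_image_sub_le_of_norm_hasFDerivWithin_le'
    (f := f) (f' := fderiv ℝ f) (φ := fderiv ℝ f (u x)) (C := c) (x := u x) (y := u x + h x)
    (fun z _ => (hf z).hasFDerivAt.hasFDerivWithinAt)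
    (fun z hz => by
      -- A point z near u(x) is the value at x of a translate of u by a constant, so the uniform
      -- estimate applies to it.
      have hv : dist (u + ContinuousMap.const K (z - u x)) u < δ := by
        rw [dist_eq_norm, add_sub_cancel_left]
        refine lt_of_le_of_lt ((ContinuousMap.norm_le _ (norm_nonneg (z - u x))).2
          fun _ => le_rfl) ?_
        rwa [← dist_eq_norm]
      have h1 := H _ hv x
      rw [dist_eq_norm] at h1
      simpa using h1.le)
    (Metric.mem_ball_self hδ) (by simpa using hx)
  simp only [add_sub_cancel_left] at key
  refine le_trans ?_ (key.trans (by gcongr; exact h.norm_coe_le_norm x))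
  simp

/-- The derivative is postcomposition with Df followed by a fixed bounded linear map, so induction
on n works once the target space is allowed to vary; the common universe accommodates the target E
→L[ℝ] F of Df. -/
theorem contDiff_nat_postcomp (n : ℕ) : ∀ {E F : Type u} [NormedAddCommGroup E] [NormedSpace ℝ E]
    [NormedAddCommGroup F] [NormedSpace ℝ F] {f : E → F} (hf : ContDiff ℝ n f),
    ContDiff ℝ n (fun v : C(K, E) => (⟨f, hf.continuous⟩ : C(E, F)).comp v) := by
  induction n with
  | zero =>
    intro E F _ _ _ _ f hf
    exact contDiff_zero.2 (ContinuousMap.continuous_postcomp _)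
  | succ n ih =>
    intro E F _ _ _ _ f hf
    have hd : ContDiff ℝ n (fderiv ℝ f) := hf.fderiv_right (by norm_cast)
    have hdiff : Differentiable ℝ f := hf.differentiable (by simp)
    have hder := fun u => hasFDerivAt_postcomp (K := K) hdiff hf.continuous hd.continuous u
    push_cast
    rw [contDiff_succ_iff_fderiv]
    refine ⟨fun u => (hder u).differentiableAt, by simp, ?_⟩
    rw [funext fun u => (hder u).fderiv]
    exact (pointwiseApply (K := K) (E := E) (F := F)).contDiff.comp (ih hd)

/-- Postcomposition with a smooth map is a smooth map between spaces of continuous functions on a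
compact space. -/
theorem contDiff_postcomp {E F : Type u} [NormedAddCommGroup E] [NormedSpace ℝ E]
    [NormedAddCommGroup F] [NormedSpace ℝ F] {f : E → F} (hf : ContDiff ℝ ∞ f) :
    ContDiff ℝ ∞ (fun v : C(K, E) => (⟨f, hf.continuous⟩ : C(E, F)).comp v) :=
  contDiff_infty.2 fun n => contDiff_nat_postcomp n (contDiff_infty.1 hf n)

end Postcomp

/-! ### Smooth global flows of bounded Lipschitz vector fields. -/

section Flow

variable {E : Type u} [NormedAddCommGroup E] [NormedSpace ℝ E]

/-- The primitive, vanishing at `0`, of a continuous function on the unit interval. -/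
noncomputable def unitPrimitive [CompleteSpace E] : C(Icc (0 : ℝ) 1, E) →L[ℝ] C(Icc (0 : ℝ) 1, E) :=
  LinearMap.mkContinuous
    { toFun := fun u => ⟨fun t => ∫ r in (0 : ℝ)..t, u (projIcc 0 1 zero_le_one r),
        (intervalIntegral.continuous_primitive
          (fun a b => (u.continuous.comp continuous_projIcc).intervalIntegrable a b) 0).comp
          continuous_subtype_val⟩
      map_add' := fun u v => by
        ext t
        simp only [ContinuousMap.add_apply, ContinuousMap.coe_mk]
        exact intervalIntegral.integral_add
          ((u.continuous.comp continuous_projIcc).intervalIntegrable _ _)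
          ((v.continuous.comp continuous_projIcc).intervalIntegrable _ _)
      map_smul' := fun c u => by
        ext t
        simp } 1
    (fun u => by
      rw [ContinuousMap.norm_le _ (by positivity)]
      intro t
      simp only [LinearMap.coe_mk, AddHom.coe_mk, ContinuousMap.coe_mk]
      have h := intervalIntegral.norm_integral_le_of_norm_le_const (a := (0 : ℝ)) (b := t)
        (f := fun r => u (projIcc 0 1 zero_le_one r)) (C := ‖u‖)
        (fun r _ => u.norm_coe_le_norm _)
      refine h.trans ?_
      rw [sub_zero, abs_of_nonneg t.2.1, one_mul]
      exact mul_le_of_le_one_right (norm_nonneg _) t.2.2)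

theorem unitPrimitive_apply [CompleteSpace E] (u : C(Icc (0 : ℝ) 1, E)) (t : Icc (0 : ℝ) 1) :
    unitPrimitive u t = ∫ r in (0 : ℝ)..t, u (projIcc 0 1 zero_le_one r) := rfl

theorem norm_unitPrimitive_le [CompleteSpace E] (u : C(Icc (0 : ℝ) 1, E)) :
    ‖unitPrimitive u‖ ≤ ‖u‖ := by
  simpa [unitPrimitive] using
    (unitPrimitive (E := E)).le_of_opNorm_le (LinearMap.mkContinuous_norm_le _ zero_le_one _) u

/-- For a contracting smooth vector field the time one map is smooth. -/
theorem exists_contDiff_time_one [CompleteSpace E] {f : E → E} (hf : ContDiff ℝ ∞ f) {L : NNReal}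
    (hL : LipschitzWith L f) (hL1 : L < 1) :
    ∃ g : E → E, ContDiff ℝ ∞ g ∧
      ∀ c : ℝ → E, (∀ t, HasDerivAt c (f (c t)) t) → c 1 = g (c 0) := by
  -- A solution u of the differential equation starting at x satisfies u - N u = const x. As N is a
  -- contraction, u ↦ u - N u is a homeomorphism; its derivative 1 - DN is invertible by the Neumann
  -- series, so the inverse is smooth. The time one map is evaluation at 1 of the inverse applied to
  -- constants.
  set N : C(Icc (0 : ℝ) 1, E) → C(Icc (0 : ℝ) 1, E) :=
    fun u => unitPrimitive ((⟨f, hf.continuous⟩ : C(E, E)).comp u) with hN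
  have hNsm : ContDiff ℝ ∞ N := unitPrimitive.contDiff.comp (contDiff_postcomp hf)
  have hNL : LipschitzWith L N := by
    refine LipschitzWith.of_dist_le_mul fun u v => ?_
    rw [dist_eq_norm, dist_eq_norm, hN]
    simp only
    rw [← map_sub]
    refine (norm_unitPrimitive_le _).trans ((ContinuousMap.norm_le _ (by positivity)).2 fun x => ?_)
    have := hL.dist_le_mul (u x) (v x)
    rw [dist_eq_norm, dist_eq_norm] at this
    exact this.trans (by gcongr; exact (u - v).norm_coe_le_norm x)
  set H : C(Icc (0 : ℝ) 1, E) → C(Icc (0 : ℝ) 1, E) := fun u => u - N u with hH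
  have hHsm : ContDiff ℝ ∞ H := contDiff_id.sub hNsm
  have happ : ApproximatesLinearOn H
      ((ContinuousLinearEquiv.refl ℝ C(Icc (0 : ℝ) 1, E) :
        C(Icc (0 : ℝ) 1, E) ≃L[ℝ] C(Icc (0 : ℝ) 1, E)) :
        C(Icc (0 : ℝ) 1, E) →L[ℝ] C(Icc (0 : ℝ) 1, E)) univ L := by
    intro u _ v _
    have := hNL.dist_le_mul u v
    rw [dist_eq_norm, dist_eq_norm] at this
    have e : H u - H v - (u - v) = -(N u - N v) := by rw [hH]; simp only; abel
    rw [ContinuousLinearEquiv.coe_refl, ContinuousLinearMap.id_apply, e, norm_neg]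
    exact this
  have hc : Subsingleton C(Icc (0 : ℝ) 1, E) ∨
      L < ‖((ContinuousLinearEquiv.refl ℝ C(Icc (0 : ℝ) 1, E)).symm :
        C(Icc (0 : ℝ) 1, E) →L[ℝ] C(Icc (0 : ℝ) 1, E))‖₊⁻¹ := by
    rcases subsingleton_or_nontrivial C(Icc (0 : ℝ) 1, E) with h | h
    · exact Or.inl h
    · right
      have : ‖((ContinuousLinearEquiv.refl ℝ C(Icc (0 : ℝ) 1, E)).symm :
        C(Icc (0 : ℝ) 1, E) →L[ℝ] C(Icc (0 : ℝ) 1, E))‖₊ = 1 := by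
        ext; exact ContinuousLinearMap.norm_id
      rw [this]; simpa using hL1
  set Hh := happ.toHomeomorph H hc with hHh
  have hHh_coe : ∀ u, Hh u = H u := fun u => rfl
  have hder : ∀ u, ∃ A : C(Icc (0 : ℝ) 1, E) ≃L[ℝ] C(Icc (0 : ℝ) 1, E),
      HasFDerivAt H (A : C(Icc (0 : ℝ) 1, E) →L[ℝ] C(Icc (0 : ℝ) 1, E)) u := by
    intro u
    have hn : ‖fderiv ℝ N u‖ < 1 :=
      (norm_fderiv_le_of_lipschitz ℝ hNL).trans_lt (by exact_mod_cast hL1)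
    refine ⟨ContinuousLinearEquiv.ofUnit (Units.oneSub (fderiv ℝ N u) hn), ?_⟩
    exact (hasFDerivAt_id u).sub (hNsm.differentiable (by simp) u).hasFDerivAt
  choose A hA using hder
  have hsymm : ContDiff ℝ ∞ Hh.symm := Hh.contDiff_symm (f₀' := A) hA hHsm
  refine ⟨fun x => Hh.symm (ContinuousMap.const _ x) ⟨1, by simp⟩, ?_, fun c hc => ?_⟩
  · have h1 : ContDiff ℝ ∞ (fun x : E => ContinuousMap.const (Icc (0 : ℝ) 1) x) := by
      refine IsBoundedLinearMap.contDiff ⟨⟨fun x y => rfl, fun a x => rfl⟩, 1, one_pos, fun x => ?_⟩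
      rw [one_mul]
      exact (ContinuousMap.norm_le _ (norm_nonneg _)).2 fun _ => le_rfl
    exact (ContinuousMap.evalCLM ℝ (⟨1, by simp⟩ : Icc (0 : ℝ) 1)).contDiff.comp (hsymm.comp h1)
  · have hcc : Continuous c := continuous_iff_continuousAt.2 fun t => (hc t).continuousAt
    set u : C(Icc (0 : ℝ) 1, E) := ⟨fun t => c t, hcc.comp continuous_subtype_val⟩ with hu
    have hHu : Hh u = ContinuousMap.const _ (c 0) := by
      rw [hHh_coe]
      ext t
      simp only [hH, hN, ContinuousMap.sub_apply, unitPrimitive_apply, ContinuousMap.const_apply]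
      have h1 : ∫ r in (0 : ℝ)..t, ((⟨f, hf.continuous⟩ : C(E, E)).comp u) (projIcc 0 1 zero_le_one r)
          = ∫ r in (0 : ℝ)..t, f (c r) := by
        refine intervalIntegral.integral_congr fun r hr => ?_
        rw [uIcc_of_le t.2.1] at hr
        simp [hu, projIcc_of_mem zero_le_one (⟨hr.1, hr.2.trans t.2.2⟩ : r ∈ Icc (0 : ℝ) 1)]
      rw [h1, intervalIntegral.integral_eq_sub_of_hasDerivAt (fun r _ => hc r)
        ((hf.continuous.comp hcc).intervalIntegrable _ _)]
      simp [hu]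
    change c 1 = Hh.symm (ContinuousMap.const _ (c 0)) ⟨1, by simp⟩
    rw [← hHu, Homeomorph.symm_apply_apply]
    rfl

theorem solution_unique_of_lipschitz {f : E → E} {L : NNReal} (hL : LipschitzWith L f)
    {c d : ℝ → E} (hc : ∀ t, HasDerivAt c (f (c t)) t) (hd : ∀ t, HasDerivAt d (f (d t)) t)
    {t₀ : ℝ} (h : c t₀ = d t₀) : c = d :=
  ODE_solution_unique_univ (v := fun _ => f) (s := fun _ => univ) (K := L)
    (fun _ => hL.lipschitzOnWith) (fun t => ⟨hc t, trivial⟩) (fun t => ⟨hd t, trivial⟩) h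

/-- The bound B keeps solutions within distance B|T| up to time |T|, so Picard–Lindelöf applies on
any prescribed interval; uniqueness patches the solutions together. -/
theorem exists_global_solution [CompleteSpace E] {f : E → E} {L : NNReal} (hL : LipschitzWith L f)
    {B : NNReal} (hB : ∀ x, ‖f x‖ ≤ B) (x : E) :
    ∃ c : ℝ → E, c 0 = x ∧ ∀ t, HasDerivAt c (f (c t)) t := by
  have hloc : ∀ T : ℝ, ∃ c : ℝ → E, c 0 = x ∧
      ∀ t ∈ Ioo (-(|T|)) (|T|), HasDerivAt c (f (c t)) t := by
    intro T
    have hPL : IsPicardLindelof (fun _ => f) (tmin := -|T|) (tmax := |T|) ⟨0, by simp⟩ x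
        (B * ‖T‖₊) 0 B L :=
      { lipschitzOnWith := fun t _ => hL.lipschitzOnWith
        continuousOn := fun y _ => continuousOn_const
        norm_le := fun t _ y _ => hB y
        mul_max_le := by simp }
    obtain ⟨c, hc0, hc⟩ := hPL.exists_eq_forall_mem_Icc_hasDerivWithinAt (x := x) (by simp)
    exact ⟨c, hc0, fun t ht => (hc t (Ioo_subset_Icc_self ht)).hasDerivAt (Icc_mem_nhds ht.1 ht.2)⟩
  choose c hc0 hc using hloc
  have hagree : ∀ S T t : ℝ, |t| < |S| → |t| < |T| → c S t = c T t := by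
    have aux : ∀ S T t : ℝ, |t| < |S| → |S| ≤ |T| → c S t = c T t := by
      intro S T t hS hST
      have hS0 : 0 < |S| := (abs_nonneg t).trans_lt hS
      exact ODE_solution_unique_of_mem_Ioo (v := fun _ => f) (s := fun _ => univ) (K := L)
        (fun _ _ => hL.lipschitzOnWith) (t₀ := 0) (a := -|S|) (b := |S|) (by simpa using hS0)
        (fun t ht => ⟨hc S t ht, trivial⟩)
        (fun t ht => ⟨hc T t (Ioo_subset_Ioo (by linarith) hST ht), trivial⟩)
        (by rw [hc0, hc0]) (abs_lt.1 hS)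
    intro S T t hS hT
    rcases le_total |S| |T| with h | h
    · exact aux S T t hS h
    · exact (aux T S t hT h).symm
  refine ⟨fun t => c (|t| + 1) t, hc0 _, fun t => ?_⟩
  have hlt : |t| < |(|t| + 1)| := by rw [abs_of_pos (a := |_| + 1) (by positivity)]; linarith
  refine (hc (|t| + 1) t (abs_lt.1 hlt)).congr_of_eventuallyEq ?_
  have hopen : ∀ᶠ s in 𝓝 t, |s| < |(|t| + 1)| := continuous_abs.continuousAt.eventually_lt_const hlt
  filter_upwards [hopen] with s hs
  exact hagree _ _ _ (by rw [abs_of_pos (a := |_| + 1) (by positivity)]; linarith) hs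

/-- A bounded, globally Lipschitz smooth vector field on a Banach space has a smooth global flow. -/
theorem exists_smooth_flow [CompleteSpace E] {f : E → E} (hf : ContDiff ℝ ∞ f) {L : NNReal}
    (hL : LipschitzWith L f) {B : NNReal} (hB : ∀ x, ‖f x‖ ≤ B) :
    ∃ Φ : ℝ → E → E, ContDiff ℝ ∞ (fun p : ℝ × E => Φ p.1 p.2) ∧ (∀ x, Φ 0 x = x) ∧
      ∀ t x, HasDerivAt (fun s => Φ s x) (f (Φ t x)) t := by
  choose c hc0 hc using exists_global_solution hL hB
  have hgroup : ∀ s t x, c x (s + t) = c (c x t) s := by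
    intro s t x
    have := solution_unique_of_lipschitz hL (c := fun s => c x (s + t)) (d := c (c x t))
      (fun s => by simpa using (hc x (s + t)).comp_add_const s t) (hc _) (t₀ := 0)
      (by simp [hc0])
    exact congrFun this s
  -- This makes ε(B + L) ≤ 1/2, the Lipschitz constant needed for the field F below.
  set ε : ℝ := 1 / (2 * (B + L + 1)) with hε
  have hε0 : 0 < ε := by positivity
  have hshort : ∀ t x, |t| < ε → ContDiffAt ℝ ∞ (fun p : ℝ × E => c p.2 p.1) (t, x) := by
    -- Time is turned into a parameter: with s frozen, the time one map of ε sin(s) f is the flow of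
    -- f for time ε sin(s). The sine, unlike s itself, keeps F globally Lipschitz, and arcsin undoes
    -- it for |t| < ε.
    set F : ℝ × E → ℝ × E := fun p => (0, (ε * Real.sin p.1) • f p.2) with hF
    have hFsm : ContDiff ℝ ∞ F := by
      refine contDiff_const.prodMk (ContDiff.smul ?_ (hf.comp contDiff_snd))
      exact contDiff_const.mul (Real.contDiff_sin.comp contDiff_fst)
    have hFL : LipschitzWith (1 / 2) F := by
      refine LipschitzWith.of_dist_le_mul fun p q => ?_
      rw [dist_eq_norm, dist_eq_norm]
      have e : F p - F q = (0, (ε * Real.sin p.1) • (f p.2 - f q.2) +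
          (ε * (Real.sin p.1 - Real.sin q.1)) • f q.2) := by
        simp only [hF, Prod.mk_sub_mk, sub_zero, Prod.mk.injEq, true_and]
        module
      have h1 : ‖f p.2 - f q.2‖ ≤ L * ‖p - q‖ := by
        have := hL.dist_le_mul p.2 q.2
        rw [dist_eq_norm, dist_eq_norm] at this
        exact this.trans (by gcongr; exact norm_snd_le (p - q))
      have h2 : |Real.sin p.1 - Real.sin q.1| ≤ ‖p - q‖ := by
        have := Real.lipschitzWith_sin.dist_le_mul p.1 q.1
        rw [Real.dist_eq, dist_eq_norm] at this
        simp only [NNReal.coe_one, one_mul] at this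
        exact this.trans (norm_fst_le (p - q))
      rw [e, Prod.norm_mk, norm_zero, max_eq_right (norm_nonneg _)]
      calc _ ≤ ‖(ε * Real.sin p.1) • (f p.2 - f q.2)‖ +
            ‖(ε * (Real.sin p.1 - Real.sin q.1)) • f q.2‖ := norm_add_le _ _
        _ = ε * |Real.sin p.1| * ‖f p.2 - f q.2‖ +
            ε * |Real.sin p.1 - Real.sin q.1| * ‖f q.2‖ := by
          rw [norm_smul, norm_smul, norm_mul, norm_mul, Real.norm_of_nonneg hε0.le,
            Real.norm_eq_abs, Real.norm_eq_abs]
        _ ≤ ε * 1 * (L * ‖p - q‖) + ε * ‖p - q‖ * B := by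
          gcongr
          · exact Real.abs_sin_le_one _
          · exact hB _
        _ = ε * (B + L) * ‖p - q‖ := by ring
        _ ≤ ((1 / 2 : NNReal) : ℝ) * ‖p - q‖ := by
          gcongr
          rw [hε]
          push_cast
          rw [div_mul_eq_mul_div, one_mul, div_le_div_iff₀ (by positivity) (by positivity)]
          linarith
    obtain ⟨g, hg, hgc⟩ := exists_contDiff_time_one hFsm hFL
      (by rw [← NNReal.coe_lt_coe]; push_cast; norm_num)
    have hgv : ∀ s x, c x (ε * Real.sin s) = (g (s, x)).2 := by
      intro s x
      have := hgc (fun r => (s, c x (ε * Real.sin s * r))) (fun r => by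
        have h1 := (hc x (ε * Real.sin s * r)).scomp r
          ((hasDerivAt_id r).const_mul (ε * Real.sin s))
        simp only [mul_one] at h1
        exact (hasDerivAt_const r s).prodMk h1)
      simp only [mul_one, mul_zero, hc0] at this
      rw [← this]
    intro t x ht
    have harc : ∀ s : ℝ, |s| < ε → -1 < s / ε ∧ s / ε < 1 := fun s hs => by
      rw [← abs_lt, abs_div, abs_of_pos hε0, div_lt_one hε0]; exact hs
    have hloc : (fun p : ℝ × E => c p.2 p.1) =ᶠ[𝓝 (t, x)]
        fun p => (g (Real.arcsin (p.1 / ε), p.2)).2 := by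
      have : ∀ᶠ p : ℝ × E in 𝓝 (t, x), |p.1| < ε :=
        (continuous_abs.comp continuous_fst).continuousAt.eventually_lt_const ht
      filter_upwards [this] with p hp
      rw [← hgv, Real.sin_arcsin (harc _ hp).1.le (harc _ hp).2.le, mul_div_cancel₀ _ hε0.ne']
    refine ContDiffAt.congr_of_eventuallyEq ?_ hloc
    have h1 : ContDiffAt ℝ ∞ (fun p : ℝ × E => Real.arcsin (p.1 / ε)) (t, x) :=
      ContDiffAt.comp (g := Real.arcsin) (t, x)
        (Real.contDiffAt_arcsin (harc t ht).1.ne' (harc t ht).2.ne) (contDiffAt_fst.div_const ε)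
    exact contDiffAt_snd.comp _ (hg.contDiffAt.comp (t, x) (h1.prodMk contDiffAt_snd))
  have hfix_short : ∀ t, |t| < ε → ContDiff ℝ ∞ (fun x => c x t) := fun t ht =>
    contDiff_iff_contDiffAt.2 fun x =>
      (hshort t x ht).comp x (contDiffAt_const.prodMk contDiffAt_id)
  have hmul : ∀ t, |t| < ε → ∀ n : ℕ, ContDiff ℝ ∞ (fun x => c x (n * t)) := by
    intro t ht n
    induction n with
    | zero => simpa [hc0] using contDiff_fun_id
    | succ n ih =>
      have : (fun x => c x ((n + 1 : ℕ) * t)) = fun x => c (c x t) (n * t) := by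
        ext x; rw [← hgroup]; congr 1; push_cast; ring
      rw [this]
      exact ih.comp (hfix_short t ht)
  have hfix : ∀ t, ContDiff ℝ ∞ (fun x => c x t) := by
    intro t
    obtain ⟨n, hn⟩ := exists_nat_gt (|t| / ε)
    have hn0 : (0 : ℝ) < n := lt_of_le_of_lt (by positivity) hn
    have := hmul (t / n) (by
      rw [abs_div, Nat.abs_cast, div_lt_iff₀ hn0]; rwa [div_lt_iff₀ hε0, mul_comm] at hn) n
    rwa [mul_div_cancel₀ _ hn0.ne'] at this
  refine ⟨fun t x => c x t, contDiff_iff_contDiffAt.2 fun p => ?_, hc0, fun t x => hc x t⟩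
  -- Joint smoothness near time p.1 follows from the group law: flow for the fixed time p.1, then
  -- for the short time q.1 - p.1.
  have : (fun q : ℝ × E => c q.2 q.1) = (fun q : ℝ × E => c q.2 q.1) ∘
      fun q : ℝ × E => (q.1 - p.1, c q.2 p.1) := by
    ext q; simp only [Function.comp_apply]; rw [← hgroup]; simp
  simp only
  rw [this]
  refine ContDiffAt.comp p ?_ ?_
  · rw [sub_self]; exact hshort 0 _ (by simpa using hε0)
  · exact (contDiffAt_fst.sub contDiffAt_const).prodMk
      ((hfix p.1).contDiffAt.comp p contDiffAt_snd)

end Flow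


/-! ### Variational equation and local dependence on initial values. -/

section FlowTools

variable {E : Type u} [NormedAddCommGroup E] [NormedSpace ℝ E]

/-- The derivative of a smooth flow in a space direction solves the variational equation. -/
theorem hasDerivAt_fderiv_flow {f : E → E} (hf : ContDiff ℝ ∞ f) {Φ : ℝ → E → E}
    (hΦ : ContDiff ℝ ∞ (fun p : ℝ × E => Φ p.1 p.2))
    (hode : ∀ t x, HasDerivAt (fun s => Φ s x) (f (Φ t x)) t) (x ξ : E) (t : ℝ) :
    HasDerivAt (fun s => fderiv ℝ (fun p : ℝ × E => Φ p.1 p.2) (s, x) (0, ξ))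
      (fderiv ℝ f (Φ t x) (fderiv ℝ (fun p : ℝ × E => Φ p.1 p.2) (t, x) (0, ξ))) t := by
  set F : ℝ × E → E := fun p => Φ p.1 p.2 with hF
  have hFd : Differentiable ℝ F := hΦ.differentiable (by simp)
  have hF' : ContDiff ℝ ∞ (fderiv ℝ F) := hΦ.fderiv_right (by simp)
  have hF'd : Differentiable ℝ (fderiv ℝ F) := hF'.differentiable (by simp)
  have htime : ∀ p : ℝ × E, fderiv ℝ F p (1, 0) = f (F p) := by
    rintro ⟨s, y⟩
    have h1 : HasDerivAt (fun s : ℝ => (s, y)) ((1 : ℝ), (0 : E)) s :=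
      (hasDerivAt_id s).prodMk (hasDerivAt_const s y)
    have h2 : HasDerivAt (fun s => Φ s y) (fderiv ℝ F (s, y) (1, 0)) s :=
      HasFDerivAt.comp_hasDerivAt (l := F) s (hFd (s, y)).hasFDerivAt h1
    exact h2.unique (hode s y)
  have h1 : HasDerivAt (fun s : ℝ => (s, x)) ((1 : ℝ), (0 : E)) t :=
    (hasDerivAt_id t).prodMk (hasDerivAt_const t x)
  have h2 : HasDerivAt (fun s => fderiv ℝ F (s, x) (0, ξ))
      (fderiv ℝ (fderiv ℝ F) (t, x) (1, 0) (0, ξ)) t := by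
    have h3 : HasDerivAt (fun s => fderiv ℝ F (s, x)) (fderiv ℝ (fderiv ℝ F) (t, x) (1, 0)) t :=
      HasFDerivAt.comp_hasDerivAt (l := fderiv ℝ F) t (hF'd (t, x)).hasFDerivAt h1
    simpa using h3.clm_apply (hasDerivAt_const t ((0 : ℝ), ξ))
  -- Symmetry of the second derivative exchanges the time derivative with the derivative in the
  -- direction ξ.
  have hsymm : fderiv ℝ (fderiv ℝ F) (t, x) (1, 0) (0, ξ) =
      fderiv ℝ (fderiv ℝ F) (t, x) (0, ξ) (1, 0) :=
    (hΦ.contDiffAt.isSymmSndFDerivAt (by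
      rw [minSmoothness_of_isRCLikeNormedField]; exact WithTop.coe_le_coe.2 le_top)) (1, 0) (0, ξ)
  have h3 : fderiv ℝ (fun p => fderiv ℝ F p (1, 0)) (t, x) (0, ξ) =
      fderiv ℝ (fderiv ℝ F) (t, x) (0, ξ) (1, 0) := by
    rw [fderiv_clm_apply (hF'd _) (differentiableAt_const _)]
    simp
  have h4 : fderiv ℝ (fun p => fderiv ℝ F p (1, 0)) (t, x) (0, ξ) =
      fderiv ℝ f (Φ t x) (fderiv ℝ F (t, x) (0, ξ)) := by
    rw [funext htime]
    exact congrArg (fun A : ℝ × E →L[ℝ] E => A (0, ξ))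
      (((hf.differentiable (by simp) (F (t, x))).hasFDerivAt.comp (t, x)
        (hFd (t, x)).hasFDerivAt).fderiv)
  rw [← h4, h3, ← hsymm]
  exact h2

theorem fderiv_flow_zero {Φ : ℝ → E → E}
    (hΦ : ContDiff ℝ ∞ (fun p : ℝ × E => Φ p.1 p.2)) (h0 : ∀ x, Φ 0 x = x) (x ξ : E) :
    fderiv ℝ (fun p : ℝ × E => Φ p.1 p.2) (0, x) (0, ξ) = ξ := by
  have h1 : HasFDerivAt (fun y : E => ((0 : ℝ), y)) (ContinuousLinearMap.inr ℝ ℝ E) x :=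
    hasFDerivAt_prodMk_right 0 x
  have h2 := (hΦ.differentiable (by simp) (0, x)).hasFDerivAt.comp x h1
  have h3 : (fun p : ℝ × E => Φ p.1 p.2) ∘ (fun y : E => ((0 : ℝ), y)) = id := by
    ext y; simp [h0]
  rw [h3] at h2
  have := congrArg (fun A : E →L[ℝ] E => A ξ) (h2.unique (hasFDerivAt_id x))
  simpa using this

variable [FiniteDimensional ℝ E]

/-- Uniqueness of solutions on a closed interval for a `C¹` autonomous equation. -/
theorem solution_unique_Icc {f : E → E} (hf : ContDiff ℝ 1 f) {T : ℝ} {c d : ℝ → E}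
    (hc : ∀ t ∈ Icc 0 T, HasDerivWithinAt c (f (c t)) (Icc 0 T) t)
    (hd : ∀ t ∈ Icc 0 T, HasDerivWithinAt d (f (d t)) (Icc 0 T) t) (h : c 0 = d 0) :
    EqOn c d (Icc 0 T) := by
  have hcc : ContinuousOn c (Icc 0 T) := fun t ht => (hc t ht).continuousWithinAt
  have hdc : ContinuousOn d (Icc 0 T) := fun t ht => (hd t ht).continuousWithinAt
  obtain ⟨R₁, hR₁⟩ := isCompact_Icc.exists_bound_of_continuousOn hcc
  obtain ⟨R₂, hR₂⟩ := isCompact_Icc.exists_bound_of_continuousOn hdc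
  set R := max R₁ R₂ with hR
  obtain ⟨K, hK⟩ := (isCompact_closedBall (0 : E) R).exists_bound_of_continuousOn
    (hf.continuous_fderiv one_ne_zero).continuousOn
  have hlip : LipschitzOnWith K.toNNReal f (Metric.closedBall 0 R) :=
    (convex_closedBall (0 : E) R).lipschitzOnWith_of_nnnorm_fderiv_le
      (fun x _ => hf.differentiable one_ne_zero x) fun x hx => by
        rw [← NNReal.coe_le_coe, coe_nnnorm]
        exact (hK x hx).trans (Real.le_coe_toNNReal K)
  have hIci : ∀ {e : ℝ → E}, (∀ t ∈ Icc 0 T, HasDerivWithinAt e (f (e t)) (Icc 0 T) t) →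
      ∀ t ∈ Ico 0 T, HasDerivWithinAt e (f (e t)) (Ici t) t := fun he t ht =>
    (he t (Ico_subset_Icc_self ht)).mono_of_mem_nhdsWithin
      (mem_of_superset (Icc_mem_nhdsGE ht.2) (Icc_subset_Icc_left ht.1))
  exact ODE_solution_unique_of_mem_Icc_right (v := fun _ => f)
    (s := fun _ => Metric.closedBall 0 R) (fun _ _ => hlip) hcc (hIci hc)
    (fun t ht => mem_closedBall_zero_iff.2
      ((hR₁ t (Ico_subset_Icc_self ht)).trans (le_max_left _ _))) hdc (hIci hd)
    (fun t ht => mem_closedBall_zero_iff.2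
      ((hR₂ t (Ico_subset_Icc_self ht)).trans (le_max_right _ _))) h

/-- Smooth dependence of the time one value on the initial value, near a solution which exists on
`[0, 1]`; the derivative is given by the variational equation. -/
theorem exists_local_time_one_map {f : E → E} (hf : ContDiff ℝ ∞ f) {c : ℝ → E}
    (hc : ∀ t ∈ Icc (0 : ℝ) 1, HasDerivWithinAt c (f (c t)) (Icc 0 1) t) :
    ∃ U ∈ 𝓝 (c 0), ∃ G : E → E, ContDiff ℝ ∞ G ∧
      (∀ d : ℝ → E, d 0 ∈ U → (∀ t ∈ Icc (0 : ℝ) 1, HasDerivWithinAt d (f (d t)) (Icc 0 1) t) →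
        G (d 0) = d 1) ∧
      ∀ ξ, ∃ ζ : ℝ → E, ζ 0 = ξ ∧ ζ 1 = fderiv ℝ G (c 0) ξ ∧
        ∀ t ∈ Icc (0 : ℝ) 1, HasDerivAt ζ (fderiv ℝ f (c t) (ζ t)) t := by
  have hcc : ContinuousOn c (Icc 0 1) := fun t ht => (hc t ht).continuousWithinAt
  obtain ⟨R₀, hR₀⟩ := isCompact_Icc.exists_bound_of_continuousOn hcc
  set R := max R₀ 0 + 1 with hR
  have hRpos : 0 < R := by positivity
  -- R exceeds the norm of the curve by at least one, which leaves room for neighbouring orbits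
  -- inside the ball where F = f.
  let χ : ContDiffBump (0 : E) := ⟨R, R + 1, hRpos, by linarith⟩
  set F : E → E := fun x => χ x • f x with hF
  have hFsm : ContDiff ℝ ∞ F := χ.contDiff.smul hf
  have hFsupp : HasCompactSupport F := χ.hasCompactSupport.smul_right
  have hFeq : ∀ x, ‖x‖ ≤ R → F x = f x := fun x hx => by
    rw [hF]; simp only
    rw [χ.one_of_mem_closedBall (mem_closedBall_zero_iff.2 hx), one_smul]
  obtain ⟨L, hL⟩ := hFsm.lipschitzWith_of_hasCompactSupport hFsupp (by simp)
  obtain ⟨B, hB⟩ := hFsupp.exists_bound_of_continuous hFsm.continuous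
  obtain ⟨Φ, hΦ, hΦ0, hΦode⟩ := exists_smooth_flow hFsm hL (B := B.toNNReal)
    (fun x => (hB x).trans (Real.le_coe_toNNReal B))
  have hcF : ∀ t ∈ Icc (0 : ℝ) 1, HasDerivWithinAt c (F (c t)) (Icc 0 1) t := fun t ht => by
    rw [hFeq _ ((hR₀ t ht).trans (by rw [hR]; linarith [le_max_left R₀ 0]))]; exact hc t ht
  have hΦc : EqOn (fun t => Φ t (c 0)) c (Icc 0 1) :=
    solution_unique_Icc (hFsm.of_le (by simp)) (fun t _ => (hΦode t _).hasDerivWithinAt) hcF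
      (hΦ0 _)
  have hball : ∀ t ∈ Icc (0 : ℝ) 1, ‖Φ t (c 0)‖ < R := fun t ht => by
    have : Φ t (c 0) = c t := hΦc ht
    rw [this]
    exact (hR₀ t ht).trans_lt (by rw [hR]; linarith [le_max_left R₀ 0])
  -- U consists of the initial values whose cut-off orbit stays in the ball; it is a neighbourhood
  -- because [0, 1] is compact. Such an orbit solves the original equation, so uniqueness identifies
  -- it with d without any a priori bound on d.
  refine ⟨{y | ∀ t ∈ Icc (0 : ℝ) 1, ‖Φ t y‖ < R}, ?_, Φ 1, ?_, ?_, ?_⟩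
  · refine isCompact_Icc.eventually_forall_of_forall_eventually (x₀ := c 0)
      (P := fun y t => ‖Φ t y‖ < R) fun t ht => ?_
    have : Continuous fun z : E × ℝ => ‖Φ z.2 z.1‖ :=
      (hΦ.continuous.comp continuous_swap).norm
    exact this.continuousAt.eventually_lt_const (hball t ht)
  · exact hΦ.comp (contDiff_const.prodMk contDiff_id)
  · intro d hd0 hd
    have : EqOn (fun t => Φ t (d 0)) d (Icc 0 1) := by
      refine solution_unique_Icc (hf.of_le (by simp)) (fun t ht => ?_) hd (hΦ0 _)
      rw [← hFeq _ (hd0 t ht).le]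
      exact (hΦode t _).hasDerivWithinAt
    exact this (right_mem_Icc.2 zero_le_one)
  · intro ξ
    refine ⟨fun t => fderiv ℝ (fun p : ℝ × E => Φ p.1 p.2) (t, c 0) (0, ξ),
      fderiv_flow_zero hΦ hΦ0 _ _, ?_, fun t ht => ?_⟩
    · have h1 : HasFDerivAt (fun y : E => ((1 : ℝ), y)) (ContinuousLinearMap.inr ℝ ℝ E) (c 0) :=
        hasFDerivAt_prodMk_right 1 (c 0)
      have h2 := (hΦ.differentiable (by simp) (1, c 0)).hasFDerivAt.comp (c 0) h1
      have h3 : HasFDerivAt (Φ 1) _ (c 0) := h2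
      rw [h3.fderiv]; simp
    · have := hasDerivAt_fderiv_flow hFsm hΦ hΦode (c 0) ξ t
      have hc' : Φ t (c 0) = c t := hΦc ht
      have heq : F =ᶠ[𝓝 (c t)] f := by
        have : ∀ᶠ x : E in 𝓝 (c t), ‖x‖ < R :=
          continuous_norm.continuousAt.eventually_lt_const (hc' ▸ hball t ht)
        filter_upwards [this] with x hx using hFeq x hx.le
      rw [hc', heq.fderiv_eq] at this
      exact this

end FlowTools

/-! ### Parameter integrals with estimates uniform in the weight. -/

section WeightedIntegral

variable {E : Type u} [NormedAddCommGroup E] [NormedSpace ℝ E] [FiniteDimensional ℝ E]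
  {Y : Type*} [NormedAddCommGroup Y] [MeasurableSpace Y] [OpensMeasurableSpace Y]
  [SecondCountableTopology Y] {μ : Measure Y} {C : Set Y}

theorem integrable_weighted {F : Type*} [NormedAddCommGroup F] [NormedSpace ℂ F] {k : Y → F}
    (hk : Continuous k) (hC : IsCompact C) (hμ : ∀ᵐ y ∂μ, y ∈ C) {w : Y → ℂ}
    (hw : Integrable w μ) : Integrable (fun y => w y • k y) μ := by
  obtain ⟨B, hB⟩ := hC.exists_bound_of_continuousOn hk.continuousOn
  exact hw.smul_bdd B hk.aestronglyMeasurable (hμ.mono fun y hy => hB y hy)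

variable [NormedSpace ℝ Y]

/-- The measure is carried by the compact set C, so for x in a closed ball the derivative of the
integrand is dominated by a multiple of |w|. -/
theorem hasFDerivAt_weighted {F : Type*} [NormedAddCommGroup F] [NormedSpace ℝ F] [NormedSpace ℂ F]
    [SMulCommClass ℝ ℂ F] {k : E × Y → F} (hk : ContDiff ℝ 1 k) (hC : IsCompact C)
    (hμ : ∀ᵐ y ∂μ, y ∈ C) {w : Y → ℂ} (hw : Integrable w μ) (x₀ : E) :
    HasFDerivAt (fun x => ∫ y, w y • k (x, y) ∂μ)
      (∫ y, w y • (fderiv ℝ k (x₀, y)).comp (ContinuousLinearMap.inl ℝ E Y) ∂μ) x₀ := by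
  have hk' : Continuous fun p : E × Y =>
      (fderiv ℝ k p).comp (ContinuousLinearMap.inl ℝ E Y) :=
    (hk.continuous_fderiv one_ne_zero).clm_comp continuous_const
  obtain ⟨B, hB⟩ := ((isCompact_closedBall x₀ 1).prod hC).exists_bound_of_continuousOn
    hk'.continuousOn
  have hkx : ∀ x, Continuous fun y => k (x, y) := fun x =>
    hk.continuous.comp (Continuous.prodMk_right x)
  refine hasFDerivAt_integral_of_dominated_of_fderiv_le (Metric.closedBall_mem_nhds x₀ one_pos)
    (F' := fun x y => w y • (fderiv ℝ k (x, y)).comp (ContinuousLinearMap.inl ℝ E Y))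
    (bound := fun y => ‖w y‖ * B)
    (Eventually.of_forall fun x => (integrable_weighted (hkx x) hC hμ hw).aestronglyMeasurable)
    (integrable_weighted (hkx x₀) hC hμ hw)
    (integrable_weighted (hk'.comp (Continuous.prodMk_right x₀)) hC hμ hw).aestronglyMeasurable
    (hμ.mono fun y hy x hx => ?_) (hw.norm.mul_const B) (Eventually.of_forall fun y x _ => ?_)
  · rw [norm_smul]
    exact mul_le_mul_of_nonneg_left (hB (x, y) ⟨hx, hy⟩) (norm_nonneg _)
  · have h1 : HasFDerivAt (fun x : E => (x, y)) (ContinuousLinearMap.inl ℝ E Y) x :=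
      hasFDerivAt_prodMk_left x y
    exact ((hk.differentiable one_ne_zero (x, y)).hasFDerivAt.comp x h1).const_smul (w y)

/-- The constant B is chosen before the weight w; this uniformity is the source of the smoothing
estimate. Differentiation in x yields an integral of the same kind with kernel ∂_x k, which drives
the induction. -/
theorem contDiff_weighted_nat (hC : IsCompact C) (hμ : ∀ᵐ y ∂μ, y ∈ C) {S : Set E}
    (hS : IsCompact S) (n : ℕ) : ∀ {F : Type u} [NormedAddCommGroup F] [NormedSpace ℝ F]
    [NormedSpace ℂ F] [SMulCommClass ℝ ℂ F] {k : E × Y → F} (_ : ContDiff ℝ ∞ k),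
    (∀ {w : Y → ℂ}, Integrable w μ → ContDiff ℝ n (fun x => ∫ y, w y • k (x, y) ∂μ)) ∧
    ∃ B : ℝ, ∀ {w : Y → ℂ}, Integrable w μ → ∀ x ∈ S,
      ‖iteratedFDeriv ℝ n (fun x => ∫ y, w y • k (x, y) ∂μ) x‖ ≤ B * ∫ y, ‖w y‖ ∂μ := by
  induction n with
  | zero =>
    intro F _ _ _ _ k hk
    refine ⟨fun {w} hw => contDiff_zero.2 (continuous_iff_continuousAt.2 fun x =>
      (hasFDerivAt_weighted (hk.of_le (by simp)) hC hμ hw x).continuousAt), ?_⟩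
    obtain ⟨B, hB⟩ := (hS.prod hC).exists_bound_of_continuousOn hk.continuous.continuousOn
    refine ⟨B, fun {w} hw x hx => ?_⟩
    rw [norm_iteratedFDeriv_zero, mul_comm, ← integral_mul_const]
    refine norm_integral_le_of_norm_le (hw.norm.mul_const B) (hμ.mono fun y hy => ?_)
    rw [norm_smul]
    exact mul_le_mul_of_nonneg_left (hB (x, y) ⟨hx, hy⟩) (norm_nonneg _)
  | succ n ih =>
    intro F _ _ _ _ k hk
    have hk' : ContDiff ℝ ∞ fun p : E × Y =>
        (fderiv ℝ k p).comp (ContinuousLinearMap.inl ℝ E Y) :=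
      (hk.fderiv_right (by simp)).clm_comp contDiff_const
    obtain ⟨ih1, B, hB⟩ := ih hk'
    have hd : ∀ {w : Y → ℂ}, Integrable w μ → ∀ x, HasFDerivAt (fun x => ∫ y, w y • k (x, y) ∂μ)
      (∫ y, w y • (fderiv ℝ k (x, y)).comp (ContinuousLinearMap.inl ℝ E Y) ∂μ) x :=
      fun hw x => hasFDerivAt_weighted (hk.of_le (by simp)) hC hμ hw x
    refine ⟨fun {w} hw => ?_, B, fun {w} hw x hx => ?_⟩
    · push_cast
      rw [contDiff_succ_iff_fderiv]
      refine ⟨fun x => (hd hw x).differentiableAt, by simp, ?_⟩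
      rw [funext fun x => (hd hw x).fderiv]
      exact ih1 hw
    · rw [← norm_iteratedFDeriv_fderiv, funext fun x => (hd hw x).fderiv]
      exact hB hw x hx

theorem contDiff_weighted {F : Type u} [NormedAddCommGroup F] [NormedSpace ℝ F]
    [NormedSpace ℂ F] [SMulCommClass ℝ ℂ F] {k : E × Y → F} (hk : ContDiff ℝ ∞ k)
    (hC : IsCompact C) (hμ : ∀ᵐ y ∂μ, y ∈ C) {w : Y → ℂ} (hw : Integrable w μ) :
    ContDiff ℝ ∞ (fun x => ∫ y, w y • k (x, y) ∂μ) :=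
  contDiff_infty.2 fun n => (contDiff_weighted_nat hC hμ isCompact_empty n hk).1 hw

theorem contDiff_intervalIntegral {F : Type u} [NormedAddCommGroup F] [NormedSpace ℝ F]
    [NormedSpace ℂ F] [SMulCommClass ℝ ℂ F] {k : E × ℝ → F} (hk : ContDiff ℝ ∞ k) {T : ℝ}
    (hT : 0 ≤ T) :
    ContDiff ℝ ∞ (fun x => ∫ t in (0 : ℝ)..T, k (x, t)) ∧ ∀ x,
      HasFDerivAt (fun x => ∫ t in (0 : ℝ)..T, k (x, t))
        (∫ t in (0 : ℝ)..T, (fderiv ℝ k (x, t)).comp (ContinuousLinearMap.inl ℝ E ℝ)) x := by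
  have hμ : ∀ᵐ t ∂(volume.restrict (Ioc 0 T)), t ∈ Icc 0 T :=
    (ae_restrict_mem measurableSet_Ioc).mono fun t ht => Ioc_subset_Icc_self ht
  have hw : Integrable (fun _ : ℝ => (1 : ℂ)) (volume.restrict (Ioc 0 T)) :=
    integrable_const _
  constructor
  · have := contDiff_weighted hk isCompact_Icc hμ hw
    simpa [intervalIntegral.integral_of_le hT] using this
  · intro x
    have := hasFDerivAt_weighted (hk.of_le (by simp)) isCompact_Icc hμ hw x
    simpa [intervalIntegral.integral_of_le hT] using this

end WeightedIntegral

/-! ### Unique differentiability up to a regular boundary. -/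

section UniqueDiff

/-- A closed sublevel domain with regular boundary is a set of unique differentiability. -/
theorem uniqueDiffOn_superlevel {E : Type*} [NormedAddCommGroup E] [NormedSpace ℝ E] {r : E → ℝ}
    (hr : Differentiable ℝ r) (hreg : ∀ x, r x = 0 → fderiv ℝ r x ≠ 0) :
    UniqueDiffOn ℝ {x | 0 ≤ r x} := by
  intro x hx
  rcases (show 0 ≤ r x from hx).eq_or_lt with h0 | h0
  -- At a boundary point the tangent cone contains the open half-space of inward directions, and a
  -- nonempty open half-space spans.
  · have hpos : ∀ v, 0 < fderiv ℝ r x v → v ∈ tangentConeAt ℝ {x | 0 ≤ r x} x := by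
      intro v hv
      refine mem_tangentConeAt_of_add_smul_mem (l := 𝓝[>] (0 : ℝ)) (c := id) ?_ ?_
      · exact tendsto_id.mono_left (nhdsWithin_mono _ fun s hs => ne_of_gt hs) |>.mono_right le_rfl
      · have h1 : HasDerivAt (fun s : ℝ => x + s • v) v 0 := by
          simpa using ((hasDerivAt_id (0 : ℝ)).smul_const v).const_add x
        have h2 : HasDerivAt (fun s : ℝ => r (x + s • v)) (fderiv ℝ r x v) 0 := by
          have h3 : HasFDerivAt r (fderiv ℝ r x) (x + (0 : ℝ) • v) := by
            simpa using (hr x).hasFDerivAt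
          exact h3.comp_hasDerivAt 0 h1
        have h4 := hasDerivAt_iff_tendsto_slope.1 h2
        have h5 : ∀ᶠ s in 𝓝[>] (0 : ℝ), 0 < slope (fun s : ℝ => r (x + s • v)) 0 s :=
          (h4.mono_left (nhdsWithin_mono _ fun s hs => ne_of_gt hs)).eventually_const_lt hv
        filter_upwards [h5, self_mem_nhdsWithin] with s hs hs0
        have hs0' : (0 : ℝ) < s := hs0
        rw [slope_def_field] at hs
        simp only [zero_smul, add_zero, ← h0, sub_zero] at hs
        have := (div_pos_iff_of_pos_right hs0').1 hs
        exact this.le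
    obtain ⟨v₀, hv₀⟩ : ∃ v, 0 < fderiv ℝ r x v := by
      by_contra! hcon
      refine hreg x h0.symm (ContinuousLinearMap.ext fun v => le_antisymm (hcon v) ?_)
      have := hcon (-v)
      rw [map_neg] at this
      simpa using this
    refine ⟨?_, subset_closure hx⟩
    have : Submodule.span ℝ (tangentConeAt ℝ {x | 0 ≤ r x} x) = ⊤ := by
      refine eq_top_iff.2 fun w _ => ?_
      obtain ⟨s, hs⟩ : ∃ s : ℝ, 0 < fderiv ℝ r x (w + s • v₀) := by
        refine ⟨(1 - fderiv ℝ r x w) / fderiv ℝ r x v₀, ?_⟩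
        rw [map_add, map_smul, smul_eq_mul, div_mul_cancel₀ _ hv₀.ne']
        linarith
      have h1 := Submodule.subset_span (R := ℝ) (hpos _ hs)
      have h2 := Submodule.subset_span (R := ℝ) (hpos _ hv₀)
      have := Submodule.sub_mem _ h1 (Submodule.smul_mem _ s h2)
      simpa using this
    rw [this]
    exact dense_univ
  · exact uniqueDiffWithinAt_of_mem_nhds
      (mem_of_superset (hr.continuous.continuousAt.eventually_const_lt h0)
        fun y (hy : 0 < r y) => hy.le)

end UniqueDiff

/-! ### Fields that depend trigonometrically on the angle. -/

theorem lipschitzWith_smul_of_bounded {E G : Type*} [NormedAddCommGroup E]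
    [NormedAddCommGroup G] [NormedSpace ℝ G] {u : ℝ → ℝ} (hu : LipschitzWith 1 u) (hu1 : ∀ s, |u s| ≤ 1)
    {F : E → G} {L B : NNReal} (hF : LipschitzWith L F) (hB : ∀ x, ‖F x‖ ≤ B) :
    LipschitzWith (L + B) (fun p : E × ℝ => u p.2 • F p.1) := by
  refine LipschitzWith.of_dist_le_mul fun p q => ?_
  have e : u p.2 • F p.1 - u q.2 • F q.1 = u p.2 • (F p.1 - F q.1) + (u p.2 - u q.2) • F q.1 := by
    module
  have h1 := hF.dist_le_mul p.1 q.1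
  have h2 := hu.dist_le_mul p.2 q.2
  rw [dist_eq_norm, dist_eq_norm] at h1
  rw [Real.dist_eq, dist_eq_norm, NNReal.coe_one, one_mul] at h2
  rw [dist_eq_norm, dist_eq_norm, e]
  calc _ ≤ ‖u p.2 • (F p.1 - F q.1)‖ + ‖(u p.2 - u q.2) • F q.1‖ := norm_add_le _ _
    _ = |u p.2| * ‖F p.1 - F q.1‖ + |u p.2 - u q.2| * ‖F q.1‖ := by
      rw [norm_smul, norm_smul, Real.norm_eq_abs, Real.norm_eq_abs]
    _ ≤ 1 * (L * ‖p - q‖) + ‖p - q‖ * B := by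
      gcongr
      · exact hu1 _
      · exact h1.trans (by gcongr; exact norm_fst_le (p - q))
      · exact h2.trans (norm_snd_le (p - q))
      · exact hB _
    _ = _ := by push_cast; ring

section TrigCombination

variable {E G : Type*} [NormedAddCommGroup E] [NormedSpace ℝ E] [NormedAddCommGroup G]
  [NormedSpace ℝ G]

theorem fderiv_trig_combination {F₁ F₂ : E → G} (h₁ : Differentiable ℝ F₁)
    (h₂ : Differentiable ℝ F₂) {u v : ℝ → ℝ} {u' v' θ : ℝ} (hu : HasDerivAt u u' θ)
    (hv : HasDerivAt v v' θ) (x ξ : E) (η : ℝ) :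
    fderiv ℝ (fun p : E × ℝ => u p.2 • F₁ p.1 + v p.2 • F₂ p.1) (x, θ) (ξ, η) =
      u θ • fderiv ℝ F₁ x ξ + v θ • fderiv ℝ F₂ x ξ + (η * u') • F₁ x + (η * v') • F₂ x := by
  have e₁ : HasFDerivAt (fun p : E × ℝ => F₁ p.1)
      ((fderiv ℝ F₁ x).comp (ContinuousLinearMap.fst ℝ E ℝ)) (x, θ) :=
    HasFDerivAt.comp (x, θ) (f := Prod.fst) (h₁ x).hasFDerivAt hasFDerivAt_fst
  have e₂ : HasFDerivAt (fun p : E × ℝ => F₂ p.1)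
      ((fderiv ℝ F₂ x).comp (ContinuousLinearMap.fst ℝ E ℝ)) (x, θ) :=
    HasFDerivAt.comp (x, θ) (f := Prod.fst) (h₂ x).hasFDerivAt hasFDerivAt_fst
  have eu : HasFDerivAt (fun p : E × ℝ => u p.2)
      (u' • ContinuousLinearMap.snd ℝ E ℝ) (x, θ) :=
    HasDerivAt.comp_hasFDerivAt (f := Prod.snd) (x, θ) hu hasFDerivAt_snd
  have ev : HasFDerivAt (fun p : E × ℝ => v p.2)
      (v' • ContinuousLinearMap.snd ℝ E ℝ) (x, θ) :=
    HasDerivAt.comp_hasFDerivAt (f := Prod.snd) (x, θ) hv hasFDerivAt_snd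
  rw [((eu.fun_smul e₁).fun_add (ev.fun_smul e₂)).fderiv]
  simp only [add_apply, smul_apply,
    ContinuousLinearMap.comp_apply, ContinuousLinearMap.coe_fst',
    ContinuousLinearMap.smulRight_apply, ContinuousLinearMap.coe_snd', smul_eq_mul]
  rw [mul_comm η, mul_comm η]
  abel

end TrigCombination

/-! ### The frame and the structure equation. -/

namespace RiemSurface

variable (S : RiemSurface)

theorem lieBracket_frame_smooth :
    ContDiff ℝ ∞ (VectorField.lieBracket ℝ S.e₁ S.e₂) :=
  ((S.e₂_smooth.fderiv_right (by simp)).clm_apply S.e₁_smooth).sub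
    ((S.e₁_smooth.fderiv_right (by simp)).clm_apply S.e₂_smooth)

theorem c₁_smooth : ContDiff ℝ ∞ S.c₁ :=
  (S.g_smooth.clm_apply S.lieBracket_frame_smooth).clm_apply S.e₁_smooth

theorem c₂_smooth : ContDiff ℝ ∞ S.c₂ :=
  (S.g_smooth.clm_apply S.lieBracket_frame_smooth).clm_apply S.e₂_smooth

theorem curvature_smooth : ContDiff ℝ ∞ S.curvature :=
  ((((S.c₂_smooth.fderiv_right (by simp)).clm_apply S.e₁_smooth).sub
    ((S.c₁_smooth.fderiv_right (by simp)).clm_apply S.e₂_smooth)).sub (S.c₁_smooth.pow 2)).sub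
    (S.c₂_smooth.pow 2)

/-- The frame vector `e₁` with the rotation rate of the angle along it. -/
noncomputable def frame₁ (x : Plane) : Plane × ℝ := (S.e₁ x, S.c₁ x)

/-- The frame vector `e₂` with the rotation rate of the angle along it. -/
noncomputable def frame₂ (x : Plane) : Plane × ℝ := (S.e₂ x, S.c₂ x)

theorem frame₁_smooth : ContDiff ℝ ∞ S.frame₁ := S.e₁_smooth.prodMk S.c₁_smooth

theorem frame₂_smooth : ContDiff ℝ ∞ S.frame₂ := S.e₂_smooth.prodMk S.c₂_smooth

theorem X_eq : S.X = fun p => Real.cos p.2 • S.frame₁ p.1 + Real.sin p.2 • S.frame₂ p.1 := rfl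

theorem fderiv_X (x ξ : Plane) (θ η : ℝ) :
    fderiv ℝ S.X (x, θ) (ξ, η) = Real.cos θ • fderiv ℝ S.frame₁ x ξ +
      Real.sin θ • fderiv ℝ S.frame₂ x ξ + (η * -Real.sin θ) • S.frame₁ x +
      (η * Real.cos θ) • S.frame₂ x :=
  fderiv_trig_combination (S.frame₁_smooth.differentiable (by simp))
    (S.frame₂_smooth.differentiable (by simp)) (Real.hasDerivAt_cos θ) (Real.hasDerivAt_sin θ) x ξ η

theorem Xperp_eq :
    S.Xperp = fun p => Real.sin p.2 • S.frame₁ p.1 + (-Real.cos p.2) • S.frame₂ p.1 := by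
  funext ⟨x, θ⟩
  change fderiv ℝ V (x, θ) (S.X (x, θ)) - fderiv ℝ S.X (x, θ) (V (x, θ)) = _
  have h1 : fderiv ℝ V (x, θ) = 0 := fderiv_const_apply _
  rw [h1, show V (x, θ) = ((0 : Plane), (1 : ℝ)) from rfl, fderiv_X]
  simp only [zero_apply, map_zero, smul_zero]
  module

theorem X_smooth : ContDiff ℝ ∞ S.X := by
  rw [X_eq]
  exact ((Real.contDiff_cos.comp contDiff_snd).smul (S.frame₁_smooth.comp contDiff_fst)).add
    ((Real.contDiff_sin.comp contDiff_snd).smul (S.frame₂_smooth.comp contDiff_fst))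

theorem Xperp_smooth : ContDiff ℝ ∞ S.Xperp := by
  rw [Xperp_eq]
  exact ((Real.contDiff_sin.comp contDiff_snd).smul (S.frame₁_smooth.comp contDiff_fst)).add
    ((Real.contDiff_cos.comp contDiff_snd).neg.smul (S.frame₂_smooth.comp contDiff_fst))

theorem Xrho_smooth : ContDiff ℝ ∞ S.Xrho :=
  (((S.rho_smooth.fderiv_right (by simp)).comp contDiff_fst).clm_apply S.X_smooth.fst)

theorem fderiv_X_vertical (p : Plane × ℝ) : fderiv ℝ S.X p (0, 1) = -S.Xperp p := by
  obtain ⟨x, θ⟩ := p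
  rw [fderiv_X, Xperp_eq]
  simp only [map_zero, smul_zero]
  module

theorem fderiv_Xperp (x ξ : Plane) (θ η : ℝ) :
    fderiv ℝ S.Xperp (x, θ) (ξ, η) = Real.sin θ • fderiv ℝ S.frame₁ x ξ +
      (-Real.cos θ) • fderiv ℝ S.frame₂ x ξ + (η * Real.cos θ) • S.frame₁ x +
      (η * Real.sin θ) • S.frame₂ x := by
  rw [Xperp_eq]
  have h : HasDerivAt (fun s => -Real.cos s) (Real.sin θ) θ := by
    simpa using (Real.hasDerivAt_cos θ).fun_neg
  exact fderiv_trig_combination (S.frame₁_smooth.differentiable (by simp))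
    (S.frame₂_smooth.differentiable (by simp)) (Real.hasDerivAt_sin θ) h x ξ η

variable {S}

/-- The determinant of the frame. -/
noncomputable def frameDet (S : RiemSurface) (x : Plane) : ℝ := (S.e₁ x).1 * (S.e₂ x).2 - (S.e₁ x).2 * (S.e₂ x).1

theorem g_expand (x v w : Plane) : S.g x v w =
    v.1 * w.1 * S.g x (1, 0) (1, 0) + v.1 * w.2 * S.g x (1, 0) (0, 1) +
    v.2 * w.1 * S.g x (0, 1) (1, 0) + v.2 * w.2 * S.g x (0, 1) (0, 1) := by
  have h : ∀ u : Plane, u = u.1 • ((1 : ℝ), (0 : ℝ)) + u.2 • ((0 : ℝ), (1 : ℝ)) := fun u => by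
    ext <;> simp
  conv_lhs => rw [h v, h w]
  simp only [map_add, map_smul, add_apply, smul_apply,
    smul_eq_mul]
  ring

/-- Determinants are taken in Eᵀ G E = 1, where E is the matrix of the frame and G that of the
metric. -/
theorem gram_det (x : Plane) (hx : x ∈ S.M) :
    (S.g x (1, 0) (1, 0) * S.g x (0, 1) (0, 1) - S.g x (1, 0) (0, 1) ^ 2) * S.frameDet x ^ 2 = 1 := by
  have h1 := S.norm_e₁ x hx
  have h2 := S.norm_e₂ x hx
  have h3 := S.orthogonal x hx
  have h4 := S.g_symm x hx (0, 1) (1, 0)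
  rw [g_expand, h4] at h1 h2 h3
  unfold frameDet
  set a := S.g x (1, 0) (1, 0)
  set b := S.g x (1, 0) (0, 1)
  set c := S.g x (0, 1) (0, 1)
  linear_combination ((S.e₂ x).1 * (S.e₂ x).1 * a + (S.e₂ x).1 * (S.e₂ x).2 * b +
    (S.e₂ x).2 * (S.e₂ x).1 * b + (S.e₂ x).2 * (S.e₂ x).2 * c) * h1 + h2 -
    ((S.e₁ x).1 * (S.e₂ x).1 * a + (S.e₁ x).1 * (S.e₂ x).2 * b +
    (S.e₁ x).2 * (S.e₂ x).1 * b + (S.e₁ x).2 * (S.e₂ x).2 * c) * h3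

theorem frameDet_ne_zero {x : Plane} (hx : x ∈ S.M) : S.frameDet x ≠ 0 := by
  intro h
  have := gram_det x hx
  rw [h] at this
  norm_num at this

theorem areaDensity_mul_abs_frameDet {x : Plane} (hx : x ∈ S.M) :
    S.areaDensity x * |S.frameDet x| = 1 := by
  have h := gram_det x hx
  have hpos : 0 ≤ S.g x (1, 0) (1, 0) * S.g x (0, 1) (0, 1) - S.g x (1, 0) (0, 1) ^ 2 := by
    by_contra! hneg
    nlinarith [sq_nonneg (S.frameDet x)]
  unfold areaDensity
  rw [← Real.sqrt_sq_eq_abs, ← Real.sqrt_mul hpos, h, Real.sqrt_one]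

theorem frame_expand {x : Plane} (hx : x ∈ S.M) (v : Plane) :
    v = S.g x v (S.e₁ x) • S.e₁ x + S.g x v (S.e₂ x) • S.e₂ x := by
  have hd := frameDet_ne_zero hx
  have h1 := S.norm_e₁ x hx
  have h2 := S.norm_e₂ x hx
  have h3 := S.orthogonal x hx
  have h4 := S.g_symm x hx (S.e₁ x) (S.e₂ x)
  set α := (v.1 * (S.e₂ x).2 - v.2 * (S.e₂ x).1) / S.frameDet x with hα
  set β := ((S.e₁ x).1 * v.2 - (S.e₁ x).2 * v.1) / S.frameDet x with hβ
  have hv : v = α • S.e₁ x + β • S.e₂ x := by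
    ext
    · simp only [Prod.fst_add, Prod.smul_fst, smul_eq_mul, hα, hβ]
      field_simp
      unfold frameDet; ring
    · simp only [Prod.snd_add, Prod.smul_snd, smul_eq_mul, hα, hβ]
      field_simp
      unfold frameDet; ring
  have e1 : S.g x v (S.e₁ x) = α := by
    rw [hv]; simp [h1, ← h4, h3]
  have e2 : S.g x v (S.e₂ x) = β := by
    rw [hv]; simp [h2, h3]
  rw [e1, e2]
  exact hv

/-- The structure equation `[X, X_⊥] = -κ V` at the points of `SM`. -/
theorem structure_equation {p : Plane × ℝ} (hp : p ∈ S.SM) :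
    fderiv ℝ S.Xperp p (S.X p) - fderiv ℝ S.X p (S.Xperp p) = (0, -S.curvature p.1) := by
  obtain ⟨x, θ⟩ := p
  have hx : x ∈ S.M := hp.1
  have h1 : S.X (x, θ) = (Real.cos θ • S.e₁ x + Real.sin θ • S.e₂ x,
    Real.cos θ * S.c₁ x + Real.sin θ * S.c₂ x) := rfl
  have h2 : S.Xperp (x, θ) = (Real.sin θ • S.e₁ x + (-Real.cos θ) • S.e₂ x,
    Real.sin θ * S.c₁ x + (-Real.cos θ) * S.c₂ x) := by rw [Xperp_eq]; rfl
  rw [h1, h2, fderiv_Xperp, fderiv_X]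
  have hf1 : ∀ ξ, fderiv ℝ S.frame₁ x ξ = (fderiv ℝ S.e₁ x ξ, fderiv ℝ S.c₁ x ξ) := fun ξ => by
    have := (((S.e₁_smooth.differentiable (by simp) x).hasFDerivAt).prodMk
      ((S.c₁_smooth.differentiable (by simp) x).hasFDerivAt)).fderiv
    exact congrArg (fun A : Plane →L[ℝ] Plane × ℝ => A ξ) this
  have hf2 : ∀ ξ, fderiv ℝ S.frame₂ x ξ = (fderiv ℝ S.e₂ x ξ, fderiv ℝ S.c₂ x ξ) := fun ξ => by
    have := (((S.e₂_smooth.differentiable (by simp) x).hasFDerivAt).prodMk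
      ((S.c₂_smooth.differentiable (by simp) x).hasFDerivAt)).fderiv
    exact congrArg (fun A : Plane →L[ℝ] Plane × ℝ => A ξ) this
  -- Here c₁ and c₂ become the coefficients of [e₁, e₂]; this uses orthonormality and hence x ∈ M.
  have hbr : fderiv ℝ S.e₂ x (S.e₁ x) - fderiv ℝ S.e₁ x (S.e₂ x) =
      S.c₁ x • S.e₁ x + S.c₂ x • S.e₂ x :=
    frame_expand hx (VectorField.lieBracket ℝ S.e₁ S.e₂ x)
  have hbr' : fderiv ℝ S.e₂ x (S.e₁ x) =
      fderiv ℝ S.e₁ x (S.e₂ x) + (S.c₁ x • S.e₁ x + S.c₂ x • S.e₂ x) := by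
    rw [← hbr]; abel
  have hcs : Real.sin θ * Real.sin θ = 1 - Real.cos θ * Real.cos θ := by
    linear_combination Real.sin_sq_add_cos_sq θ
  simp only [hf1, hf2, frame₁, frame₂, map_add, map_smul, hbr', Prod.smul_mk, Prod.mk_add_mk,
    Prod.mk_sub_mk, smul_eq_mul, Prod.mk.injEq]
  constructor
  · have : ∀ A B C D e1 e2 : Plane, ∀ c s c1 c2 : ℝ, s * s = 1 - c * c →
        s • (c • A + s • B) + (-c) • (c • (B + (c1 • e1 + c2 • e2)) + s • D) +
        ((c * c1 + s * c2) * c) • e1 + ((c * c1 + s * c2) * s) • e2 -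
        (c • (s • A + (-c) • B) + s • (s • (B + (c1 • e1 + c2 • e2)) + (-c) • D) +
        ((s * c1 + -c * c2) * -s) • e1 + ((s * c1 + -c * c2) * c) • e2) = 0 := by
      intro A B C D e1 e2 c s c1 c2 h
      ext
      · simp only [Prod.fst_add, Prod.fst_sub, Prod.smul_fst, smul_eq_mul, Prod.fst_zero]
        linear_combination (c1 * e1.1 - c1 * e1.1 + c2 * e2.1 - c2 * e2.1) * h
      · simp only [Prod.snd_add, Prod.snd_sub, Prod.smul_snd, smul_eq_mul, Prod.snd_zero]
        linear_combination (c1 * e1.2 - c1 * e1.2 + c2 * e2.2 - c2 * e2.2) * h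
    exact this _ _ 0 _ _ _ _ _ _ _ hcs
  · unfold curvature
    linear_combination (fderiv ℝ S.c₁ x (S.e₂ x) - fderiv ℝ S.c₂ x (S.e₁ x) +
      S.c₁ x ^ 2 + S.c₂ x ^ 2) * hcs

end RiemSurface

/-- The derivative w is negative just after 0, in the glancing case w(0) = 0 because it leaves 0
with negative slope; the mean value theorem transfers the sign to r. -/
theorem eventually_neg_of_hasDerivAt {r w : ℝ → ℝ} {w' : ℝ}
    (hr : ∀ᶠ t in 𝓝 0, HasDerivAt r (w t) t) (hw : HasDerivAt w w' 0) (h0 : r 0 = 0)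
    (h : w 0 < 0 ∨ (w 0 = 0 ∧ w' < 0)) : ∀ᶠ t in 𝓝[>] (0 : ℝ), r t < 0 := by
  have hwneg : ∀ᶠ t in 𝓝[>] (0 : ℝ), w t < 0 := by
    rcases h with h | ⟨h, h'⟩
    · exact nhdsWithin_le_nhds (hw.continuousAt.eventually_lt_const h)
    · have h1 : ∀ᶠ s in 𝓝[>] (0 : ℝ), slope w 0 s < 0 :=
        ((hasDerivAt_iff_tendsto_slope.1 hw).mono_left
          (nhdsWithin_mono _ fun s hs => ne_of_gt hs)).eventually_lt_const h'
      filter_upwards [h1, self_mem_nhdsWithin] with s hs hs0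
      have hs0' : (0 : ℝ) < s := hs0
      rw [slope_def_field, h, sub_zero, sub_zero] at hs
      by_contra! hcon
      exact absurd hs (not_lt.2 (div_nonneg hcon hs0'.le))
  obtain ⟨ε, hε, H⟩ := mem_nhdsGT_iff_exists_Ioo_subset.1 (hwneg.and (nhdsWithin_le_nhds hr))
  have hr0 : HasDerivAt r (w 0) 0 := hr.self_of_nhds
  filter_upwards [Ioo_mem_nhdsGT (show (0 : ℝ) < ε from hε)] with t ht
  have hcont : ContinuousOn r (Icc 0 t) := fun s hs => by
    rcases hs.1.eq_or_lt with h | h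
    · exact h ▸ hr0.continuousAt.continuousWithinAt
    · exact (H ⟨h, hs.2.trans_lt ht.2⟩).2.continuousAt.continuousWithinAt
  obtain ⟨c, hc, hc'⟩ := exists_hasDerivAt_eq_slope r w ht.1 hcont
    fun s hs => (H ⟨hs.1, hs.2.trans ht.2⟩).2
  have hwc : w c < 0 := (H ⟨hc.1, hc.2.trans ht.2⟩).1
  rw [h0, sub_zero, sub_zero] at hc'
  rw [hc'] at hwc
  by_contra! hcon
  exact absurd hwc (not_lt.2 (div_nonneg hcon ht.1.le))

/-! ### The complete extension of the geodesic flow. -/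

namespace RiemSurface

variable (S : RiemSurface)

/-- The inequality is strict so that the extended field agrees with X in a neighbourhood of each
point of SM, and thus has the same derivative there. -/
theorem exists_cutoff : ∃ χ : ContDiffBump (0 : Plane), ∀ x ∈ S.M, ‖x‖ < χ.rIn := by
  obtain ⟨R, hR⟩ := S.compact.exists_bound_of_continuousOn continuousOn_id
  refine ⟨⟨max R 0 + 1, max R 0 + 2, by positivity, by linarith⟩, fun x hx => ?_⟩
  exact (hR x hx).trans_lt (by change R < max R 0 + 1; linarith [le_max_left R 0])

/-- A cutoff function which is `1` near `M`. -/
noncomputable def cutoff : ContDiffBump (0 : Plane) := S.exists_cutoff.choose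

theorem norm_lt_of_mem_M {x : Plane} (hx : x ∈ S.M) : ‖x‖ < S.cutoff.rIn :=
  S.exists_cutoff.choose_spec x hx

/-- A complete extension of the geodesic vector field. -/
noncomputable def extX (p : Plane × ℝ) : Plane × ℝ := S.cutoff p.1 • S.X p

theorem extX_smooth : ContDiff ℝ ∞ S.extX :=
  (S.cutoff.contDiff.comp contDiff_fst).smul S.X_smooth

variable {S}

theorem extX_eq {p : Plane × ℝ} (hp : ‖p.1‖ < S.cutoff.rIn) : S.extX p = S.X p := by
  rw [extX, S.cutoff.one_of_mem_closedBall (mem_closedBall_zero_iff.2 hp.le), one_smul]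

theorem extX_eventuallyEq {p : Plane × ℝ} (hp : ‖p.1‖ < S.cutoff.rIn) : S.extX =ᶠ[𝓝 p] S.X := by
  have : ∀ᶠ q : Plane × ℝ in 𝓝 p, ‖q.1‖ < S.cutoff.rIn :=
    continuous_fst.norm.continuousAt.eventually_lt_const hp
  filter_upwards [this] with q hq using extX_eq hq

variable (S)

/-- The cutoff acts on x only, so the support is not compact in the angle; the angle enters through
cos and sin alone, which are bounded and Lipschitz. -/
theorem extX_lipschitz_bounded :
    ∃ L B : NNReal, LipschitzWith L S.extX ∧ ∀ p, ‖S.extX p‖ ≤ B := by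
  have key : ∀ F : Plane → Plane × ℝ, ContDiff ℝ ∞ F → ∃ L B : NNReal,
      LipschitzWith L (fun x => S.cutoff x • F x) ∧ ∀ x, ‖S.cutoff x • F x‖ ≤ B := by
    intro F hF
    have hs : ContDiff ℝ ∞ (fun x => S.cutoff x • F x) := S.cutoff.contDiff.smul hF
    have hc : HasCompactSupport (fun x => S.cutoff x • F x) :=
      S.cutoff.hasCompactSupport.smul_right
    obtain ⟨L, hL⟩ := hs.lipschitzWith_of_hasCompactSupport hc (by simp)
    obtain ⟨B, hB⟩ := hc.exists_bound_of_continuous hs.continuous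
    exact ⟨L, B.toNNReal, hL, fun x => (hB x).trans (Real.le_coe_toNNReal B)⟩
  obtain ⟨L₁, B₁, hL₁, hB₁⟩ := key _ S.frame₁_smooth
  obtain ⟨L₂, B₂, hL₂, hB₂⟩ := key _ S.frame₂_smooth
  have heq : S.extX = fun p => Real.cos p.2 • (S.cutoff p.1 • S.frame₁ p.1) +
      Real.sin p.2 • (S.cutoff p.1 • S.frame₂ p.1) := by
    funext p
    rw [extX, X_eq]
    simp only
    module
  refine ⟨(L₁ + B₁) + (L₂ + B₂), B₁ + B₂, ?_, fun p => ?_⟩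
  · rw [heq]
    exact (lipschitzWith_smul_of_bounded Real.lipschitzWith_cos Real.abs_cos_le_one hL₁ hB₁).add
      (lipschitzWith_smul_of_bounded Real.lipschitzWith_sin Real.abs_sin_le_one hL₂ hB₂)
  · rw [heq]
    have h1 : ‖Real.cos p.2 • (S.cutoff p.1 • S.frame₁ p.1)‖ ≤ B₁ := by
      rw [norm_smul]
      exact (mul_le_of_le_one_left (norm_nonneg _) (Real.abs_cos_le_one _)).trans (hB₁ _)
    have h2 : ‖Real.sin p.2 • (S.cutoff p.1 • S.frame₂ p.1)‖ ≤ B₂ := by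
      rw [norm_smul]
      exact (mul_le_of_le_one_left (norm_nonneg _) (Real.abs_sin_le_one _)).trans (hB₂ _)
    push_cast
    exact (norm_add_le _ _).trans (add_le_add h1 h2)

theorem exists_extFlow : ∃ Φ : ℝ → Plane × ℝ → Plane × ℝ,
    ContDiff ℝ ∞ (fun p : ℝ × (Plane × ℝ) => Φ p.1 p.2) ∧ (∀ x, Φ 0 x = x) ∧
      ∀ t x, HasDerivAt (fun s => Φ s x) (S.extX (Φ t x)) t := by
  obtain ⟨L, B, hL, hB⟩ := S.extX_lipschitz_bounded
  exact exists_smooth_flow S.extX_smooth hL hB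

/-- The flow of the extended geodesic vector field. -/
noncomputable def extFlow : ℝ → Plane × ℝ → Plane × ℝ := S.exists_extFlow.choose

theorem extFlow_smooth : ContDiff ℝ ∞ (fun p : ℝ × (Plane × ℝ) => S.extFlow p.1 p.2) :=
  S.exists_extFlow.choose_spec.1

theorem extFlow_zero (p : Plane × ℝ) : S.extFlow 0 p = p := S.exists_extFlow.choose_spec.2.1 p

theorem hasDerivAt_extFlow (t : ℝ) (p : Plane × ℝ) :
    HasDerivAt (fun s => S.extFlow s p) (S.extX (S.extFlow t p)) t :=
  S.exists_extFlow.choose_spec.2.2 t p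

theorem extFlow_unique {c : ℝ → Plane × ℝ} (hc : ∀ t, HasDerivAt c (S.extX (c t)) t) (t : ℝ) :
    c t = S.extFlow t (c 0) := by
  obtain ⟨L, B, hL, hB⟩ := S.extX_lipschitz_bounded
  exact congrFun (solution_unique_of_lipschitz hL hc (fun t => S.hasDerivAt_extFlow t (c 0))
    (t₀ := 0) (S.extFlow_zero _).symm) t

theorem extFlow_add (s t : ℝ) (p : Plane × ℝ) :
    S.extFlow (s + t) p = S.extFlow s (S.extFlow t p) := by
  have := S.extFlow_unique (c := fun s => S.extFlow (s + t) p)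
    (fun s => (S.hasDerivAt_extFlow (s + t) p).comp_add_const s t) s
  simpa using this

theorem X_shift (p : Plane × ℝ) (n : ℤ) : S.X (p + (0, n * (2 * Real.pi))) = S.X p := by
  simp only [X, Prod.fst_add, add_zero, Prod.snd_add, Real.cos_add_int_mul_two_pi,
    Real.sin_add_int_mul_two_pi]

/-- X is 2π-periodic in the angle, so a vertical translate of an integral curve by 2πn is again an
integral curve. -/
theorem extFlow_shift (t : ℝ) (p : Plane × ℝ) (n : ℤ) :
    S.extFlow t (p + (0, n * (2 * Real.pi))) = S.extFlow t p + (0, n * (2 * Real.pi)) := by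
  have := S.extFlow_unique (c := fun t => S.extFlow t p + (0, n * (2 * Real.pi)))
    (fun t => by
      have h1 : (S.extFlow t p + ((0 : Plane), n * (2 * Real.pi))).1 = (S.extFlow t p).1 := by simp
      rw [extX, X_shift, h1]
      exact (S.hasDerivAt_extFlow t p).add_const _) t
  rw [this, extFlow_zero]

theorem continuous_extFlow : Continuous (fun p : ℝ × (Plane × ℝ) => S.extFlow p.1 p.2) :=
  S.extFlow_smooth.continuous

variable {S}

/-- By uniqueness every geodesic in M is an orbit of the extended flow. This frees all later
arguments from the choices made in `flow` and `survivalTimes`. -/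
theorem isGeodesicOn_iff {p : Plane × ℝ} {T : ℝ} {c : ℝ → Plane × ℝ} :
    S.IsGeodesicOn p T c ↔
      0 ≤ T ∧ ∀ s ∈ Icc 0 T, c s = S.extFlow s p ∧ S.extFlow s p ∈ S.SM := by
  constructor
  · rintro ⟨hT, hc0, hc⟩
    have heq : EqOn c (fun s => S.extFlow s p) (Icc 0 T) := by
      refine solution_unique_Icc (f := S.extX) (S.extX_smooth.of_le (by simp)) (fun t ht => ?_)
        (fun t _ => (S.hasDerivAt_extFlow t p).hasDerivWithinAt) (by rw [hc0, extFlow_zero])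
      rw [extX_eq (S.norm_lt_of_mem_M (hc t ht).1.1)]
      exact (hc t ht).2
    exact ⟨hT, fun s hs => ⟨heq hs, by have := heq hs; simp only at this; exact this ▸ (hc s hs).1⟩⟩
  · rintro ⟨hT, hc⟩
    refine ⟨hT, by rw [(hc 0 (left_mem_Icc.2 hT)).1, extFlow_zero], fun s hs => ?_⟩
    have hmem := (hc s hs).2
    refine ⟨(hc s hs).1 ▸ hmem, ?_⟩
    rw [(hc s hs).1, ← extX_eq (S.norm_lt_of_mem_M hmem.1)]
    exact (S.hasDerivAt_extFlow s p).hasDerivWithinAt.congr (fun r hr => (hc r hr).1) (hc s hs).1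

theorem mem_survivalTimes {p : Plane × ℝ} {T : ℝ} :
    T ∈ S.survivalTimes p ↔ 0 ≤ T ∧ ∀ s ∈ Icc 0 T, S.extFlow s p ∈ S.SM := by
  constructor
  · rintro ⟨c, hc⟩
    exact ⟨hc.1, fun s hs => ((isGeodesicOn_iff.1 hc).2 s hs).2⟩
  · rintro ⟨hT, h⟩
    exact ⟨fun s => S.extFlow s p, isGeodesicOn_iff.2 ⟨hT, fun s hs => ⟨rfl, h s hs⟩⟩⟩

theorem mem_SM_iff {p : Plane × ℝ} : p ∈ S.SM ↔ 0 ≤ S.rho p.1 := by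
  simp [SM, M]

theorem zero_mem_survivalTimes {p : Plane × ℝ} (hp : p ∈ S.SM) : 0 ∈ S.survivalTimes p := by
  refine mem_survivalTimes.2 ⟨le_rfl, fun s hs => ?_⟩
  rw [le_antisymm hs.2 hs.1, extFlow_zero]
  exact hp

theorem continuous_rho_extFlow :
    Continuous (fun z : ℝ × (Plane × ℝ) => S.rho (S.extFlow z.1 z.2).1) :=
  S.rho_smooth.continuous.comp S.continuous_extFlow.fst

theorem continuous_rho_curve (p : Plane × ℝ) : Continuous (fun s => S.rho (S.extFlow s p).1) :=
  continuous_rho_extFlow.comp (Continuous.prodMk_left p)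

theorem hasDerivAt_rho {p : Plane × ℝ} {t : ℝ} (ht : ‖(S.extFlow t p).1‖ < S.cutoff.rIn) :
    HasDerivAt (fun s => S.rho (S.extFlow s p).1) (S.Xrho (S.extFlow t p)) t := by
  have h1 := (S.hasDerivAt_extFlow t p).fst
  rw [extX_eq ht] at h1
  exact HasFDerivAt.comp_hasDerivAt (l := S.rho) t
    (S.rho_smooth.differentiable (by simp) _).hasFDerivAt h1

theorem hasDerivAt_Xrho {p : Plane × ℝ} {t : ℝ} (ht : ‖(S.extFlow t p).1‖ < S.cutoff.rIn) :
    HasDerivAt (fun s => S.Xrho (S.extFlow s p))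
      (fderiv ℝ S.Xrho (S.extFlow t p) (S.X (S.extFlow t p))) t := by
  have h1 := S.hasDerivAt_extFlow t p
  rw [extX_eq ht] at h1
  exact HasFDerivAt.comp_hasDerivAt (l := S.Xrho) t
    (S.Xrho_smooth.differentiable (by simp) _).hasFDerivAt h1

theorem eventually_norm_extFlow_lt {p : Plane × ℝ} (hp : p ∈ S.SM) :
    ∀ᶠ t in 𝓝 (0 : ℝ), ‖(S.extFlow t p).1‖ < S.cutoff.rIn := by
  have hc : Continuous fun t => ‖(S.extFlow t p).1‖ :=
    (S.continuous_extFlow.comp (Continuous.prodMk_left p)).fst.norm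
  refine hc.continuousAt.eventually_lt_const ?_
  simp only [extFlow_zero]
  exact S.norm_lt_of_mem_M hp.1

/-- Times below the supremum are survived; the end point is reached by continuity, as M is closed.
-/
theorem extFlow_mem_SM {p : Plane × ℝ} (hp : p ∈ S.SM) {s : ℝ} (hs : s ∈ Icc 0 (S.exitTime p)) :
    S.extFlow s p ∈ S.SM := by
  have hlt : ∀ r ∈ Ico 0 (S.exitTime p), 0 ≤ S.rho (S.extFlow r p).1 := by
    intro r hr
    obtain ⟨T, hT, hrT⟩ := exists_lt_of_lt_csSup ⟨0, zero_mem_survivalTimes hp⟩ hr.2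
    exact mem_SM_iff.1 ((mem_survivalTimes.1 hT).2 r ⟨hr.1, hrT.le⟩)
  rw [mem_SM_iff]
  rcases hs.2.eq_or_lt with h | h
  · rcases hs.1.eq_or_lt with h0 | h0
    · rw [← h0, S.extFlow_zero]; exact mem_SM_iff.1 hp
    · have hc := (continuous_rho_curve (S := S) p).continuousWithinAt (s := Iio s) (x := s)
      refine ge_of_tendsto hc ?_
      filter_upwards [Ico_mem_nhdsLT h0] with r hr
      exact hlt r ⟨hr.1, h ▸ hr.2⟩
  · exact hlt s ⟨hs.1, h⟩

theorem flow_eq {p : Plane × ℝ} (hp : p ∈ S.SM) {t : ℝ} (ht : t ∈ Icc 0 (S.exitTime p)) :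
    S.flow p t = S.extFlow t p := by
  have hex : ∃ c, S.IsGeodesicOn p t c :=
    ⟨fun s => S.extFlow s p, isGeodesicOn_iff.2 ⟨ht.1, fun s hs =>
      ⟨rfl, extFlow_mem_SM hp ⟨hs.1, hs.2.trans ht.2⟩⟩⟩⟩
  rw [flow, dif_pos hex]
  exact ((isGeodesicOn_iff.1 hex.choose_spec).2 t (right_mem_Icc.2 ht.1)).1

end RiemSurface

/-! ### Strict convexity and continuity of the exit time. -/

namespace RiemSurface.IsSimple

variable {S : RiemSurface}

/-- Either Xρ < 0, or the vector is glancing and strict convexity gives X(Xρ) < 0. -/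
theorem exits_forward (hS : S.IsSimple) {p : Plane × ℝ} (h0 : S.rho p.1 = 0) (h1 : S.Xrho p ≤ 0) :
    ∀ᶠ t in 𝓝[>] (0 : ℝ), S.rho (S.extFlow t p).1 < 0 := by
  have hp : p ∈ S.SM := mem_SM_iff.2 h0.ge
  have hev := eventually_norm_extFlow_lt hp
  refine eventually_neg_of_hasDerivAt (hev.mono fun t ht => hasDerivAt_rho ht)
    (hasDerivAt_Xrho hev.self_of_nhds) (by rw [S.extFlow_zero, h0]) ?_
  rw [S.extFlow_zero]
  rcases h1.lt_or_eq with h | h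
  · exact Or.inl h
  · exact Or.inr ⟨h, hS.strictly_convex p h0 h⟩

theorem exits_backward (hS : S.IsSimple) {p : Plane × ℝ} (h0 : S.rho p.1 = 0) (h1 : 0 ≤ S.Xrho p) :
    ∀ᶠ t in 𝓝[>] (0 : ℝ), S.rho (S.extFlow (-t) p).1 < 0 := by
  have hp : p ∈ S.SM := mem_SM_iff.2 h0.ge
  have hev := eventually_norm_extFlow_lt hp
  have hneg : Tendsto (fun t : ℝ => -t) (𝓝 0) (𝓝 0) := by
    simpa using (continuous_neg (G := ℝ)).tendsto 0
  have hw : HasDerivAt (fun t => -S.Xrho (S.extFlow (-t) p))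
      (fderiv ℝ S.Xrho p (S.X p)) 0 := by
    have h2 : HasDerivAt (fun s => S.Xrho (S.extFlow s p)) (fderiv ℝ S.Xrho p (S.X p)) (-0) := by
      have := hasDerivAt_Xrho hev.self_of_nhds
      rw [S.extFlow_zero] at this
      rwa [neg_zero]
    have h3 := (h2.comp (0 : ℝ) (hasDerivAt_neg 0)).fun_neg
    rw [mul_neg_one, neg_neg] at h3
    exact h3
  refine eventually_neg_of_hasDerivAt (w := fun t => -S.Xrho (S.extFlow (-t) p)) ?_ hw
    (by rw [neg_zero, S.extFlow_zero, h0]) ?_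
  · filter_upwards [hneg.eventually hev] with t ht
    have h3 := (hasDerivAt_rho ht).comp t (hasDerivAt_neg t)
    rw [mul_neg_one] at h3
    exact h3
  · rw [neg_zero, S.extFlow_zero]
    rcases h1.lt_or_eq with h | h
    · exact Or.inl (by linarith)
    · exact Or.inr ⟨by rw [← h, neg_zero], hS.strictly_convex p h0 h.symm⟩

theorem exitTime_nonneg (hS : S.IsSimple) {p : Plane × ℝ} (hp : p ∈ S.SM) : 0 ≤ S.exitTime p :=
  le_csSup (hS.nontrapping p hp) (zero_mem_survivalTimes hp)

theorem exists_exit (hS : S.IsSimple) {p : Plane × ℝ} (hp : p ∈ S.SM) {T : ℝ} (hT : S.exitTime p < T) :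
    ∃ s ∈ Ioc (S.exitTime p) T, S.rho (S.extFlow s p).1 < 0 := by
  by_contra! hcon
  have : T ∈ S.survivalTimes p := by
    refine mem_survivalTimes.2 ⟨(hS.exitTime_nonneg hp).trans hT.le, fun s hs => ?_⟩
    rcases le_or_gt s (S.exitTime p) with h | h
    · exact extFlow_mem_SM hp ⟨hs.1, h⟩
    · exact mem_SM_iff.2 (hcon s ⟨h, hs.2⟩)
  exact absurd (le_csSup (hS.nontrapping p hp) this) (not_le.2 hT)

theorem rho_exit (hS : S.IsSimple) {p : Plane × ℝ} (hp : p ∈ S.SM) :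
    S.rho (S.extFlow (S.exitTime p) p).1 = 0 := by
  refine le_antisymm ?_ (mem_SM_iff.1
    (extFlow_mem_SM hp (right_mem_Icc.2 (hS.exitTime_nonneg hp))))
  by_contra! hpos
  have := (continuous_rho_curve (S := S) p).continuousAt.eventually_const_lt hpos
  obtain ⟨ε, hε, H⟩ := Metric.eventually_nhds_iff.1 this
  obtain ⟨s, hs, hs'⟩ := hS.exists_exit hp (T := S.exitTime p + ε / 2) (by linarith)
  refine absurd (H (y := s) ?_) (not_lt.2 hs'.le)
  rw [Real.dist_eq, abs_of_pos (sub_pos.2 hs.1)]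
  linarith [hs.2]

/-- A contact with the boundary strictly between start and exit would force the geodesic out of M
just after it or just before it, according to the sign of Xρ. -/
theorem rho_pos (hS : S.IsSimple) {p : Plane × ℝ} (hp : p ∈ S.SM) {t : ℝ} (h0 : 0 < t) (h1 : t < S.exitTime p) :
    0 < S.rho (S.extFlow t p).1 := by
  have hmem := extFlow_mem_SM hp ⟨h0.le, h1.le⟩
  refine lt_of_le_of_ne (mem_SM_iff.1 hmem) fun hzero => ?_
  rcases le_total (S.Xrho (S.extFlow t p)) 0 with h | h
  · obtain ⟨s, hs, hs'⟩ := ((hS.exits_forward hzero.symm h).and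
      (Ioo_mem_nhdsGT (sub_pos.2 h1))).exists
    rw [← S.extFlow_add] at hs
    exact absurd (mem_SM_iff.1 (extFlow_mem_SM hp (s := s + t)
      ⟨by linarith [hs'.1], by linarith [hs'.2]⟩)) (not_le.2 hs)
  · obtain ⟨s, hs, hs'⟩ := ((hS.exits_backward hzero.symm h).and (Ioo_mem_nhdsGT h0)).exists
    rw [← S.extFlow_add] at hs
    exact absurd (mem_SM_iff.1 (extFlow_mem_SM hp (s := -s + t)
      ⟨by linarith [hs'.2], by linarith [hs'.1]⟩)) (not_le.2 hs)

theorem exitTime_eq_zero_of_outflux (hS : S.IsSimple) {p : Plane × ℝ} (hp : p ∈ S.outflux) : S.exitTime p = 0 := by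
  have hpM : p ∈ S.SM := mem_SM_iff.2 hp.1.ge
  refine le_antisymm (le_of_not_gt fun h => ?_) (hS.exitTime_nonneg hpM)
  obtain ⟨s, hs, hs'⟩ := ((hS.exits_forward hp.1 hp.2).and (Ioo_mem_nhdsGT h)).exists
  exact absurd (mem_SM_iff.1 (extFlow_mem_SM hpM ⟨hs'.1.le, hs'.2.le⟩)) (not_le.2 hs)

/-- Upper semicontinuity: some time in (τ(p), T] has ρ < 0, which is an open condition on the
initial vector. -/
theorem eventually_exitTime_lt (hS : S.IsSimple) {p : Plane × ℝ} (hp : p ∈ S.SM) {T : ℝ} (hT : S.exitTime p < T) :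
    ∀ᶠ q in 𝓝 p, q ∈ S.SM → S.exitTime q < T := by
  obtain ⟨s, hs, hs'⟩ := hS.exists_exit hp hT
  have hc : Continuous fun q => S.rho (S.extFlow s q).1 :=
    continuous_rho_extFlow.comp (Continuous.prodMk_right s)
  filter_upwards [hc.continuousAt.eventually_lt_const hs'] with q hq hqM
  refine lt_of_lt_of_le (lt_of_not_ge fun h => ?_) hs.2
  exact absurd (mem_SM_iff.1 (extFlow_mem_SM hqM
    ⟨(hS.exitTime_nonneg hp).trans hs.1.le, h⟩)) (not_le.2 hq)

/-- Lower semicontinuity: away from time 0, ρ has a positive minimum on a compact time interval,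
which persists. If p starts on the boundary with positive exit time then Xρ(p) > 0, so for
neighbouring initial vectors ρ increases during a short initial interval of fixed length. -/
theorem eventually_lt_exitTime (hS : S.IsSimple) {p : Plane × ℝ} (hp : p ∈ S.SM) {T : ℝ} (hT : T < S.exitTime p) :
    ∀ᶠ q in 𝓝 p, q ∈ S.SM → T < S.exitTime q := by
  rcases lt_or_ge T 0 with hT0 | hT0
  · exact Eventually.of_forall fun q hq => hT0.trans_le (hS.exitTime_nonneg hq)
  obtain ⟨T', hTT', hT'⟩ := exists_between hT
  have hT'0 : 0 < T' := hT0.trans_lt hTT'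
  suffices h : ∀ᶠ q in 𝓝 p, q ∈ S.SM → ∀ s ∈ Icc 0 T', 0 ≤ S.rho (S.extFlow s q).1 by
    filter_upwards [h] with q hq hqM
    exact hTT'.trans_le (le_csSup (hS.nontrapping q hqM)
      (mem_survivalTimes.2 ⟨hT'0.le, fun s hs => mem_SM_iff.2 (hq hqM s hs)⟩))
  have hcomp : ∀ ε, (∀ s ∈ Icc ε T', 0 < S.rho (S.extFlow s p).1) →
      ∀ᶠ q in 𝓝 p, ∀ s ∈ Icc ε T', 0 < S.rho (S.extFlow s q).1 := by
    intro ε hε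
    refine isCompact_Icc.eventually_forall_of_forall_eventually (x₀ := p)
      (P := fun q s => 0 < S.rho (S.extFlow s q).1) fun s hs => ?_
    have hc : Continuous fun z : (Plane × ℝ) × ℝ => S.rho (S.extFlow z.2 z.1).1 :=
      continuous_rho_extFlow.comp continuous_swap
    exact hc.continuousAt.eventually_const_lt (hε s hs)
  rcases (mem_SM_iff.1 hp).eq_or_lt with h0 | h0
  · have hX : 0 < S.Xrho p := by
      by_contra! hcon
      have := hS.exitTime_eq_zero_of_outflux ⟨h0.symm, hcon⟩
      linarith
    have hc1 : Continuous fun z : (Plane × ℝ) × ℝ => S.Xrho (S.extFlow z.2 z.1) :=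
      S.Xrho_smooth.continuous.comp (S.continuous_extFlow.comp continuous_swap)
    have hc2 : Continuous fun z : (Plane × ℝ) × ℝ => ‖(S.extFlow z.2 z.1).1‖ :=
      (S.continuous_extFlow.comp continuous_swap).fst.norm
    have hev : ∀ᶠ z : (Plane × ℝ) × ℝ in 𝓝 (p, 0), 0 < S.Xrho (S.extFlow z.2 z.1) ∧
        ‖(S.extFlow z.2 z.1).1‖ < S.cutoff.rIn := by
      refine (hc1.continuousAt.eventually_const_lt ?_).and (hc2.continuousAt.eventually_lt_const ?_)
      · simpa [S.extFlow_zero] using hX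
      · simpa [S.extFlow_zero] using S.norm_lt_of_mem_M hp.1
    rw [nhds_prod_eq] at hev
    obtain ⟨Pa, ha, Pb, hb, hab⟩ := eventually_prod_iff.1 hev
    obtain ⟨δ, hδ, Hδ⟩ := Metric.eventually_nhds_iff.1 hb
    set ε := min (δ / 2) T' with hε
    have hε0 : 0 < ε := lt_min (by linarith) hT'0
    filter_upwards [ha, hcomp ε fun s hs => hS.rho_pos hp (hε0.trans_le hs.1)
      (hs.2.trans_lt hT')] with q hq1 hq2 hqM s hs
    rcases le_or_gt ε s with hsε | hsε
    · exact (hq2 s ⟨hsε, hs.2⟩).le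
    · have hder : ∀ r ∈ Icc 0 ε, HasDerivAt (fun r => S.rho (S.extFlow r q).1)
          (S.Xrho (S.extFlow r q)) r ∧ 0 < S.Xrho (S.extFlow r q) := by
        intro r hr
        have := hab hq1 (Hδ (y := r) (by
          rw [Real.dist_eq, sub_zero, abs_of_nonneg hr.1]
          have := hr.2.trans (min_le_left (δ / 2) T')
          linarith))
        exact ⟨hasDerivAt_rho this.2, this.1⟩
      have hmono : MonotoneOn (fun r => S.rho (S.extFlow r q).1) (Icc 0 ε) := by
        refine monotoneOn_of_deriv_nonneg (convex_Icc 0 ε)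
          (continuous_rho_curve q).continuousOn (fun r hr => ?_) fun r hr => ?_
        · exact (hder r (interior_subset hr)).1.differentiableAt.differentiableWithinAt
        · rw [(hder r (interior_subset hr)).1.deriv]
          exact (hder r (interior_subset hr)).2.le
      have := hmono (left_mem_Icc.2 hε0.le) ⟨hs.1, hsε.le⟩ hs.1
      simp only [S.extFlow_zero] at this
      exact (mem_SM_iff.1 hqM).trans this
  · have hpos : ∀ s ∈ Icc 0 T', 0 < S.rho (S.extFlow s p).1 := fun s hs => by
      rcases hs.1.eq_or_lt with h | h
      · rw [← h, S.extFlow_zero]; exact h0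
      · exact hS.rho_pos hp h (hs.2.trans_lt hT')
    filter_upwards [hcomp 0 hpos] with q hq _ s hs using (hq s hs).le

theorem continuousOn_exitTime (hS : S.IsSimple) : ContinuousOn S.exitTime S.SM := by
  intro p hp
  refine tendsto_order.2 ⟨fun T hT => ?_, fun T hT => ?_⟩
  · filter_upwards [nhdsWithin_le_nhds (hS.eventually_lt_exitTime hp hT), self_mem_nhdsWithin]
      with q hq hqM using hq hqM
  · filter_upwards [nhdsWithin_le_nhds (hS.eventually_exitTime_lt hp hT), self_mem_nhdsWithin]
      with q hq hqM using hq hqM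

end RiemSurface.IsSimple

/-! ### The linearized flow and its Jacobi functions. -/

/-- The determinant of two plane vectors. -/
def det2 (u v : Plane) : ℝ := u.1 * v.2 - u.2 * v.1

theorem ContDiffAt.det2 {E : Type*} [NormedAddCommGroup E] [NormedSpace ℝ E] {f g : E → Plane}
    {x : E} {n : WithTop ℕ∞} (hf : ContDiffAt ℝ n f x) (hg : ContDiffAt ℝ n g x) :
    ContDiffAt ℝ n (fun y => _root_.det2 (f y) (g y)) x :=
  (hf.fst.mul hg.snd).sub (hf.snd.mul hg.fst)

namespace RiemSurface

variable {S : RiemSurface}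

/-- The coefficient of `X` in the decomposition with respect to `X`, `X_⊥`, `V`. -/
noncomputable def coefX (S : RiemSurface) (q ζ : Plane × ℝ) : ℝ :=
  -det2 ζ.1 (S.Xperp q).1 / S.frameDet q.1

/-- The coefficient of `X_⊥` in the decomposition with respect to `X`, `X_⊥`, `V`. -/
noncomputable def coefXperp (S : RiemSurface) (q ζ : Plane × ℝ) : ℝ :=
  -det2 (S.X q).1 ζ.1 / S.frameDet q.1

/-- The coefficient of `V` in the decomposition with respect to `X`, `X_⊥`, `V`. -/
noncomputable def coefV (S : RiemSurface) (q ζ : Plane × ℝ) : ℝ :=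
  ζ.2 - S.coefX q ζ * (S.X q).2 - S.coefXperp q ζ * (S.Xperp q).2

theorem X_fst (q : Plane × ℝ) :
    (S.X q).1 = Real.cos q.2 • S.e₁ q.1 + Real.sin q.2 • S.e₂ q.1 := rfl

theorem Xperp_fst (q : Plane × ℝ) :
    (S.Xperp q).1 = Real.sin q.2 • S.e₁ q.1 - Real.cos q.2 • S.e₂ q.1 := by
  rw [Xperp_eq]
  simp [frame₁, frame₂, sub_eq_add_neg]

theorem det2_X_Xperp (q : Plane × ℝ) : det2 (S.X q).1 (S.Xperp q).1 = -S.frameDet q.1 := by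
  rw [X_fst, Xperp_fst]
  simp only [det2, frameDet, Prod.fst_add, Prod.snd_add, Prod.fst_sub, Prod.snd_sub, Prod.smul_fst,
    Prod.smul_snd, smul_eq_mul]
  linear_combination (-(S.e₁ q.1).1 * (S.e₂ q.1).2 + (S.e₁ q.1).2 * (S.e₂ q.1).1) *
    Real.sin_sq_add_cos_sq q.2

theorem coef_combination {q : Plane × ℝ} (hq : S.frameDet q.1 ≠ 0) (w y z : ℝ) :
    S.coefX q (w • S.X q + y • S.Xperp q + z • ((0 : Plane), (1 : ℝ))) = w ∧
    S.coefXperp q (w • S.X q + y • S.Xperp q + z • ((0 : Plane), (1 : ℝ))) = y ∧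
    S.coefV q (w • S.X q + y • S.Xperp q + z • ((0 : Plane), (1 : ℝ))) = z := by
  have hd := det2_X_Xperp (S := S) q
  have h1 : S.coefX q (w • S.X q + y • S.Xperp q + z • ((0 : Plane), (1 : ℝ))) = w := by
    rw [coefX, div_eq_iff hq]
    simp only [det2, Prod.fst_add, Prod.snd_add, Prod.smul_fst, Prod.smul_snd, smul_eq_mul,
      Prod.fst_zero, Prod.snd_zero] at hd ⊢
    linear_combination -w * hd
  have h2 : S.coefXperp q (w • S.X q + y • S.Xperp q + z • ((0 : Plane), (1 : ℝ))) = y := by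
    rw [coefXperp, div_eq_iff hq]
    simp only [det2, Prod.fst_add, Prod.snd_add, Prod.smul_fst, Prod.smul_snd, smul_eq_mul,
      Prod.fst_zero, Prod.snd_zero] at hd ⊢
    linear_combination -y * hd
  refine ⟨h1, h2, ?_⟩
  rw [coefV, h1, h2]
  simp only [Prod.snd_add, Prod.smul_snd, smul_eq_mul, mul_one]
  ring

theorem coef_decomposition {q : Plane × ℝ} (hq : S.frameDet q.1 ≠ 0) (ζ : Plane × ℝ) :
    ζ = S.coefX q ζ • S.X q + S.coefXperp q ζ • S.Xperp q +
      S.coefV q ζ • ((0 : Plane), (1 : ℝ)) := by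
  have hd := det2_X_Xperp (S := S) q
  -- Cramer's rule, in the form of the linear relation among three plane vectors.
  have key : ∀ u v w : Plane, det2 u v • w = det2 w v • u + det2 u w • v := by
    intro u v w
    ext
    · simp only [det2, Prod.fst_add, Prod.smul_fst, smul_eq_mul]; ring
    · simp only [det2, Prod.snd_add, Prod.smul_snd, smul_eq_mul]; ring
  refine Prod.ext ?_ ?_
  · have h := key (S.X q).1 (S.Xperp q).1 ζ.1
    rw [hd] at h
    have h2 : ζ.1 = (-S.frameDet q.1)⁻¹ • ((-S.frameDet q.1) • ζ.1) := by
      rw [smul_smul, inv_mul_cancel₀ (neg_ne_zero.2 hq), one_smul]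
    rw [h] at h2
    simp only [Prod.fst_add, Prod.smul_fst, smul_zero, add_zero, coefX, coefXperp]
    refine h2.trans ?_
    rw [smul_add, smul_smul, smul_smul]
    congr 2 <;> · rw [inv_neg]; field_simp
  · simp only [coefV, Prod.snd_add, Prod.smul_snd, smul_eq_mul, mul_one]
    ring

theorem frameDet_smooth : ContDiff ℝ ∞ S.frameDet :=
  (S.e₁_smooth.fst.mul S.e₂_smooth.snd).sub (S.e₁_smooth.snd.mul S.e₂_smooth.fst)

theorem contDiffAt_coef {E : Type*} [NormedAddCommGroup E] [NormedSpace ℝ E]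
    {f g : E → Plane × ℝ} {x : E} (hf : ContDiffAt ℝ ∞ f x) (hg : ContDiffAt ℝ ∞ g x)
    (hx : S.frameDet (f x).1 ≠ 0) :
    ContDiffAt ℝ ∞ (fun y => S.coefX (f y) (g y)) x ∧
    ContDiffAt ℝ ∞ (fun y => S.coefXperp (f y) (g y)) x ∧
    ContDiffAt ℝ ∞ (fun y => S.coefV (f y) (g y)) x := by
  have hX := S.X_smooth.contDiffAt.comp x hf
  have hP := S.Xperp_smooth.contDiffAt.comp x hf
  have hd : ContDiffAt ℝ ∞ (fun y => S.frameDet (f y).1) x :=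
    (frameDet_smooth (S := S)).contDiffAt.comp x hf.fst
  have h1 : ContDiffAt ℝ ∞ (fun y => S.coefX (f y) (g y)) x := ((hg.fst.det2 hP.fst).neg).div hd hx
  have h2 : ContDiffAt ℝ ∞ (fun y => S.coefXperp (f y) (g y)) x :=
    ((hX.fst.det2 hg.fst).neg).div hd hx
  exact ⟨h1, h2, (hg.snd.sub (h1.mul hX.snd)).sub (h2.mul hP.snd)⟩

/-- The differential of the extended flow at time `t` at the point `p`. -/
noncomputable def dFlow (S : RiemSurface) (t : ℝ) (p ξ : Plane × ℝ) : Plane × ℝ :=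
  fderiv ℝ (fun z : ℝ × (Plane × ℝ) => S.extFlow z.1 z.2) (t, p) (0, ξ)

theorem dFlow_zero (p ξ : Plane × ℝ) : S.dFlow 0 p ξ = ξ :=
  fderiv_flow_zero S.extFlow_smooth S.extFlow_zero p ξ

theorem hasDerivAt_dFlow {t : ℝ} {p : Plane × ℝ} (hp : S.extFlow t p ∈ S.SM) (ξ : Plane × ℝ) :
    HasDerivAt (fun s => S.dFlow s p ξ) (fderiv ℝ S.X (S.extFlow t p) (S.dFlow t p ξ)) t := by
  rw [← (extX_eventuallyEq (S.norm_lt_of_mem_M hp.1)).fderiv_eq]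
  exact hasDerivAt_fderiv_flow S.extX_smooth S.extFlow_smooth S.hasDerivAt_extFlow p ξ t

theorem contDiff_dFlow {E : Type*} [NormedAddCommGroup E] [NormedSpace ℝ E]
    {f : E → ℝ} {g h : E → Plane × ℝ} (hf : ContDiff ℝ ∞ f) (hg : ContDiff ℝ ∞ g)
    (hh : ContDiff ℝ ∞ h) : ContDiff ℝ ∞ (fun y => S.dFlow (f y) (g y) (h y)) :=
  ((S.extFlow_smooth.fderiv_right (by simp)).comp (hf.prodMk hg)).clm_apply
    (contDiff_const.prodMk hh)

theorem dFlow_shift (t : ℝ) (p ξ : Plane × ℝ) (n : ℤ) :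
    S.dFlow t (p + (0, n * (2 * Real.pi))) ξ = S.dFlow t p ξ := by
  unfold dFlow
  have h1 := fderiv_comp_add_right (𝕜 := ℝ) (f := fun z : ℝ × (Plane × ℝ) => S.extFlow z.1 z.2)
    (x := (t, p)) ((0 : ℝ), ((0 : Plane), (n : ℝ) * (2 * Real.pi)))
  have h2 : (fun z : ℝ × (Plane × ℝ) =>
      S.extFlow (z + ((0 : ℝ), ((0 : Plane), (n : ℝ) * (2 * Real.pi)))).1
        (z + ((0 : ℝ), ((0 : Plane), (n : ℝ) * (2 * Real.pi)))).2) =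
      fun z => S.extFlow z.1 z.2 + ((0 : Plane), (n : ℝ) * (2 * Real.pi)) := by
    funext z
    rw [Prod.fst_add, Prod.snd_add, add_zero, extFlow_shift]
  rw [h2, fderiv_add_const] at h1
  rw [h1]
  simp

theorem hasDerivAt_X_extFlow {t : ℝ} {p : Plane × ℝ} (hp : S.extFlow t p ∈ S.SM)
    {Y : Plane × ℝ → Plane × ℝ} (hY : ContDiff ℝ ∞ Y) :
    HasDerivAt (fun s => Y (S.extFlow s p))
      (fderiv ℝ Y (S.extFlow t p) (S.X (S.extFlow t p))) t := by
  have h1 := S.hasDerivAt_extFlow t p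
  rw [extX_eq (S.norm_lt_of_mem_M hp.1)] at h1
  exact HasFDerivAt.comp_hasDerivAt (l := Y) t (hY.differentiable (by simp) _).hasFDerivAt h1

/-- The linearized geodesic flow in the frame `X`, `X_⊥`, `V`. -/
theorem hasDerivAt_coef_dFlow {t : ℝ} {p : Plane × ℝ} (hp : S.extFlow t p ∈ S.SM)
    (ξ : Plane × ℝ) :
    HasDerivAt (fun s => S.coefX (S.extFlow s p) (S.dFlow s p ξ)) 0 t ∧
    HasDerivAt (fun s => S.coefXperp (S.extFlow s p) (S.dFlow s p ξ))
      (-S.coefV (S.extFlow t p) (S.dFlow t p ξ)) t ∧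
    HasDerivAt (fun s => S.coefV (S.extFlow s p) (S.dFlow s p ξ))
      (S.curvature (S.extFlow t p).1 * S.coefXperp (S.extFlow t p) (S.dFlow t p ξ)) t := by
  have hdet : S.frameDet (S.extFlow t p).1 ≠ 0 := frameDet_ne_zero hp.1
  have hflow : ContDiff ℝ ∞ (fun s => S.extFlow s p) :=
    S.extFlow_smooth.comp (contDiff_id.prodMk contDiff_const)
  obtain ⟨hw, hy, hz⟩ := contDiffAt_coef (S := S) hflow.contDiffAt
    (contDiff_dFlow contDiff_id contDiff_const contDiff_const :
      ContDiff ℝ ∞ (fun s => S.dFlow s p ξ)).contDiffAt (x := t) hdet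
  have hw := (hw.differentiableAt (by simp)).hasDerivAt
  have hy := (hy.differentiableAt (by simp)).hasDerivAt
  have hz := (hz.differentiableAt (by simp)).hasDerivAt
  set w := fun s => S.coefX (S.extFlow s p) (S.dFlow s p ξ)
  set y := fun s => S.coefXperp (S.extFlow s p) (S.dFlow s p ξ)
  set z := fun s => S.coefV (S.extFlow s p) (S.dFlow s p ξ)
  have hX := hasDerivAt_X_extFlow hp S.X_smooth
  have hP := hasDerivAt_X_extFlow hp S.Xperp_smooth
  have hev : (fun s => S.dFlow s p ξ) =ᶠ[𝓝 t] fun s => w s • S.X (S.extFlow s p) +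
      y s • S.Xperp (S.extFlow s p) + z s • ((0 : Plane), (1 : ℝ)) := by
    have hc : Continuous fun s => S.frameDet (S.extFlow s p).1 :=
      (frameDet_smooth (S := S)).continuous.comp hflow.continuous.fst
    filter_upwards [hc.continuousAt.eventually_ne hdet] with s hs
    exact coef_decomposition hs _
  have h1 := ((hw.fun_smul hX).fun_add (hy.fun_smul hP)).fun_add
    (hz.smul_const ((0 : Plane), (1 : ℝ)))
  have h2 := ((hasDerivAt_dFlow hp ξ).congr_of_eventuallyEq hev.symm).unique h1
  have h3 : S.dFlow t p ξ = _ := coef_decomposition hdet (S.dFlow t p ξ)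
  have hst := structure_equation hp
  set q := S.extFlow t p
  -- The variational equation is written in the frame moving along the orbit. DX applied to V is
  -- -X_⊥, and the structure equation compares DX_⊥(X) with DX(X_⊥); comparing coefficients gives w'
  -- = 0, y' = -z, z' = κy.
  have h4 : deriv w t • S.X q + (deriv y t + z t) • S.Xperp q +
      (deriv z t - S.curvature q.1 * y t) • ((0 : Plane), (1 : ℝ)) = 0 := by
    have h5 : fderiv ℝ S.X q (S.dFlow t p ξ) = w t • fderiv ℝ S.X q (S.X q) +
        y t • fderiv ℝ S.X q (S.Xperp q) + z t • (-S.Xperp q) := by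
      conv_lhs => rw [h3]
      rw [map_add, map_add, map_smul, map_smul, map_smul, fderiv_X_vertical]
    rw [h5] at h2
    have h6 : fderiv ℝ S.Xperp q (S.X q) = fderiv ℝ S.X q (S.Xperp q) +
        (-S.curvature q.1) • ((0 : Plane), (1 : ℝ)) := by
      rw [← sub_eq_iff_eq_add', hst]; simp
    rw [h6] at h2
    have h7 := sub_eq_zero.2 h2.symm
    rw [← h7]
    module
  obtain ⟨e1, e2, e3⟩ := coef_combination hdet (deriv w t) (deriv y t + z t)
    (deriv z t - S.curvature q.1 * y t)
  rw [h4] at e1 e2 e3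
  obtain ⟨f1, f2, f3⟩ := coef_combination hdet 0 0 0
  simp only [zero_smul, add_zero] at f1 f2 f3
  rw [f1] at e1
  rw [f2] at e2
  rw [f3] at e3
  refine ⟨e1 ▸ hw, ?_, ?_⟩
  · rwa [show deriv y t = -z t by linarith] at hy
  · rwa [show deriv z t = S.curvature q.1 * y t by linarith] at hz

/-- The Jacobi function `b`, extended smoothly. -/
noncomputable def bExt (S : RiemSurface) (p : Plane × ℝ) (t : ℝ) : ℝ :=
  -S.coefXperp (S.extFlow t p) (S.dFlow t p (0, 1))

/-- The time derivative of `bExt`. -/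
noncomputable def bExt' (S : RiemSurface) (p : Plane × ℝ) (t : ℝ) : ℝ :=
  S.coefV (S.extFlow t p) (S.dFlow t p (0, 1))

/-- The Jacobi function `a`, extended smoothly. -/
noncomputable def aExt (S : RiemSurface) (p : Plane × ℝ) (t : ℝ) : ℝ :=
  S.coefXperp (S.extFlow t p) (S.dFlow t p (S.Xperp p))

/-- The time derivative of `aExt`. -/
noncomputable def aExt' (S : RiemSurface) (p : Plane × ℝ) (t : ℝ) : ℝ :=
  -S.coefV (S.extFlow t p) (S.dFlow t p (S.Xperp p))

theorem Xperp_shift (p : Plane × ℝ) (n : ℤ) : S.Xperp (p + (0, n * (2 * Real.pi))) = S.Xperp p := by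
  rw [Xperp_eq]
  simp only [Prod.fst_add, add_zero, Prod.snd_add, Real.cos_add_int_mul_two_pi,
    Real.sin_add_int_mul_two_pi]

theorem coefXperp_shift (p ζ : Plane × ℝ) (n : ℤ) :
    S.coefXperp (p + (0, n * (2 * Real.pi))) ζ = S.coefXperp p ζ := by
  rw [coefXperp, X_shift, Prod.fst_add, add_zero, coefXperp]

theorem bExt_shift (p : Plane × ℝ) (t : ℝ) (n : ℤ) :
    S.bExt (p + (0, n * (2 * Real.pi))) t = S.bExt p t := by
  rw [bExt, extFlow_shift, dFlow_shift, coefXperp_shift, bExt]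

theorem aExt_shift (p : Plane × ℝ) (t : ℝ) (n : ℤ) :
    S.aExt (p + (0, n * (2 * Real.pi))) t = S.aExt p t := by
  rw [aExt, extFlow_shift, dFlow_shift, coefXperp_shift, Xperp_shift, aExt]

theorem contDiffAt_bExt {t : ℝ} {p : Plane × ℝ} (hp : S.frameDet (S.extFlow t p).1 ≠ 0) :
    ContDiffAt ℝ ∞ (fun z : ℝ × (Plane × ℝ) => S.bExt z.2 z.1) (t, p) :=
  (contDiffAt_coef (S := S) S.extFlow_smooth.contDiffAt
    (contDiff_dFlow contDiff_fst contDiff_snd contDiff_const).contDiffAt (x := (t, p)) hp).2.1.neg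

theorem contDiffAt_aExt {t : ℝ} {p : Plane × ℝ} (hp : S.frameDet (S.extFlow t p).1 ≠ 0) :
    ContDiffAt ℝ ∞ (fun z : ℝ × (Plane × ℝ) => S.aExt z.2 z.1) (t, p) :=
  (contDiffAt_coef (S := S) S.extFlow_smooth.contDiffAt
    (contDiff_dFlow contDiff_fst contDiff_snd (S.Xperp_smooth.comp contDiff_snd)).contDiffAt
    (x := (t, p)) hp).2.1

theorem hasDerivAt_bExt {t : ℝ} {p : Plane × ℝ} (hp : S.extFlow t p ∈ S.SM) :
    HasDerivAt (S.bExt p) (S.bExt' p t) t := by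
  have := (hasDerivAt_coef_dFlow hp (0, 1)).2.1.fun_neg
  rwa [neg_neg] at this

theorem hasDerivAt_bExt' {t : ℝ} {p : Plane × ℝ} (hp : S.extFlow t p ∈ S.SM) :
    HasDerivAt (S.bExt' p) (-S.curvature (S.extFlow t p).1 * S.bExt p t) t := by
  have := (hasDerivAt_coef_dFlow hp (0, 1)).2.2
  rwa [bExt, neg_mul_neg]

theorem hasDerivAt_aExt {t : ℝ} {p : Plane × ℝ} (hp : S.extFlow t p ∈ S.SM) :
    HasDerivAt (S.aExt p) (S.aExt' p t) t :=
  (hasDerivAt_coef_dFlow hp (S.Xperp p)).2.1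

theorem hasDerivAt_aExt' {t : ℝ} {p : Plane × ℝ} (hp : S.extFlow t p ∈ S.SM) :
    HasDerivAt (S.aExt' p) (-S.curvature (S.extFlow t p).1 * S.aExt p t) t := by
  have := (hasDerivAt_coef_dFlow hp (S.Xperp p)).2.2.fun_neg
  rwa [aExt, neg_mul]

theorem Jacobi_initial {p : Plane × ℝ} (hp : p ∈ S.SM) :
    S.bExt p 0 = 0 ∧ S.bExt' p 0 = 1 ∧ S.aExt p 0 = 1 ∧ S.aExt' p 0 = 0 ∧
      S.coefX (S.extFlow 0 p) (S.dFlow 0 p (0, 1)) = 0 ∧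
      S.coefX (S.extFlow 0 p) (S.dFlow 0 p (S.Xperp p)) = 0 := by
  simp only [bExt, bExt', aExt, aExt', dFlow_zero, extFlow_zero]
  obtain ⟨h1, h2, h3⟩ := coef_combination (S := S) (frameDet_ne_zero hp.1) 0 0 1
  obtain ⟨k1, k2, k3⟩ := coef_combination (S := S) (frameDet_ne_zero hp.1) 0 1 0
  simp only [zero_smul, one_smul, zero_add, add_zero] at h1 h2 h3 k1 k2 k3
  rw [h1, h2, h3, k1, k2, k3]
  simp

end RiemSurface

theorem eq_of_hasDerivAt_zero {f : ℝ → ℝ} {t : ℝ} (ht : 0 ≤ t)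
    (h : ∀ s ∈ Icc 0 t, HasDerivAt f 0 s) : f t = f 0 :=
  constant_of_has_deriv_right_zero (fun s hs => (h s hs).continuousAt.continuousWithinAt)
    (fun s hs => (h s (Ico_subset_Icc_self hs)).hasDerivWithinAt) t (right_mem_Icc.2 ht)

/-- A smooth self-map with injective differential has a smooth local left inverse. -/
theorem exists_smooth_left_inverse {E : Type*} [NormedAddCommGroup E] [NormedSpace ℝ E]
    [FiniteDimensional ℝ E] {f : E → E} {a : E} (hf : ∀ᶠ x in 𝓝 a, ContDiffAt ℝ ∞ f x)
    (hinj : ∀ v, fderiv ℝ f a v = 0 → v = 0) :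
    ∃ Ψ : E → E, (∀ᶠ y in 𝓝 (f a), ContDiffAt ℝ ∞ Ψ y) ∧ Ψ (f a) = a ∧
      ∀ᶠ x in 𝓝 a, Ψ (f x) = x := by
  have : CompleteSpace E := FiniteDimensional.complete ℝ E
  have hfa := hf.self_of_nhds
  have hker : Function.Injective (fderiv ℝ f a : E →ₗ[ℝ] E) :=
    (injective_iff_map_eq_zero _).2 hinj
  set A : E ≃L[ℝ] E := (LinearEquiv.ofInjectiveEndo (fderiv ℝ f a : E →ₗ[ℝ] E)
    hker).toContinuousLinearEquiv with hA
  have hAc : (A : E →L[ℝ] E) = fderiv ℝ f a := by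
    ext v; rfl
  have hd : HasFDerivAt f (A : E →L[ℝ] E) a := by
    rw [hAc]; exact (hfa.differentiableAt (by simp)).hasFDerivAt
  have hs : HasStrictFDerivAt f (A : E →L[ℝ] E) a :=
    hfa.hasStrictFDerivAt' hd (by simp)
  set R := hs.toOpenPartialHomeomorph f
  have hRa : f a ∈ R.target := hs.image_mem_toOpenPartialHomeomorph_target
  have hRs : R.symm (f a) = a := R.left_inv hs.mem_toOpenPartialHomeomorph_source
  have hcont : ContinuousAt R.symm (f a) := R.symm.continuousAt hRa
  -- Order ∞ at a single point provides neighbourhoods that may shrink with the order, so smoothness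
  -- of the inverse is proved separately at each nearby point; invertibility of the derivative is an
  -- open condition.
  have hinv : ∀ᶠ x in 𝓝 a, fderiv ℝ f x ∈ range ((↑) : (E ≃L[ℝ] E) → E →L[ℝ] E) :=
    ((hfa.fderiv_right (m := 0) (by simp)).continuousAt).eventually
      (ContinuousLinearEquiv.isOpen.mem_nhds ⟨A, hAc⟩)
  refine ⟨R.symm, ?_, hRs, ?_⟩
  · have hev := hcont.eventually (by rw [hRs]; exact hf.and hinv)
    filter_upwards [hev, R.open_target.mem_nhds hRa] with y hy hyt
    obtain ⟨hy1, B, hB⟩ := hy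
    exact R.contDiffAt_symm hyt (f₀' := B)
      (by rw [hB]; exact (hy1.differentiableAt (by simp)).hasFDerivAt) hy1
  · filter_upwards [R.open_source.mem_nhds hs.mem_toOpenPartialHomeomorph_source] with x hx
    exact R.left_inv hx

theorem ContDiffAt.deriv_last {E : Type*} [NormedAddCommGroup E] [NormedSpace ℝ E]
    {R : ℝ × (E × ℝ) → ℝ} {z₀ : ℝ × (E × ℝ)} (h : ContDiffAt ℝ ∞ R z₀) :
    (fun z : ℝ × (E × ℝ) => deriv (fun s : ℝ => R (z.1, (z.2.1, s))) z.2.2) =ᶠ[𝓝 z₀]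
      (fun z => fderiv ℝ R z (0, (0, 1))) ∧
    ContDiffAt ℝ ∞ (fun z : ℝ × (E × ℝ) => deriv (fun s : ℝ => R (z.1, (z.2.1, s))) z.2.2) z₀ := by
  have hev : ∀ᶠ z in 𝓝 z₀, ContDiffAt ℝ 1 R z :=
    (h.of_le (by simp)).eventually (by simp)
  have key : (fun z : ℝ × (E × ℝ) => deriv (fun s : ℝ => R (z.1, (z.2.1, s))) z.2.2) =ᶠ[𝓝 z₀]
      (fun z => fderiv ℝ R z (0, (0, 1))) := by
    filter_upwards [hev] with z hz
    have h1 : HasDerivAt (fun s : ℝ => (z.1, (z.2.1, s))) ((0 : ℝ), ((0 : E), (1 : ℝ))) z.2.2 :=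
      (hasDerivAt_const _ _).prodMk ((hasDerivAt_const _ _).prodMk (hasDerivAt_id _))
    exact (HasFDerivAt.comp_hasDerivAt (l := R) z.2.2
      (hz.differentiableAt one_ne_zero).hasFDerivAt h1).deriv
  exact ⟨key, ((h.fderiv_right (by simp)).clm_apply contDiffAt_const).congr_of_eventuallyEq key⟩

theorem ContDiffAt.differentiableAt_last {E : Type*} [NormedAddCommGroup E] [NormedSpace ℝ E]
    {R : ℝ × (E × ℝ) → ℝ} {z : ℝ × (E × ℝ)} (h : ContDiffAt ℝ ∞ R z) :
    DifferentiableAt ℝ (fun s : ℝ => R (z.1, (z.2.1, s))) z.2.2 :=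
  DifferentiableAt.comp (g := R) z.2.2 (h.differentiableAt (by simp))
    ((differentiableAt_const _).prodMk ((differentiableAt_const _).prodMk differentiableAt_id))

/-! ### The functions a and b, and the kernel in polar coordinates. -/

namespace RiemSurface

variable {S : RiemSurface}

/-- This is the Gauss lemma: the X-coefficient is constant along the geodesic, and it vanishes
initially for V and for X_⊥. -/
theorem coefX_dFlow_eq_zero {p : Plane × ℝ} (hp : p ∈ S.SM) {t : ℝ}
    (ht : t ∈ Icc 0 (S.exitTime p)) : S.coefX (S.extFlow t p) (S.dFlow t p (0, 1)) = 0 ∧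
      S.coefX (S.extFlow t p) (S.dFlow t p (S.Xperp p)) = 0 := by
  have hmem : ∀ s ∈ Icc 0 t, S.extFlow s p ∈ S.SM := fun s hs =>
    extFlow_mem_SM hp ⟨hs.1, hs.2.trans ht.2⟩
  obtain ⟨-, -, -, -, h1, h2⟩ := Jacobi_initial hp
  exact ⟨(eq_of_hasDerivAt_zero ht.1 fun s hs =>
    (hasDerivAt_coef_dFlow (hmem s hs) (0, 1)).1).trans h1,
    (eq_of_hasDerivAt_zero ht.1 fun s hs =>
      (hasDerivAt_coef_dFlow (hmem s hs) (S.Xperp p)).1).trans h2⟩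

theorem dFlow_vertical {p : Plane × ℝ} (hp : p ∈ S.SM) {t : ℝ}
    (ht : t ∈ Icc 0 (S.exitTime p)) : S.dFlow t p (0, 1) =
      (-S.bExt p t) • S.Xperp (S.extFlow t p) + S.bExt' p t • ((0 : Plane), (1 : ℝ)) := by
  have h := coef_decomposition (S := S) (frameDet_ne_zero (extFlow_mem_SM hp ht).1)
    (S.dFlow t p (0, 1))
  rw [(coefX_dFlow_eq_zero hp ht).1, zero_smul, zero_add] at h
  rw [bExt, bExt', neg_neg]
  exact h

theorem dFlow_Xperp {p : Plane × ℝ} (hp : p ∈ S.SM) {t : ℝ}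
    (ht : t ∈ Icc 0 (S.exitTime p)) : S.dFlow t p (S.Xperp p) =
      S.aExt p t • S.Xperp (S.extFlow t p) + (-S.aExt' p t) • ((0 : Plane), (1 : ℝ)) := by
  have h := coef_decomposition (S := S) (frameDet_ne_zero (extFlow_mem_SM hp ht).1)
    (S.dFlow t p (S.Xperp p))
  rw [(coefX_dFlow_eq_zero hp ht).2, zero_smul, zero_add] at h
  rw [aExt, aExt', neg_neg]
  exact h

theorem wronskian {p : Plane × ℝ} (hp : p ∈ S.SM) {t : ℝ} (ht : t ∈ Icc 0 (S.exitTime p)) :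
    S.aExt p t * S.bExt' p t - S.aExt' p t * S.bExt p t = 1 := by
  obtain ⟨h1, h2, h3, h4, -⟩ := Jacobi_initial hp
  have h := eq_of_hasDerivAt_zero (f := fun s => S.aExt p s * S.bExt' p s -
    S.aExt' p s * S.bExt p s) ht.1 fun s hs => by
      have hm := extFlow_mem_SM hp (s := s) ⟨hs.1, hs.2.trans ht.2⟩
      have := ((hasDerivAt_aExt hm).fun_mul (hasDerivAt_bExt' hm)).fun_sub
        ((hasDerivAt_aExt' hm).fun_mul (hasDerivAt_bExt hm))
      exact this.congr_deriv (by ring)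
  simp only [h1, h2, h3, h4] at h
  linarith

theorem isJacobi_aExt {p : Plane × ℝ} (hp : p ∈ S.SM) : S.IsJacobi p 1 0 (S.aExt p) := by
  obtain ⟨-, -, h3, h4, -⟩ := Jacobi_initial hp
  refine ⟨S.aExt' p, h3, h4, fun s hs => ?_⟩
  have hm := extFlow_mem_SM hp hs
  rw [flow_eq hp hs]
  exact ⟨(hasDerivAt_aExt hm).hasDerivWithinAt, (hasDerivAt_aExt' hm).hasDerivWithinAt⟩

theorem isJacobi_bExt {p : Plane × ℝ} (hp : p ∈ S.SM) : S.IsJacobi p 0 1 (S.bExt p) := by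
  obtain ⟨h3, h4, -⟩ := Jacobi_initial hp
  refine ⟨S.bExt' p, h3, h4, fun s hs => ?_⟩
  have hm := extFlow_mem_SM hp hs
  rw [flow_eq hp hs]
  exact ⟨(hasDerivAt_bExt hm).hasDerivWithinAt, (hasDerivAt_bExt' hm).hasDerivWithinAt⟩

theorem continuous_extFlow_curve (p : Plane × ℝ) : Continuous fun s => S.extFlow s p :=
  S.continuous_extFlow.comp (Continuous.prodMk_left p)

/-- The Jacobi equation as a linear first-order system has bounded coefficients on the compact time
interval. The lemma identifies the solutions picked by choice in `jacobi` with the smooth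
extensions. -/
theorem IsJacobi.eqOn {p : Plane × ℝ} (hp : p ∈ S.SM) {y₀ y₁ : ℝ} {y z : ℝ → ℝ}
    (hy : S.IsJacobi p y₀ y₁ y) (hz : S.IsJacobi p y₀ y₁ z) : EqOn y z (Icc 0 (S.exitTime p)) := by
  obtain ⟨y', hy0, hy'0, hy⟩ := hy
  obtain ⟨z', hz0, hz'0, hz⟩ := hz
  have hκ : Continuous fun s => S.curvature (S.extFlow s p).1 :=
    S.curvature_smooth.continuous.comp (continuous_extFlow_curve p).fst
  obtain ⟨B, hB⟩ := isCompact_Icc.exists_bound_of_continuousOn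
    (s := Icc 0 (S.exitTime p)) hκ.continuousOn
  have hlip : ∀ t ∈ Ico 0 (S.exitTime p), LipschitzOnWith (max 1 B).toNNReal
      (fun u : ℝ × ℝ => (u.2, -S.curvature (S.extFlow t p).1 * u.1)) univ := by
    intro t ht
    refine (LipschitzWith.of_dist_le_mul fun u v => ?_).lipschitzOnWith
    rw [Real.coe_toNNReal _ (by positivity), dist_eq_norm, dist_eq_norm, Prod.mk_sub_mk,
      ← mul_sub, Prod.norm_mk]
    refine max_le ?_ ?_
    · calc ‖u.2 - v.2‖ ≤ 1 * ‖u - v‖ := by rw [one_mul]; exact norm_snd_le (u - v)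
        _ ≤ _ := by gcongr; exact le_max_left _ _
    · rw [norm_mul, norm_neg]
      gcongr
      · exact (hB t (Ico_subset_Icc_self ht)).trans (le_max_right _ _)
      · exact norm_fst_le (u - v)
  have key : ∀ {u u' : ℝ → ℝ}, (∀ s ∈ Icc 0 (S.exitTime p),
      HasDerivWithinAt u (u' s) (Icc 0 (S.exitTime p)) s ∧
      HasDerivWithinAt u' (-S.curvature (S.flow p s).1 * u s) (Icc 0 (S.exitTime p)) s) →
      ContinuousOn (fun s => (u s, u' s)) (Icc 0 (S.exitTime p)) ∧
      ∀ s ∈ Ico 0 (S.exitTime p), HasDerivWithinAt (fun s => (u s, u' s))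
        ((fun t (u : ℝ × ℝ) => (u.2, -S.curvature (S.extFlow t p).1 * u.1)) s (u s, u' s))
        (Ici s) s := by
    intro u u' hu
    refine ⟨fun s hs => (hu s hs).1.continuousWithinAt.prodMk (hu s hs).2.continuousWithinAt,
      fun s hs => ?_⟩
    have hs' := Ico_subset_Icc_self hs
    have h1 := (hu s hs').1.prodMk (hu s hs').2
    rw [flow_eq hp hs'] at h1
    exact h1.mono_of_mem_nhdsWithin
      (mem_of_superset (Icc_mem_nhdsGE hs.2) (Icc_subset_Icc_left hs.1))
  intro s hs
  have := ODE_solution_unique_of_mem_Icc_right (s := fun _ => univ) hlip (key hy).1 (key hy).2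
    (fun _ _ => trivial) (key hz).1 (key hz).2 (fun _ _ => trivial)
    (by rw [hy0, hz0, hy'0, hz'0]) hs
  exact congrArg Prod.fst this

theorem a_eq_aExt {p : Plane × ℝ} (hp : p ∈ S.SM) {t : ℝ} (ht : t ∈ Icc 0 (S.exitTime p)) :
    S.a p t = S.aExt p t := by
  have hex : ∃ y, S.IsJacobi p 1 0 y := ⟨_, isJacobi_aExt hp⟩
  rw [a, jacobi, dif_pos hex]
  exact IsJacobi.eqOn hp hex.choose_spec (isJacobi_aExt hp) ht

theorem b_eq_bExt {p : Plane × ℝ} (hp : p ∈ S.SM) {t : ℝ} (ht : t ∈ Icc 0 (S.exitTime p)) :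
    S.b p t = S.bExt p t := by
  have hex : ∃ y, S.IsJacobi p 0 1 y := ⟨_, isJacobi_bExt hp⟩
  rw [b, jacobi, dif_pos hex]
  exact IsJacobi.eqOn hp hex.choose_spec (isJacobi_bExt hp) ht

/-- b starts positive because b'(0) = 1, and a change of sign would produce a conjugate point. -/
theorem IsSimple.bExt_pos (hS : S.IsSimple) {p : Plane × ℝ} (hp : p ∈ S.SM) {t : ℝ} (h0 : 0 < t)
    (h1 : t ≤ S.exitTime p) : 0 < S.bExt p t := by
  have hne : ∀ s, 0 < s → s ≤ S.exitTime p → S.bExt p s ≠ 0 := fun s hs0 hs1 => by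
    rw [← b_eq_bExt hp ⟨hs0.le, hs1⟩]; exact hS.no_conjugate p hp s hs0 hs1
  obtain ⟨hb0, hb1, -⟩ := Jacobi_initial hp
  have hder : HasDerivAt (S.bExt p) 1 0 := by
    rw [← hb1]; exact hasDerivAt_bExt (by rw [S.extFlow_zero]; exact hp)
  have hpos : ∀ᶠ s in 𝓝[>] (0 : ℝ), 0 < S.bExt p s := by
    have hsl : ∀ᶠ s in 𝓝[>] (0 : ℝ), 0 < slope (S.bExt p) 0 s :=
      ((hasDerivAt_iff_tendsto_slope.1 hder).mono_left
        (nhdsWithin_mono _ fun s hs => ne_of_gt hs)).eventually_const_lt one_pos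
    filter_upwards [hsl, self_mem_nhdsWithin] with s hs hs0
    rw [slope_def_field, hb0, sub_zero, sub_zero] at hs
    exact (div_pos_iff_of_pos_right (show (0 : ℝ) < s from hs0)).1 hs
  by_contra! hneg
  obtain ⟨s, hs, hs'⟩ := (hpos.and (Ioo_mem_nhdsGT h0)).exists
  have hcont : ContinuousOn (S.bExt p) (Icc s t) := fun r hr =>
    (hasDerivAt_bExt (extFlow_mem_SM hp
      ⟨hs'.1.le.trans hr.1, hr.2.trans h1⟩)).continuousAt.continuousWithinAt
  obtain ⟨r, hr, hr0⟩ := intermediate_value_Icc' hs'.2.le hcont ⟨hneg, hs.le⟩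
  exact hne r (hs'.1.trans_le hr.1) (hr.2.trans h1) hr0

theorem exitTime_shift (p : Plane × ℝ) (n : ℤ) :
    S.exitTime (p + (0, n * (2 * Real.pi))) = S.exitTime p := by
  have : S.survivalTimes (p + (0, n * (2 * Real.pi))) = S.survivalTimes p := by
    ext T
    simp only [mem_survivalTimes, extFlow_shift, mem_SM_iff, Prod.fst_add, add_zero]
  rw [exitTime, this, exitTime]

/-- The factor `q_k`, in terms of the smooth extensions of the Jacobi functions. -/
noncomputable def qExt (S : RiemSurface) (k : ℤ) (p : Plane × ℝ) (t : ℝ) : ℂ :=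
  (-((deriv (fun s : ℝ => S.aExt (p.1, s) t / S.bExt (p.1, s) t) p.2 : ℝ) : ℂ) +
      Complex.I * k * (((S.aExt p t - 1) / S.bExt p t : ℝ) : ℂ)) *
    Complex.exp (Complex.I * k * (((S.extFlow t p).2 - p.2 : ℝ) : ℂ))

/-- The value of the kernel at the point with exponential polar coordinates `(θ, t)`. -/
noncomputable def kernelValue (S : RiemSurface) (k : ℤ) (p : Plane × ℝ) (t : ℝ) : ℂ :=
  -(1 / (2 * Real.pi) : ℂ) * (S.qExt k p t / S.bExt p t)

theorem kernelValue_shift (k : ℤ) (p : Plane × ℝ) (t : ℝ) (n : ℤ) :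
    S.kernelValue k (p + (0, n * (2 * Real.pi))) t = S.kernelValue k p t := by
  have h1 : ∀ s : ℝ, (p.1, s + n * (2 * Real.pi)) = (p.1, s) + ((0 : Plane), n * (2 * Real.pi)) :=
    fun s => by simp
  have h2 : deriv (fun s : ℝ => S.aExt (p.1, s) t / S.bExt (p.1, s) t) (p.2 + n * (2 * Real.pi)) =
      deriv (fun s : ℝ => S.aExt (p.1, s) t / S.bExt (p.1, s) t) p.2 := by
    rw [← deriv_comp_add_const (fun s : ℝ => S.aExt (p.1, s) t / S.bExt (p.1, s) t)]
    simp only [h1, aExt_shift, bExt_shift]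
  simp only [kernelValue, qExt, bExt_shift, aExt_shift, extFlow_shift, Prod.fst_add, add_zero,
    Prod.snd_add, h2, add_sub_add_right_eq_sub]

theorem contDiffAt_quotient {p : Plane × ℝ} {t : ℝ}
    (hp : S.frameDet (S.extFlow t p).1 ≠ 0) (hb : S.bExt p t ≠ 0) :
    ContDiffAt ℝ ∞ (fun z : ℝ × (Plane × ℝ) => S.aExt z.2 z.1 / S.bExt z.2 z.1) (t, p) :=
  (contDiffAt_aExt hp).div (contDiffAt_bExt hp) hb

theorem contDiffAt_kernelValue (k : ℤ) {p : Plane × ℝ} {t : ℝ}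
    (hp : S.frameDet (S.extFlow t p).1 ≠ 0) (hb : S.bExt p t ≠ 0) :
    ContDiffAt ℝ ∞ (fun z : ℝ × (Plane × ℝ) => S.kernelValue k z.2 z.1) (t, p) := by
  have hd : ContDiffAt ℝ ∞ (fun z : ℝ × (Plane × ℝ) =>
      deriv (fun s : ℝ => S.aExt (z.2.1, s) z.1 / S.bExt (z.2.1, s) z.1) z.2.2) (t, p) :=
    (contDiffAt_quotient hp hb).deriv_last.2
  have ha := contDiffAt_aExt hp
  have hb' := contDiffAt_bExt hp
  have hofReal : ∀ {f : ℝ × (Plane × ℝ) → ℝ}, ContDiffAt ℝ ∞ f (t, p) →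
      ContDiffAt ℝ ∞ (fun z => (f z : ℂ)) (t, p) := fun hf =>
    Complex.ofRealCLM.contDiff.contDiffAt.comp (t, p) hf
  have hang : ContDiffAt ℝ ∞ (fun z : ℝ × (Plane × ℝ) => (S.extFlow z.1 z.2).2 - z.2.2) (t, p) :=
    (S.extFlow_smooth.snd.sub (contDiff_snd.snd)).contDiffAt
  have hdC := hofReal hd
  have haC : ContDiffAt ℝ ∞ (fun z : ℝ × (Plane × ℝ) =>
      (((S.aExt z.2 z.1 - 1) / S.bExt z.2 z.1 : ℝ) : ℂ)) (t, p) :=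
    hofReal ((ha.sub (contDiffAt_const (c := (1 : ℝ)))).div hb' hb)
  have hangC := (contDiffAt_const (c := Complex.I * (k : ℂ))).mul (hofReal hang)
  have hcoef := hdC.neg.add ((contDiffAt_const (c := Complex.I * (k : ℂ))).mul haC)
  have hq : ContDiffAt ℝ ∞ (fun z : ℝ × (Plane × ℝ) => S.qExt k z.2 z.1) (t, p) :=
    hcoef.mul hangC.cexp
  have hbC : ContDiffAt ℝ ∞ (fun z : ℝ × (Plane × ℝ) => ((S.bExt z.2 z.1 : ℂ))⁻¹) (t, p) :=
    (hofReal hb').inv (by exact_mod_cast hb)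
  simp only [kernelValue, div_eq_mul_inv]
  exact contDiffAt_const.mul (hq.mul hbC)

namespace IsSimple

/-- By lower semicontinuity the geodesics with nearby angles also live up to time t. Hence a/b
agrees with its smooth extension for all nearby angles, and so do the θ-derivatives. -/
theorem q_eq_qExt (hS : S.IsSimple) (k : ℤ) {p : Plane × ℝ} (hp : p ∈ S.SM) {t : ℝ} (h0 : 0 < t)
    (h1 : t < S.exitTime p) :
    DifferentiableAt ℝ (fun s : ℝ => S.a (p.1, s) t / S.b (p.1, s) t) p.2 ∧
      S.q k p t = S.qExt k p t := by
  have hev : (fun s : ℝ => S.a (p.1, s) t / S.b (p.1, s) t) =ᶠ[𝓝 p.2]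
      fun s => S.aExt (p.1, s) t / S.bExt (p.1, s) t := by
    have hc : Continuous fun s : ℝ => (p.1, s) := Continuous.prodMk_right p.1
    filter_upwards [hc.continuousAt.eventually (hS.eventually_lt_exitTime hp h1)] with s hs
    have hsM : (p.1, s) ∈ S.SM := ⟨hp.1, trivial⟩
    rw [a_eq_aExt hsM ⟨h0.le, (hs hsM).le⟩, b_eq_bExt hsM ⟨h0.le, (hs hsM).le⟩]
  have ht : t ∈ Icc 0 (S.exitTime p) := ⟨h0.le, h1.le⟩
  refine ⟨?_, ?_⟩
  · refine DifferentiableAt.congr_of_eventuallyEq ?_ hev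
    have hR := contDiffAt_quotient (frameDet_ne_zero (extFlow_mem_SM hp ht).1) (hS.bExt_pos hp h0 h1.le).ne'
    exact hR.differentiableAt_last
  · rw [q, qExt, hev.deriv_eq, a_eq_aExt hp ht, b_eq_bExt hp ht, flow_eq hp ht]

/-- Properness of the exponential map: the polar coordinates of the points near a given pair are
near the polar coordinates of that pair. -/
theorem eventually_polar_mem (hS : S.IsSimple) (z₀ : Plane × Plane) (θ₁ : ℝ)
    {N : Set ((Plane × ℝ) × ℝ)} (hN : IsOpen N)
    (h : ∀ p ∈ S.M ×ˢ Icc θ₁ (θ₁ + 2 * Real.pi), ∀ t ∈ Icc 0 (S.exitTime p),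
      (p.1, (S.extFlow t p).1) = z₀ → (p, t) ∈ N) :
    ∀ᶠ z in 𝓝 z₀, ∀ p ∈ S.M ×ˢ Icc θ₁ (θ₁ + 2 * Real.pi), ∀ t ∈ Icc 0 (S.exitTime p),
      (p.1, (S.extFlow t p).1) = z → (p, t) ∈ N := by
  -- Q is the set of all polar coordinates with base point in M and angle in the window; scaling
  -- time by the continuous exit time shows that it is compact. The part of Q outside N then has
  -- compact image missing z₀, and the complement of that image is the required neighbourhood.
  set Q : Set ((Plane × ℝ) × ℝ) := (fun w : (Plane × ℝ) × ℝ => (w.1, w.2 * S.exitTime w.1)) ''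
    ((S.M ×ˢ Icc θ₁ (θ₁ + 2 * Real.pi)) ×ˢ Icc 0 1) with hQ
  have hQc : IsCompact Q := by
    refine ((S.compact.prod isCompact_Icc).prod isCompact_Icc).image_of_continuousOn ?_
    refine continuousOn_fst.prodMk (continuousOn_snd.mul ?_)
    exact hS.continuousOn_exitTime.comp continuousOn_fst fun w hw => ⟨hw.1.1, trivial⟩
  have hmem : ∀ p ∈ S.M ×ˢ Icc θ₁ (θ₁ + 2 * Real.pi), ∀ t ∈ Icc 0 (S.exitTime p),
      (p, t) ∈ Q := by
    intro p hp t ht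
    rcases ht.1.trans ht.2 |>.eq_or_lt with h0 | h0
    · refine ⟨(p, 0), ⟨hp, left_mem_Icc.2 zero_le_one⟩, ?_⟩
      simp only [zero_mul, Prod.mk.injEq, true_and]
      exact le_antisymm ht.1 (h0 ▸ ht.2)
    · refine ⟨(p, t / S.exitTime p), ⟨hp, div_nonneg ht.1 h0.le, (div_le_one h0).2 ht.2⟩, ?_⟩
      simp only [div_mul_cancel₀ _ h0.ne']
  have hQmem : ∀ w ∈ Q, w.1 ∈ S.M ×ˢ Icc θ₁ (θ₁ + 2 * Real.pi) ∧ w.2 ∈ Icc 0 (S.exitTime w.1) := by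
    rintro _ ⟨w, ⟨hw1, hw2⟩, rfl⟩
    have hτ := hS.exitTime_nonneg (p := w.1) ⟨hw1.1, trivial⟩
    exact ⟨hw1, mul_nonneg hw2.1 hτ, mul_le_of_le_one_left hτ hw2.2⟩
  have hcont : Continuous fun w : (Plane × ℝ) × ℝ => (w.1.1, (S.extFlow w.2 w.1).1) :=
    continuous_fst.fst.prodMk (S.continuous_extFlow.comp continuous_swap).fst
  have hK : IsCompact ((fun w : (Plane × ℝ) × ℝ => (w.1.1, (S.extFlow w.2 w.1).1)) '' (Q \ N)) :=
    (hQc.diff hN).image hcont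
  have hz : z₀ ∉ (fun w : (Plane × ℝ) × ℝ => (w.1.1, (S.extFlow w.2 w.1).1)) '' (Q \ N) := by
    rintro ⟨w, ⟨hwQ, hwN⟩, hw⟩
    exact hwN (h w.1 (hQmem w hwQ).1 w.2 (hQmem w hwQ).2 hw)
  filter_upwards [hK.isClosed.isOpen_compl.mem_nhds hz] with z hz p hp t ht hpz
  by_contra hcon
  exact hz ⟨(p, t), ⟨hmem p hp t ht, hcon⟩, hpz⟩

end IsSimple

end RiemSurface

/-! ### Exponential polar coordinates away from the diagonal. -/

namespace RiemSurface

variable {S : RiemSurface}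

theorem fderiv_extFlow_apply (t : ℝ) (p : Plane × ℝ) (σ : ℝ) (ξ : Plane × ℝ) :
    fderiv ℝ (fun z : ℝ × (Plane × ℝ) => S.extFlow z.1 z.2) (t, p) (σ, ξ) =
      σ • S.extX (S.extFlow t p) + S.dFlow t p ξ := by
  have h1 : HasDerivAt (fun s : ℝ => (s, p)) ((1 : ℝ), (0 : Plane × ℝ)) t :=
    (hasDerivAt_id t).prodMk (hasDerivAt_const _ _)
  have h2 := HasFDerivAt.comp_hasDerivAt (l := fun z : ℝ × (Plane × ℝ) => S.extFlow z.1 z.2) t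
    ((S.extFlow_smooth.differentiable (by simp) (t, p)).hasFDerivAt) h1
  rw [← (h2.unique (S.hasDerivAt_extFlow t p)), dFlow, ← map_smul, ← map_add]
  simp

/-- Exponential polar coordinates, as a map `(x, (θ, t)) ↦ (x, γ_{x,θ}(t))`. -/
noncomputable def polarMap (S : RiemSurface) (w : Plane × Plane) : Plane × Plane :=
  (w.1, (S.extFlow w.2.2 (w.1, w.2.1)).1)

theorem contDiff_polarMap : ContDiff ℝ ∞ S.polarMap :=
  contDiff_fst.prodMk (S.extFlow_smooth.comp
    (contDiff_snd.snd.prodMk (contDiff_fst.prodMk contDiff_snd.fst))).fst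

theorem fderiv_polarMap (w v : Plane × Plane) : fderiv ℝ S.polarMap w v =
    (v.1, (v.2.2 • S.extX (S.extFlow w.2.2 (w.1, w.2.1)) +
      S.dFlow w.2.2 (w.1, w.2.1) (v.1, v.2.1)).1) := by
  have h1 : HasFDerivAt (fun w : Plane × Plane => (w.2.2, (w.1, w.2.1)))
      ((ContinuousLinearMap.snd ℝ ℝ ℝ ∘L ContinuousLinearMap.snd ℝ Plane Plane).prod
        ((ContinuousLinearMap.fst ℝ Plane Plane).prod
          (ContinuousLinearMap.fst ℝ ℝ ℝ ∘L ContinuousLinearMap.snd ℝ Plane Plane))) w :=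
    (((ContinuousLinearMap.snd ℝ ℝ ℝ ∘L ContinuousLinearMap.snd ℝ Plane Plane).prod
        ((ContinuousLinearMap.fst ℝ Plane Plane).prod
          (ContinuousLinearMap.fst ℝ ℝ ℝ ∘L
            ContinuousLinearMap.snd ℝ Plane Plane)))).hasFDerivAt
  have h2 := HasFDerivAt.comp (g := fun z : ℝ × (Plane × ℝ) => S.extFlow z.1 z.2) w
    ((S.extFlow_smooth.differentiable (by simp) (w.2.2, (w.1, w.2.1))).hasFDerivAt) h1
  have h3 := (hasFDerivAt_fst (𝕜 := ℝ) (p := w)).prodMk h2.fst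
  have h4 : fderiv ℝ S.polarMap w = _ := h3.fderiv
  rw [h4, ← fderiv_extFlow_apply]
  rfl

/-- `z` is the value of the kernel required at the pair `xy`. -/
def IsKernelAt (S : RiemSurface) (k : ℤ) (xy : Plane × Plane) (z : ℂ) : Prop :=
  ∀ θ t : ℝ, xy.1 ∈ S.M → 0 < t → t < S.exitTime (xy.1, θ) →
    (S.extFlow t (xy.1, θ)).1 = xy.2 → z = S.kernelValue k (xy.1, θ) t

theorem exists_shift (θ θ₁ : ℝ) :
    ∃ n : ℤ, θ + n * (2 * Real.pi) ∈ Ico θ₁ (θ₁ + 2 * Real.pi) := by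
  obtain ⟨n, hn, -⟩ := existsUnique_add_zsmul_mem_Ico Real.two_pi_pos θ θ₁
  exact ⟨n, by rwa [zsmul_eq_mul] at hn⟩

theorem shift_apply (x : Plane) (θ : ℝ) (n : ℤ) :
    (x, θ + n * (2 * Real.pi)) = (x, θ) + ((0 : Plane), (n : ℝ) * (2 * Real.pi)) := by
  simp

/-- It suffices to consider the angles in an interval of length `2π`. -/
theorem isKernelAt_of_Ico {k : ℤ} {xy : Plane × Plane} {z : ℂ} (θ₁ : ℝ)
    (h : ∀ θ ∈ Ico θ₁ (θ₁ + 2 * Real.pi), ∀ t, xy.1 ∈ S.M → 0 < t → t < S.exitTime (xy.1, θ) →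
      (S.extFlow t (xy.1, θ)).1 = xy.2 → z = S.kernelValue k (xy.1, θ) t) :
    S.IsKernelAt k xy z := by
  intro θ t hx h0 h1 h2
  obtain ⟨n, hn⟩ := exists_shift θ θ₁
  have := h _ hn t hx h0 (by rwa [shift_apply, exitTime_shift])
    (by rw [shift_apply, extFlow_shift, Prod.fst_add, add_zero, h2])
  rwa [shift_apply, kernelValue_shift] at this

/-- After normalization to [0, 2π), `exp_bijective` shows that the two angles differ by a multiple
of 2π, and the bound π forces that multiple to be zero. Angles near the cut at 0 are thereby covered
too. -/
theorem IsSimple.polar_unique (hS : S.IsSimple) {x y : Plane} (hx : x ∈ S.M) (hxy : y ≠ x)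
    {θ θ' t t' : ℝ} (ht : t ∈ Icc 0 (S.exitTime (x, θ))) (ht' : t' ∈ Icc 0 (S.exitTime (x, θ')))
    (h : (S.extFlow t (x, θ)).1 = y) (h' : (S.extFlow t' (x, θ')).1 = y)
    (hθ : |θ - θ'| ≤ Real.pi) : θ = θ' ∧ t = t' := by
  have hy : y ∈ S.M := h ▸ (extFlow_mem_SM (p := (x, θ)) ⟨hx, trivial⟩ ht).1
  have key : ∀ {θ t : ℝ}, t ∈ Icc 0 (S.exitTime (x, θ)) → (S.extFlow t (x, θ)).1 = y →
      ∃ n : ℤ, θ + n * (2 * Real.pi) ∈ Ico 0 (2 * Real.pi) ∧ 0 < t ∧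
        t ≤ S.exitTime (x, θ + n * (2 * Real.pi)) ∧
        (S.flow (x, θ + n * (2 * Real.pi)) t).1 = y := by
    intro θ t ht h
    obtain ⟨n, hn⟩ := exists_shift θ 0
    rw [zero_add] at hn
    have ht2 : t ∈ Icc 0 (S.exitTime (x, θ + n * (2 * Real.pi))) := by
      rwa [shift_apply, exitTime_shift]
    refine ⟨n, hn, ht.1.lt_of_ne ?_, ht2.2, ?_⟩
    · rintro rfl
      rw [extFlow_zero] at h
      exact hxy h.symm
    · rw [flow_eq (p := (x, θ + n * (2 * Real.pi))) ⟨hx, trivial⟩ ht2, shift_apply, extFlow_shift,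
        Prod.fst_add, add_zero, h]
  obtain ⟨n, hn⟩ := key ht h
  obtain ⟨m, hm⟩ := key ht' h'
  have := (hS.exp_bijective x hx y hy hxy).unique (y₁ := (θ + n * (2 * Real.pi), t))
    (y₂ := (θ' + m * (2 * Real.pi), t')) hn hm
  obtain ⟨h1, h2⟩ := Prod.mk.inj this
  refine ⟨?_, h2⟩
  have h3 : θ - θ' = (m - n : ℤ) * (2 * Real.pi) := by push_cast; linarith
  have h4 : (m - n : ℤ) = 0 := by
    by_contra hne
    have : (1 : ℝ) ≤ |((m - n : ℤ) : ℝ)| := by exact_mod_cast Int.one_le_abs hne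
    rw [h3, abs_mul, abs_of_pos Real.two_pi_pos] at hθ
    nlinarith [Real.pi_pos]
  rw [h4] at h3
  simp only [Int.cast_zero, zero_mul] at h3
  linarith

theorem IsSimple.exists_polar (hS : S.IsSimple) {x y : Plane} (hx : x ∈ S.M) (hy : y ∈ S.M)
    (hxy : y ≠ x) : ∃ θ ∈ Ico 0 (2 * Real.pi), ∃ t, 0 < t ∧ t ≤ S.exitTime (x, θ) ∧
      (S.extFlow t (x, θ)).1 = y := by
  obtain ⟨v, ⟨h1, h2, h3, h4⟩, -⟩ := hS.exp_bijective x hx y hy hxy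
  rw [flow_eq (p := (x, v.1)) ⟨hx, trivial⟩ ⟨h2.le, h3⟩] at h4
  exact ⟨v.1, h1, v.2, h2, h3, h4⟩

/-- The first component forces the variation of x to vanish; in the directions θ and t the
differential is given by the base components of -bX_⊥ and X, which are independent as b ≠ 0. -/
theorem IsSimple.polarMap_immersive (hS : S.IsSimple) {x : Plane} (hx : x ∈ S.M) {θ t : ℝ}
    (h0 : 0 < t) (ht : t ≤ S.exitTime (x, θ)) (v : Plane × Plane)
    (hv : fderiv ℝ S.polarMap (x, (θ, t)) v = 0) : v = 0 := by
  have hp : (x, θ) ∈ S.SM := ⟨hx, trivial⟩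
  have hm := extFlow_mem_SM hp ⟨h0.le, ht⟩
  obtain ⟨ξ, η, σ⟩ := v
  rw [fderiv_polarMap] at hv
  simp only [Prod.mk_eq_zero] at hv
  obtain ⟨rfl, hv⟩ := hv
  have h1 : ((0 : Plane), η) = η • ((0 : Plane), (1 : ℝ)) := by simp
  have h2 : S.dFlow t (x, θ) (0, η) = η • S.dFlow t (x, θ) (0, 1) := by
    rw [h1, dFlow, dFlow, ← map_smul]; simp
  rw [h2, dFlow_vertical hp ⟨h0.le, ht⟩, extX_eq (S.norm_lt_of_mem_M hm.1)] at hv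
  have hd := det2_X_Xperp (S := S) (S.extFlow t (x, θ))
  have hne := frameDet_ne_zero hm.1
  have hb := (hS.bExt_pos hp h0 ht).ne'
  set u := (S.X (S.extFlow t (x, θ))).1
  set w := (S.Xperp (S.extFlow t (x, θ))).1
  have h3 : σ • u + (η * -S.bExt (x, θ) t) • w = 0 := by
    rw [← hv]
    simp [u, w, smul_smul]
  have h4 : σ * det2 u w = 0 := by
    have := congrArg (fun y => det2 y w) h3
    simp only [det2, Prod.fst_add, Prod.smul_fst, Prod.snd_add, Prod.smul_snd, smul_eq_mul,
      Prod.fst_zero, Prod.snd_zero] at this ⊢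
    linarith
  have h5 : (η * -S.bExt (x, θ) t) * det2 u w = 0 := by
    have := congrArg (fun y => det2 u y) h3
    simp only [det2, Prod.fst_add, Prod.smul_fst, Prod.snd_add, Prod.smul_snd, smul_eq_mul,
      Prod.fst_zero, Prod.snd_zero] at this ⊢
    linarith
  rw [hd] at h4 h5
  have hσ : σ = 0 := by simpa [hne] using h4
  have hη : η = 0 := by simpa [hne, hb] using h5
  simp [hσ, hη]

/-- The inverse function theorem gives smooth local polar coordinates, also for y₀ on the boundary,
where the extended flow continues past the exit time. A local inverse alone could miss other
preimages; properness and global uniqueness exclude them. -/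
theorem IsSimple.exists_local_kernel_offDiag (hS : S.IsSimple) (k : ℤ) {x₀ y₀ : Plane}
    (hx : x₀ ∈ S.M) (hy : y₀ ∈ S.M) (hxy : y₀ ≠ x₀) :
    ∃ G : Plane × Plane → ℂ, ∀ᶠ z in 𝓝 (x₀, y₀), ContDiffAt ℝ ∞ G z ∧ S.IsKernelAt k z (G z) := by
  obtain ⟨θ₀, -, t₀, h0, ht, hexp⟩ := hS.exists_polar hx hy hxy
  have hp : (x₀, θ₀) ∈ S.SM := ⟨hx, trivial⟩
  have hm := extFlow_mem_SM hp ⟨h0.le, ht⟩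
  obtain ⟨Ψ, hΨ, hΨ0, hΨinv⟩ := exists_smooth_left_inverse (f := S.polarMap) (a := (x₀, (θ₀, t₀)))
    (Eventually.of_forall fun x => contDiff_polarMap.contDiffAt)
    (hS.polarMap_immersive hx h0 ht)
  have hE : S.polarMap (x₀, (θ₀, t₀)) = (x₀, y₀) := by rw [polarMap, hexp]
  rw [hE] at hΨ hΨ0
  have hsm : ∀ᶠ w in 𝓝 (x₀, (θ₀, t₀)), ContDiffAt ℝ ∞
      (fun w : Plane × Plane => S.kernelValue k (w.1, w.2.1) w.2.2) w := by
    have hc : Continuous fun w : Plane × Plane => (w.2.2, (w.1, w.2.1)) := by fun_prop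
    have h1 : ∀ᶠ z : ℝ × (Plane × ℝ) in 𝓝 (t₀, (x₀, θ₀)), S.bExt z.2 z.1 ≠ 0 :=
      (contDiffAt_bExt (frameDet_ne_zero hm.1)).continuousAt.eventually_ne
        (hS.bExt_pos hp h0 ht).ne'
    have h2 : ∀ᶠ z : ℝ × (Plane × ℝ) in 𝓝 (t₀, (x₀, θ₀)), S.frameDet (S.extFlow z.1 z.2).1 ≠ 0 :=
      ((frameDet_smooth (S := S)).continuous.comp
        S.continuous_extFlow.fst).continuousAt.eventually_ne (frameDet_ne_zero hm.1)
    filter_upwards [(hc.continuousAt (x := (x₀, (θ₀, t₀)))).eventually (h1.and h2)] with w hw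
    have h3 := contDiffAt_kernelValue (S := S) k (p := (w.1, w.2.1)) (t := w.2.2) hw.2 hw.1
    have h4 : ContDiffAt ℝ ∞ (fun w : Plane × Plane => (w.2.2, (w.1, w.2.1))) w :=
      (contDiff_snd.snd.prodMk (contDiff_fst.prodMk contDiff_snd.fst)).contDiffAt
    exact ContDiffAt.comp (g := fun z : ℝ × (Plane × ℝ) => S.kernelValue k z.2 z.1)
      (f := fun w : Plane × Plane => (w.2.2, (w.1, w.2.1))) w h3 h4
  refine ⟨fun z => S.kernelValue k ((Ψ z).1, (Ψ z).2.1) (Ψ z).2.2, Filter.Eventually.and ?_ ?_⟩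
  · have hc : ContinuousAt Ψ (x₀, y₀) := hΨ.self_of_nhds.continuousAt
    filter_upwards [hΨ, hc.eventually (by rw [hΨ0]; exact hsm)] with z hz1 hz2
    exact ContDiffAt.comp (g := fun w : Plane × Plane => S.kernelValue k (w.1, w.2.1) w.2.2)
      z hz2 hz1
  · obtain ⟨N, hNsub, hNo, hN0⟩ := mem_nhds_iff.1 hΨinv
    have hc : Continuous fun w : (Plane × ℝ) × ℝ => (w.1.1, (w.1.2, w.2)) := by fun_prop
    -- The window of angles is centred at θ₀, so that every angle in it is within π of θ₀, as
    -- `polar_unique` requires.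
    have hev := hS.eventually_polar_mem (x₀, y₀) (θ₀ - Real.pi) (hNo.preimage hc) (by
      rintro ⟨x, θ⟩ hxθ t ht' hpz
      obtain ⟨rfl, h2⟩ := Prod.mk.inj hpz
      obtain ⟨rfl, rfl⟩ := hS.polar_unique hx hxy ht' ⟨h0.le, ht⟩ h2 hexp (by
        rw [abs_le]; constructor <;> linarith [hxθ.2.1, hxθ.2.2])
      exact hN0)
    filter_upwards [hev] with z hz
    refine isKernelAt_of_Ico (θ₀ - Real.pi) fun θ hθ t hxM ht0 htτ hzy => ?_
    have h1 := hNsub (hz (z.1, θ) ⟨hxM, Ico_subset_Icc_self hθ⟩ t ⟨ht0.le, htτ.le⟩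
      (by rw [hzy]))
    have h2 : S.polarMap (z.1, (θ, t)) = z := by rw [polarMap, hzy]
    have h3 : Ψ z = (z.1, (θ, t)) := by rw [← h2]; exact h1
    rw [h3]

end RiemSurface

/-! ### Regularization of the Jacobi functions at the diagonal. -/

/-- The state space of the rescaled geodesic and Jacobi equations: position `x`, velocity `w`,
angle `β`, and the regularized Jacobi functions `(A₁, A₂)`, `(B, (B₂, B₃))`. -/
abbrev PolarState : Type := Plane × (Plane × (ℝ × ((ℝ × ℝ) × (ℝ × (ℝ × ℝ)))))

namespace RiemSurface

variable {S : RiemSurface}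

/-- The rate of rotation, with respect to the frame, of a parallel vector along the velocity. -/
noncomputable def turnRate (S : RiemSurface) (s : PolarState) : ℝ :=
  s.2.1.1 * S.c₁ s.1 + s.2.1.2 * S.c₂ s.1

/-- The geodesic equation with velocity `w`, together with the equations of
`a'(r)/t`, `(a(r) - 1)/t²`, `b(r)/t`, `(b'(r) - 1)/t²`, `(b(r)/t - s)/t²` for `r = st`, `t = |w|`,
which are regular at `t = 0`. -/
noncomputable def polarField (S : RiemSurface) (s : PolarState) : PolarState :=
  (s.2.1.1 • S.e₁ s.1 + s.2.1.2 • S.e₂ s.1,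
    (S.turnRate s • (-s.2.1.2, s.2.1.1), (S.turnRate s,
      ((-S.curvature s.1 * (1 + (s.2.1.1 ^ 2 + s.2.1.2 ^ 2) * s.2.2.2.1.2), s.2.2.2.1.1),
        (1 + (s.2.1.1 ^ 2 + s.2.1.2 ^ 2) * s.2.2.2.2.2.1,
          (-S.curvature s.1 * s.2.2.2.2.1, s.2.2.2.2.2.1))))))

theorem contDiff_turnRate : ContDiff ℝ ∞ S.turnRate := by
  have h1 := S.c₁_smooth
  have h2 := S.c₂_smooth
  unfold turnRate
  fun_prop

theorem contDiff_polarField : ContDiff ℝ ∞ S.polarField := by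
  have h1 := S.e₁_smooth
  have h2 := S.e₂_smooth
  have h3 := S.curvature_smooth
  have h4 := contDiff_turnRate (S := S)
  unfold polarField
  fun_prop

/-- The position equation is linear in w and the velocity equation quadratic, so at w = 0 only the
variation of w contributes. This yields the differential of the exponential map at the zero vector.
-/
theorem fderiv_polarField_of_velocity_eq_zero {a : PolarState} (ha : a.2.1 = 0) (ζ : PolarState) :
    (fderiv ℝ S.polarField a ζ).1 = ζ.2.1.1 • S.e₁ a.1 + ζ.2.1.2 • S.e₂ a.1 ∧
      (fderiv ℝ S.polarField a ζ).2.1 = 0 := by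
  have hd := (contDiff_polarField (S := S)).differentiable (by simp) a
  have ha1 : a.2.1.1 = 0 := by rw [ha]; rfl
  have ha2 : a.2.1.2 = 0 := by rw [ha]; rfl
  have hw : HasFDerivAt (fun s : PolarState => s.2.1)
      (ContinuousLinearMap.fst ℝ _ _ ∘L ContinuousLinearMap.snd ℝ _ _) a :=
    (ContinuousLinearMap.fst ℝ _ _ ∘L ContinuousLinearMap.snd ℝ _ _ :
      PolarState →L[ℝ] Plane).hasFDerivAt
  have hx1 : HasFDerivAt (fun s : PolarState => S.e₁ s.1) _ a :=
    ((S.e₁_smooth.comp contDiff_fst).differentiable (by simp) a).hasFDerivAt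
  have hx2 : HasFDerivAt (fun s : PolarState => S.e₂ s.1) _ a :=
    ((S.e₂_smooth.comp contDiff_fst).differentiable (by simp) a).hasFDerivAt
  have ht := ((contDiff_turnRate (S := S)).differentiable (by simp) a).hasFDerivAt
  have ht0 : S.turnRate a = 0 := by rw [turnRate, ha1, ha2]; ring
  have h1 := hd.hasFDerivAt.fst.unique ((hw.fst.fun_smul hx1).fun_add (hw.snd.fun_smul hx2))
  have h2 := hd.hasFDerivAt.snd.fst.unique (ht.fun_smul (hw.snd.fun_neg.prodMk hw.fst))
  constructor
  · have := congrArg (fun L : PolarState →L[ℝ] Plane => L ζ) h1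
    simpa [ha1, ha2] using this
  · have := congrArg (fun L : PolarState →L[ℝ] Plane => L ζ) h2
    rw [ContinuousLinearMap.comp_apply, ContinuousLinearMap.comp_apply] at this
    refine this.trans ?_
    ext <;> simp [ha1, ha2, ht0]

/-- The solution of the regularized equations along a geodesic of `M`, for positive time. -/
noncomputable def polarCurve (S : RiemSurface) (p : Plane × ℝ) (t s : ℝ) : PolarState :=
  ((S.extFlow (s * t) p).1, (t • (Real.cos (S.extFlow (s * t) p).2, Real.sin (S.extFlow (s * t) p).2),
    ((S.extFlow (s * t) p).2 - p.2, ((S.aExt' p (s * t) / t, (S.aExt p (s * t) - 1) / t ^ 2),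
      (S.bExt p (s * t) / t, ((S.bExt' p (s * t) - 1) / t ^ 2,
        (S.bExt p (s * t) / t - s) / t ^ 2))))))

theorem polarCurve_zero {p : Plane × ℝ} (hp : p ∈ S.SM) (t : ℝ) :
    S.polarCurve p t 0 = (p.1, (t • (Real.cos p.2, Real.sin p.2), 0)) := by
  obtain ⟨h1, h2, h3, h4, -⟩ := Jacobi_initial hp
  simp [polarCurve, extFlow_zero, h1, h2, h3, h4]

/-- Chain rule for r = st with |w| = t. The normalizing powers of t cancel the factor t of the chain
rule, so that t survives only through t² = |w|², which is smooth in w. -/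
theorem hasDerivAt_polarCurve {p : Plane × ℝ} (hp : p ∈ S.SM) {t : ℝ} (h0 : 0 < t)
    (ht : t ≤ S.exitTime p) {s : ℝ} (hs : s ∈ Icc 0 1) :
    HasDerivAt (S.polarCurve p t) (S.polarField (S.polarCurve p t s)) s := by
  have hst : s * t ∈ Icc 0 (S.exitTime p) :=
    ⟨mul_nonneg hs.1 h0.le, (mul_le_of_le_one_left h0.le hs.2).trans ht⟩
  have hm := extFlow_mem_SM hp hst
  have hsc : HasDerivAt (fun s : ℝ => s * t) t s := by simpa using (hasDerivAt_id s).mul_const t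
  have hΦ := S.hasDerivAt_extFlow (s * t) p
  rw [extX_eq (S.norm_lt_of_mem_M hm.1)] at hΦ
  have hΦ := hΦ.scomp s hsc
  have ha := (hasDerivAt_aExt hm).comp s hsc
  have ha' := (hasDerivAt_aExt' hm).comp s hsc
  have hb := (hasDerivAt_bExt hm).comp s hsc
  have hb' := (hasDerivAt_bExt' hm).comp s hsc
  have hne := h0.ne'
  have hx : HasDerivAt (fun r => (S.extFlow (r * t) p).1) (t • S.X (S.extFlow (s * t) p)).1 s :=
    (ContinuousLinearMap.fst ℝ Plane ℝ).hasFDerivAt.comp_hasDerivAt s hΦ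
  have hα : HasDerivAt (fun r => (S.extFlow (r * t) p).2) (t • S.X (S.extFlow (s * t) p)).2 s :=
    (ContinuousLinearMap.snd ℝ Plane ℝ).hasFDerivAt.comp_hasDerivAt s hΦ
  have hw := (hα.cos.prodMk hα.sin).const_smul t
  have hB := hb.div_const t
  have h := hx.prodMk (hw.prodMk ((hα.sub_const p.2).prodMk
    (((ha'.div_const t).prodMk ((ha.sub_const 1).div_const (t ^ 2))).prodMk
      (hB.prodMk (((hb'.sub_const 1).div_const (t ^ 2)).prodMk
        ((hB.fun_sub (hasDerivAt_id s)).div_const (t ^ 2)))))))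
  refine HasDerivAt.congr_deriv (f := S.polarCurve p t) h ?_
  have hsq : ∀ α : ℝ, (t * Real.cos α) ^ 2 + (t * Real.sin α) ^ 2 = t ^ 2 := fun α => by
    linear_combination t ^ 2 * Real.sin_sq_add_cos_sq α
  simp only [polarField, polarCurve, turnRate, X,
    smul_eq_mul, Prod.mk.injEq, Prod.smul_mk, hsq]
  refine ⟨?_, ⟨?_, ?_⟩, ?_, ⟨?_, ?_⟩, ?_, ?_, ?_⟩
  · module
  · ring
  · ring
  · ring
  · field_simp; ring
  · field_simp
  · field_simp; ring
  · field_simp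
  · field_simp

end RiemSurface

namespace RiemSurface

variable {S : RiemSurface}

/-- The regularized equations have a smooth solution operator near the zero section. -/
theorem exists_polar_normal_form (S : RiemSurface) (x₀ : Plane) :
    ∃ g : Plane × Plane → PolarState, ContDiff ℝ ∞ g ∧
      (∀ᶠ u in 𝓝 (x₀, (0 : Plane)), ∀ p ∈ S.SM, ∀ t, 0 < t → t ≤ S.exitTime p →
        (p.1, t • (Real.cos p.2, Real.sin p.2)) = u → g u = S.polarCurve p t 1) ∧
      (g (x₀, 0)).1 = x₀ ∧ (g (x₀, 0)).2.2.2.2.1 = 1 ∧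
      ∀ η : Plane, (fderiv ℝ g (x₀, 0) (0, η)).1 = η.1 • S.e₁ x₀ + η.2 • S.e₂ x₀ := by
  set κ := S.curvature x₀ with hκ
  -- At zero velocity position and curvature are frozen and the system integrates to these
  -- polynomials. Existence of this solution on [0, 1] is what `exists_local_time_one_map` needs to
  -- produce a smooth solution operator for small velocities.
  set c : ℝ → PolarState := fun s => (x₀, (0, (0, ((-κ * s, -κ * (s ^ 2 / 2)),
    (s, (-κ * (s ^ 2 / 2), -κ * (s ^ 3 / 6))))))) with hc
  have hsq : ∀ s : ℝ, HasDerivAt (fun s : ℝ => s ^ 2 / 2) s s := fun s =>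
    ((hasDerivAt_pow 2 s).div_const 2).congr_deriv (by simp)
  have hcu : ∀ s : ℝ, HasDerivAt (fun s : ℝ => s ^ 3 / 6) (s ^ 2 / 2) s := fun s =>
    ((hasDerivAt_pow 3 s).div_const 6).congr_deriv (by simp; ring)
  have hder : ∀ s, HasDerivAt c (S.polarField (c s)) s := by
    intro s
    have h := (hasDerivAt_const s x₀).prodMk ((hasDerivAt_const s (0 : Plane)).prodMk
      ((hasDerivAt_const s (0 : ℝ)).prodMk
        ((((hasDerivAt_id s).const_mul (-κ)).prodMk ((hsq s).const_mul (-κ))).prodMk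
          ((hasDerivAt_id s).prodMk (((hsq s).const_mul (-κ)).prodMk ((hcu s).const_mul (-κ)))))))
    refine HasDerivAt.congr_deriv (f := c) h ?_
    simp [polarField, turnRate, hc, hκ]
  obtain ⟨U, hU, G, hG, hsol, hlin⟩ := exists_local_time_one_map (contDiff_polarField (S := S))
    (c := c) fun s _ => (hder s).hasDerivWithinAt
  set ι : Plane × Plane →L[ℝ] PolarState := (ContinuousLinearMap.fst ℝ Plane Plane).prod
    ((ContinuousLinearMap.snd ℝ Plane Plane).prod 0) with hι
  have hι0 : ι (x₀, 0) = c 0 := by simp [hι, hc]; rfl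
  refine ⟨fun u => G (ι u), hG.comp ι.contDiff, ?_, ?_, ?_, ?_⟩
  · have hcont : ContinuousAt ι (x₀, 0) := ι.continuous.continuousAt
    filter_upwards [hcont.eventually (by rw [hι0]; exact hU)] with u hu p hp t h0 ht hpu
    have h1 : S.polarCurve p t 0 = ι u := by
      rw [polarCurve_zero hp, ← hpu]; rfl
    rw [← h1]
    exact hsol _ (by rw [h1]; exact hu) fun s hs =>
      (hasDerivAt_polarCurve hp h0 ht hs).hasDerivWithinAt
  · show (G (ι (x₀, 0))).1 = _
    rw [hι0, hsol c (mem_of_mem_nhds hU) fun s _ => (hder s).hasDerivWithinAt]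
  · show (G (ι (x₀, 0))).2.2.2.2.1 = _
    rw [hι0, hsol c (mem_of_mem_nhds hU) fun s _ => (hder s).hasDerivWithinAt]
  · intro η
    obtain ⟨ζ, hζ0, hζ1, hζ⟩ := hlin (ι (0, η))
    have hd : fderiv ℝ (fun u => G (ι u)) (x₀, 0) (0, η) = ζ 1 := by
      rw [hζ1, ← hι0]
      have h1 := ((hG.differentiable (by simp) (ι (x₀, 0))).hasFDerivAt).comp (x₀, (0 : Plane))
        ι.hasFDerivAt
      have h2 : fderiv ℝ (fun u => G (ι u)) (x₀, 0) = _ := h1.fderiv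
      rw [h2]; rfl
    rw [hd]
    have hw : ∀ s ∈ Icc (0 : ℝ) 1, (ζ s).2.1 = η := by
      intro s hs
      have := constant_of_has_deriv_right_zero (f := fun s => (ζ s).2.1) (a := 0) (b := 1)
        (fun r hr => (hζ r hr).continuousAt.snd.fst.continuousWithinAt) (fun r hr => by
          have h1 := (ContinuousLinearMap.fst ℝ Plane _ ∘L ContinuousLinearMap.snd ℝ Plane _ :
            PolarState →L[ℝ] Plane).hasFDerivAt.comp_hasDerivAt r (hζ r (Ico_subset_Icc_self hr))
          have h2 := (fderiv_polarField_of_velocity_eq_zero (S := S) (a := c r) rfl (ζ r)).2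
          exact (h1.congr_deriv h2).hasDerivWithinAt) s hs
      rw [this, hζ0]; rfl
    have hx : ∀ s ∈ Icc (0 : ℝ) 1, HasDerivAt (fun s => (ζ s).1 - s • (η.1 • S.e₁ x₀ + η.2 • S.e₂ x₀))
        0 s := by
      intro s hs
      have h1 : HasDerivAt (fun s => (ζ s).1) _ s :=
        (ContinuousLinearMap.fst ℝ Plane _ : PolarState →L[ℝ] Plane).hasFDerivAt.comp_hasDerivAt s
          (hζ s hs)
      have h2 := (fderiv_polarField_of_velocity_eq_zero (S := S) (a := c s) rfl (ζ s)).1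
      rw [hw s hs] at h2
      refine (h1.fun_sub ((hasDerivAt_id s).smul_const _)).congr_deriv ?_
      rw [one_smul, sub_eq_zero]
      exact h2
    have h3 := constant_of_has_deriv_right_zero (a := 0) (b := 1)
      (fun r hr => (hx r hr).continuousAt.continuousWithinAt)
      (fun r hr => (hx r (Ico_subset_Icc_self hr)).hasDerivWithinAt) 1 (right_mem_Icc.2 zero_le_one)
    simp only [hζ0, one_smul, zero_smul, sub_zero] at h3
    have h4 : (ι (0, η)).1 = 0 := rfl
    rw [h4, sub_eq_zero] at h3
    exact h3

/-- The regular part of `a/b`, divided by `t`. -/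
noncomputable def regQuotient (g : Plane × Plane → PolarState) (u : Plane × Plane) : ℝ :=
  ((g u).2.2.2.1.2 - (g u).2.2.2.2.2.2) / (g u).2.2.2.2.1

/-- The kernel near the diagonal as a function of `(x, v)`, `v` being the initial velocity. -/
noncomputable def nearKernel (k : ℤ) (g : Plane × Plane → PolarState) (u : Plane × Plane) : ℂ :=
  -(1 / (2 * Real.pi) : ℂ) *
    (((-(fderiv ℝ (regQuotient g) u (0, (-u.2.2, u.2.1)) : ℝ) : ℂ) * (((g u).2.2.2.2.1 : ℝ) : ℂ)⁻¹ +
      Complex.I * k * (((g u).2.2.2.1.2 : ℝ) : ℂ) * ((((g u).2.2.2.2.1 : ℝ) : ℂ)⁻¹) ^ 2) *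
    Complex.exp (Complex.I * k * (((g u).2.2.1 : ℝ) : ℂ)))

theorem contDiffAt_regQuotient {g : Plane × Plane → PolarState} (hg : ContDiff ℝ ∞ g)
    {u : Plane × Plane} (hu : (g u).2.2.2.2.1 ≠ 0) : ContDiffAt ℝ ∞ (regQuotient g) u :=
  (hg.snd.snd.snd.fst.snd.sub hg.snd.snd.snd.snd.snd.snd).contDiffAt.div
    hg.snd.snd.snd.snd.fst.contDiffAt hu

theorem contDiffAt_nearKernel (k : ℤ) {g : Plane × Plane → PolarState} (hg : ContDiff ℝ ∞ g)
    {u : Plane × Plane} (hu : (g u).2.2.2.2.1 ≠ 0) : ContDiffAt ℝ ∞ (nearKernel k g) u := by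
  have hofReal : ∀ {f : Plane × Plane → ℝ}, ContDiffAt ℝ ∞ f u →
      ContDiffAt ℝ ∞ (fun z => (f z : ℂ)) u := fun hf =>
    Complex.ofRealCLM.contDiff.contDiffAt.comp u hf
  have hrot : ContDiffAt ℝ ∞ (fun u : Plane × Plane => ((0 : Plane), ((-u.2.2, u.2.1) : Plane))) u :=
    (contDiff_const.prodMk (contDiff_snd.snd.neg.prodMk contDiff_snd.fst)).contDiffAt
  have hD := hofReal (((contDiffAt_regQuotient hg hu).fderiv_right (m := ∞) (by simp)).clm_apply hrot)
  have hB := hofReal hg.snd.snd.snd.snd.fst.contDiffAt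
  have hBi := hB.inv (by exact_mod_cast hu)
  have hA := hofReal hg.snd.snd.snd.fst.snd.contDiffAt
  have hβ := hofReal hg.snd.snd.fst.contDiffAt
  have hc : ContDiffAt ℝ ∞ (fun _ : Plane × Plane => Complex.I * (k : ℂ)) u := contDiffAt_const
  exact contDiffAt_const.mul (((hD.neg.mul hBi).add ((hc.mul hA).mul (hBi.pow 2))).mul
    (hc.mul hβ).cexp)

end RiemSurface

/-! ### Smoothness of the kernel across the diagonal, and gluing. -/

namespace RiemSurface

variable {S : RiemSurface}

/-- With b = tB and a - 1 = t²A one has a/b = 1/t + tR(x, v). The θ-derivative removes 1/t and acts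
on R as the derivative along the rotated vector (-v₂, v₁); after division by b no power of t is
left. -/
theorem IsSimple.nearKernel_eq (hS : S.IsSimple) (k : ℤ) {g : Plane × Plane → PolarState}
    (hg : ContDiff ℝ ∞ g) {p : Plane × ℝ} (hp : p ∈ S.SM) {t : ℝ} (h0 : 0 < t)
    (ht : t < S.exitTime p)
    (hev : ∀ᶠ θ in 𝓝 p.2, g (p.1, t • (Real.cos θ, Real.sin θ)) = S.polarCurve (p.1, θ) t 1) :
    nearKernel k g (p.1, t • (Real.cos p.2, Real.sin p.2)) = S.kernelValue k p t := by
  have hne := h0.ne'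
  have hevτ : ∀ᶠ θ in 𝓝 p.2, t < S.exitTime (p.1, θ) := by
    have hc : Continuous fun s : ℝ => (p.1, s) := Continuous.prodMk_right p.1
    filter_upwards [hc.continuousAt.eventually (hS.eventually_lt_exitTime hp ht)] with s hs
    exact hs ⟨hp.1, trivial⟩
  have hquot : (fun θ => S.aExt (p.1, θ) t / S.bExt (p.1, θ) t) =ᶠ[𝓝 p.2]
      fun θ => 1 / t + t * regQuotient g (p.1, t • (Real.cos θ, Real.sin θ)) := by
    filter_upwards [hev, hevτ] with θ h1 h2
    have hb := (hS.bExt_pos (p := (p.1, θ)) ⟨hp.1, trivial⟩ h0 h2.le).ne'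
    rw [regQuotient, h1]
    simp only [polarCurve, one_mul]
    field_simp
    ring
  have h1 := hev.self_of_nhds
  have hb := (hS.bExt_pos hp h0 ht.le).ne'
  set u : Plane × Plane := (p.1, t • (Real.cos p.2, Real.sin p.2)) with hu
  have hB : (g u).2.2.2.2.1 = S.bExt p t / t := by rw [h1]; simp only [polarCurve, one_mul]
  have hA : (g u).2.2.2.1.2 = (S.aExt p t - 1) / t ^ 2 := by
    rw [h1]; simp only [polarCurve, one_mul]
  have hβ : (g u).2.2.1 = (S.extFlow t p).2 - p.2 := by rw [h1]; simp only [polarCurve, one_mul]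
  have hder : deriv (fun θ => S.aExt (p.1, θ) t / S.bExt (p.1, θ) t) p.2 =
      t * fderiv ℝ (regQuotient g) u (0, (-u.2.2, u.2.1)) := by
    rw [hquot.deriv_eq]
    have hc : HasDerivAt (fun θ : ℝ => (p.1, t • (Real.cos θ, Real.sin θ)))
        ((0 : Plane), t • (-Real.sin p.2, Real.cos p.2)) p.2 :=
      (hasDerivAt_const _ _).prodMk
        (((Real.hasDerivAt_cos p.2).prodMk (Real.hasDerivAt_sin p.2)).const_smul t)
    have hR := HasFDerivAt.comp_hasDerivAt (l := regQuotient g) p.2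
      ((contDiffAt_regQuotient hg (u := u) (by rw [hB]; positivity)).differentiableAt
        (by simp)).hasFDerivAt hc
    refine ((hR.const_mul t).const_add (1 / t)).deriv.trans ?_
    congr 2
    simp [hu]
  rw [nearKernel, kernelValue, qExt, hder, hB, hA, hβ]
  have hbC : (S.bExt p t : ℂ) ≠ 0 := by exact_mod_cast hb
  have htC : (t : ℂ) ≠ 0 := by exact_mod_cast hne
  push_cast
  field_simp

/-- The map (x, v) ↦ (x, exp_x v), suitably extended, is a local diffeomorphism at v = 0. Since
exp_x returns to x only at the zero vector, properness forces all polar coordinates of pairs near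
the diagonal point to be short, hence within reach of the regularized solution. -/
theorem IsSimple.exists_local_kernel_diag (hS : S.IsSimple) (k : ℤ) {x₀ : Plane} (hx : x₀ ∈ S.M) :
    ∃ G : Plane × Plane → ℂ, ∀ᶠ z in 𝓝 (x₀, x₀), ContDiffAt ℝ ∞ G z ∧ S.IsKernelAt k z (G z) := by
  obtain ⟨g, hg, hsol, hgx, hgB, hgd⟩ := S.exists_polar_normal_form x₀
  set F : Plane × Plane → Plane × Plane := fun u => (u.1, (g u).1) with hF
  have hFs : ContDiff ℝ ∞ F := contDiff_fst.prodMk hg.fst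
  have hF0 : F (x₀, 0) = (x₀, x₀) := by rw [hF]; simp only [hgx]
  obtain ⟨Ψ, hΨ, hΨ0, hΨinv⟩ := exists_smooth_left_inverse (f := F) (a := (x₀, (0 : Plane)))
    (Eventually.of_forall fun x => hFs.contDiffAt) (by
      rintro ⟨ξ, η⟩ hv
      have h1 : HasFDerivAt F _ (x₀, (0 : Plane)) := hasFDerivAt_fst.prodMk
        ((hg.differentiable (by simp) _).hasFDerivAt.fst)
      rw [h1.fderiv] at hv
      obtain ⟨h2, h3⟩ := Prod.mk.inj hv
      obtain rfl : ξ = 0 := h2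
      have h4 : η.1 • S.e₁ x₀ + η.2 • S.e₂ x₀ = 0 := by rw [← hgd]; exact h3
      have hne := frameDet_ne_zero hx
      have h5 : η.1 * S.frameDet x₀ = 0 := by
        have := congrArg (fun y => det2 y (S.e₂ x₀)) h4
        simp only [det2, Prod.fst_add, Prod.smul_fst, Prod.snd_add, Prod.smul_snd, smul_eq_mul,
          Prod.fst_zero, Prod.snd_zero, frameDet] at this ⊢
        linarith
      have h6 : η.2 * S.frameDet x₀ = 0 := by
        have := congrArg (fun y => det2 (S.e₁ x₀) y) h4
        simp only [det2, Prod.fst_add, Prod.smul_fst, Prod.snd_add, Prod.smul_snd, smul_eq_mul,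
          Prod.fst_zero, Prod.snd_zero, frameDet] at this ⊢
        linarith
      have h7 : η.1 = 0 := by simpa [hne] using h5
      have h8 : η.2 = 0 := by simpa [hne] using h6
      exact Prod.ext rfl (Prod.ext h7 h8))
  rw [hF0] at hΨ hΨ0
  have hB : ∀ᶠ u in 𝓝 (x₀, (0 : Plane)), (g u).2.2.2.2.1 ≠ 0 :=
    hg.snd.snd.snd.snd.fst.continuous.continuousAt.eventually_ne (by rw [hgB]; exact one_ne_zero)
  refine ⟨fun z => nearKernel k g (Ψ z), Filter.Eventually.and ?_ ?_⟩
  · have hc : ContinuousAt Ψ (x₀, x₀) := hΨ.self_of_nhds.continuousAt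
    filter_upwards [hΨ, hc.eventually (by rw [hΨ0]; exact hB)] with z hz1 hz2
    exact (contDiffAt_nearKernel k hg hz2).comp z hz1
  · obtain ⟨N, hNsub, hNo, hN0⟩ := mem_nhds_iff.1 (hΨinv.and hsol)
    have hc : Continuous fun w : (Plane × ℝ) × ℝ =>
      (w.1.1, w.2 • ((Real.cos w.1.2, Real.sin w.1.2) : Plane)) := by fun_prop
    have hev := hS.eventually_polar_mem (x₀, x₀) 0 (hNo.preimage hc) (by
      rintro ⟨x, θ⟩ hxθ t ht hpz
      obtain ⟨rfl, h2⟩ := Prod.mk.inj hpz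
      have hp : (x, θ) ∈ S.SM := ⟨hx, trivial⟩
      have ht0 : t = 0 := by
        by_contra hne
        refine hS.no_loop (x, θ) hp t (ht.1.lt_of_ne (Ne.symm hne)) ht.2 ?_
        rw [flow_eq hp ht, h2]
      simp only [mem_preimage, ht0, zero_smul]
      exact hN0)
    filter_upwards [hev] with z hz
    refine isKernelAt_of_Ico 0 fun θ hθ t hxM ht0 htτ hzy => ?_
    have hp : (z.1, θ) ∈ S.SM := ⟨hxM, trivial⟩
    have hmem := hz (z.1, θ) ⟨hxM, Ico_subset_Icc_self hθ⟩ t ⟨ht0.le, htτ.le⟩ (by rw [hzy])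
    have hcθ : Continuous fun s : ℝ => ((z.1, s), t) := by fun_prop
    have hevN : ∀ᶠ s in 𝓝 θ, (z.1, t • ((Real.cos s, Real.sin s) : Plane)) ∈ N :=
      (hcθ.continuousAt (x := θ)).eventually ((hNo.preimage hc).mem_nhds hmem)
    have hevτ : ∀ᶠ s in 𝓝 θ, t < S.exitTime (z.1, s) := by
      have hc : Continuous fun s : ℝ => (z.1, s) := Continuous.prodMk_right z.1
      filter_upwards [(hc.continuousAt (x := θ)).eventually (hS.eventually_lt_exitTime hp htτ)]
        with s hs
      exact hs ⟨hp.1, trivial⟩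
    have hsolev : ∀ᶠ s in 𝓝 θ, g (z.1, t • (Real.cos s, Real.sin s)) =
        S.polarCurve (z.1, s) t 1 := by
      filter_upwards [hevN, hevτ] with s h1 h2
      exact (hNsub h1).2 (z.1, s) ⟨hxM, trivial⟩ t ht0 h2.le rfl
    have h1 : F (z.1, t • (Real.cos θ, Real.sin θ)) = z := by
      simp only [hF, hsolev.self_of_nhds, polarCurve, one_mul, hzy]
    have h2 : Ψ z = (z.1, t • (Real.cos θ, Real.sin θ)) := by
      rw [← h1]
      exact (hNsub hevN.self_of_nhds).1
    rw [h2]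
    exact hS.nearKernel_eq k hg hp ht0 htτ hsolev

/-- The condition is an equation as soon as z has polar coordinates with time strictly before the
exit, and void otherwise. Convexity permits gluing by a partition of unity. -/
theorem convex_setOf_isKernelAt (k : ℤ) (z : Plane × Plane) : Convex ℝ {w | S.IsKernelAt k z w} := by
  intro u hu v hv a b _ _ hab θ t h1 h2 h3 h4
  rw [hu θ t h1 h2 h3 h4, hv θ t h1 h2 h3 h4, ← add_smul, hab, one_smul]

/-- The Schwartz kernel exists: it is smooth on the whole plane, and on `M` it has the prescribed
form in exponential polar coordinates. -/
theorem IsSimple.exists_kernel (hS : S.IsSimple) (k : ℤ) :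
    ∃ K : Plane × Plane → ℂ, ContDiff ℝ ∞ K ∧ ∀ z, S.IsKernelAt k z (K z) := by
  have hloc : ∀ z₀ : Plane × Plane, ∃ G : Plane × Plane → ℂ,
      ∀ᶠ z in 𝓝 z₀, ContDiffAt ℝ ∞ G z ∧ S.IsKernelAt k z (G z) := by
    rintro ⟨x₀, y₀⟩
    by_cases hx : x₀ ∈ S.M
    · by_cases hy : y₀ ∈ S.M
      · by_cases hxy : y₀ = x₀
        · rw [hxy]; exact hS.exists_local_kernel_diag k hx
        · exact hS.exists_local_kernel_offDiag k hx hy hxy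
      -- Off the closed set M × M the condition is void, so zero serves as local kernel.
      · refine ⟨0, ?_⟩
        filter_upwards [continuous_snd.continuousAt.preimage_mem_nhds
          (S.compact.isClosed.isOpen_compl.mem_nhds hy)] with z hz
        refine ⟨contDiffAt_const, fun θ t h1 h2 h3 h4 => absurd ?_ hz⟩
        rw [← h4]
        exact (extFlow_mem_SM (p := (z.1, θ)) ⟨h1, trivial⟩ ⟨h2.le, h3.le⟩).1
    · refine ⟨0, ?_⟩
      filter_upwards [continuous_fst.continuousAt.preimage_mem_nhds
        (S.compact.isClosed.isOpen_compl.mem_nhds hx)] with z hz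
      exact ⟨contDiffAt_const, fun θ t h1 => absurd h1 hz⟩
  obtain ⟨K, hK⟩ := exists_contMDiffMap_forall_mem_convex_of_local (n := (⊤ : ℕ∞))
    (modelWithCornersSelf ℝ (Plane × Plane)) (F := ℂ)
    (t := fun z => {w | S.IsKernelAt k z w}) (convex_setOf_isKernelAt k) fun z₀ => by
      obtain ⟨G, hG⟩ := hloc z₀
      exact ⟨_, hG, G, fun z hz => (hz.1.contMDiffAt).contMDiffWithinAt, fun z hz => hz.2⟩
  exact ⟨K, K.contMDiff.contDiff, hK⟩

end RiemSurface

theorem fderiv_intervalIntegral_apply {E F : Type} [NormedAddCommGroup E] [NormedSpace ℝ E]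
    [FiniteDimensional ℝ E] [NormedAddCommGroup F] [NormedSpace ℝ F] [CompleteSpace F]
    [NormedSpace ℂ F] [SMulCommClass ℝ ℂ F] {k : E × ℝ → F} (hk : ContDiff ℝ ∞ k) {T : ℝ}
    (hT : 0 ≤ T) (x v : E) :
    fderiv ℝ (fun x => ∫ t in (0 : ℝ)..T, k (x, t)) x v =
      ∫ t in (0 : ℝ)..T, fderiv ℝ k (x, t) (v, 0) := by
  rw [((contDiff_intervalIntegral hk hT).2 x).fderiv, ContinuousLinearMap.intervalIntegral_apply]
  · simp
  · have h1 : Continuous fun t : ℝ => fderiv ℝ k (x, t) :=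
      (hk.continuous_fderiv (by simp)).comp (Continuous.prodMk_right x)
    exact (h1.clm_comp continuous_const).intervalIntegrable _ _

theorem ContDiffAt.zpow {E : Type*} [NormedAddCommGroup E] [NormedSpace ℝ E] {f : E → ℂ} {x : E}
    {n : WithTop ℕ∞} (hf : ContDiffAt ℝ n f x) (hx : f x ≠ 0) (k : ℤ) :
    ContDiffAt ℝ n (fun y => f y ^ k) x := by
  rcases k with k | k
  · simpa only [Int.ofNat_eq_natCast, zpow_natCast] using hf.pow k
  · simp only [zpow_negSucc]
    exact (hf.pow (k + 1)).inv (pow_ne_zero _ hx)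

/-! ### Modes and the transport solution. -/

namespace RiemSurface

variable {S : RiemSurface}

/-- The function `e^{ikθ} ψ(x)`. -/
noncomputable def modeFun (k : ℤ) (ψ : Plane → ℂ) (p : Plane × ℝ) : ℂ :=
  Complex.exp (Complex.I * k * p.2) * ψ p.1

theorem contDiff_expPhase (k : ℤ) :
    ContDiff ℝ ∞ (fun s : ℝ => Complex.exp (Complex.I * k * s)) :=
  (contDiff_const.mul Complex.ofRealCLM.contDiff).cexp

theorem hasDerivAt_expPhase (c : ℂ) (s : ℝ) :
    HasDerivAt (fun s : ℝ => Complex.exp (c * s)) (c * Complex.exp (c * s)) s := by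
  have h1 : HasDerivAt (fun s : ℝ => c * (s : ℂ)) c s := by
    simpa using (Complex.ofRealCLM.hasDerivAt (x := s)).const_mul c
  exact h1.cexp.congr_deriv (mul_comm _ _)

theorem contDiff_modeFun (k : ℤ) {ψ : Plane → ℂ} (hψ : ContDiff ℝ ∞ ψ) :
    ContDiff ℝ ∞ (modeFun k ψ) :=
  ((contDiff_expPhase k).comp contDiff_snd).mul (hψ.comp contDiff_fst)

theorem modeFun_add_angle (k : ℤ) (ψ : Plane → ℂ) (x : Plane) (θ s : ℝ) :
    modeFun k ψ (x, θ + s) = Complex.exp (Complex.I * k * s) * modeFun k ψ (x, θ) := by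
  simp only [modeFun]
  rw [← mul_assoc, ← Complex.exp_add]
  congr 2
  push_cast
  ring

/-- An element of `Ω_k` is determined by its values at the angle `0`. -/
theorem Omega_apply {k : ℤ} {u : Plane × ℝ → ℂ} (hu : u ∈ S.Omega k) {p : Plane × ℝ}
    (hp : p ∈ S.SM) : u p = Complex.exp (Complex.I * k * p.2) * u (p.1, 0) := by
  have h1 : ∀ s : ℝ, HasDerivAt (fun s : ℝ => Complex.exp (-(Complex.I * k) * s) * u (p.1, s)) 0 s := by
    intro s
    exact ((hasDerivAt_expPhase (-(Complex.I * k)) s).fun_mul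
      (hu.2 (p.1, s) ⟨hp.1, trivial⟩)).congr_deriv (by ring)
  have h2 := is_const_of_deriv_eq_zero (fun s => (h1 s).differentiableAt) (fun s => (h1 s).deriv)
    p.2 0
  simp only [Complex.ofReal_zero, mul_zero, Complex.exp_zero, one_mul] at h2
  rw [← h2, ← mul_assoc, ← Complex.exp_add]
  simp

/-- Since h(x, θ) = e^{iθ} h(x, 0), the amplitude is ψ = h(·, 0)^k φ. It is smooth for negative k as
well, because h(·, 0) has no zeros on M, and φ is supported in the interior. -/
theorem exists_mode_of_Omega {h : Plane × ℝ → ℂ} (hh : h ∈ S.Omega 1)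
    (hne : ∀ p ∈ S.SM, h p ≠ 0) (k : ℤ) {φ : Plane → ℂ} (hφ : φ ∈ C0inf S) :
    ∃ ψ ∈ C0inf S, (fun p => h p ^ k * φ p.1) = modeFun k ψ := by
  have hsupp : ∀ x, φ x ≠ 0 → x ∈ interior S.M := fun x hx => hφ.2.2 (subset_tsupport φ hx)
  have hts : tsupport (fun x => h (x, 0) ^ k * φ x) ⊆ tsupport φ :=
    closure_mono fun x hx => by
      rw [Function.mem_support] at hx ⊢
      exact right_ne_zero_of_mul hx
  refine ⟨fun x => h (x, 0) ^ k * φ x, ⟨?_, hφ.2.1.of_isClosed_subset (isClosed_tsupport _) hts,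
    hts.trans hφ.2.2⟩, ?_⟩
  · refine contDiff_iff_contDiffAt.2 fun x => ?_
    by_cases hx : x ∈ tsupport φ
    · have hxM := hφ.2.2 hx
      have hmem : S.SM ∈ 𝓝 (x, (0 : ℝ)) :=
        prod_mem_nhds (mem_interior_iff_mem_nhds.1 hxM) univ_mem
      have h1 : ContDiffAt ℝ ∞ h (x, 0) := hh.1.contDiffAt hmem
      have h2 : ContDiffAt ℝ ∞ (fun x => h (x, 0)) x :=
        ContDiffAt.comp (g := h) x h1 (contDiffAt_id.prodMk contDiffAt_const)
      exact (h2.zpow (hne _ ⟨interior_subset hxM, trivial⟩) k).mul hφ.1.contDiffAt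
    · refine contDiffAt_const (c := (0 : ℂ)).congr_of_eventuallyEq ?_
      filter_upwards [(isClosed_tsupport φ).isOpen_compl.mem_nhds hx] with y hy
      rw [image_eq_zero_of_notMem_tsupport hy, mul_zero]
  · funext p
    by_cases hp : φ p.1 = 0
    · simp [modeFun, hp]
    · rw [modeFun, Omega_apply hh (p := p) ⟨interior_subset (hsupp _ hp), trivial⟩, mul_zpow,
        ← Complex.exp_int_mul]
      rw [mul_assoc]
      congr 2
      push_cast
      ring

theorem uniqueDiffOn_SM : UniqueDiffOn ℝ S.SM :=
  (uniqueDiffOn_superlevel (S.rho_smooth.differentiable (by simp)) S.boundary_regular).prod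
    uniqueDiffOn_univ

/-- A zero of ρ in the interior would be a local minimum and thus a critical point. -/
theorem rho_ne_zero_of_mem_interior {x : Plane} (hx : x ∈ interior S.M) : S.rho x ≠ 0 := by
  intro h0
  refine S.boundary_regular x h0 (IsLocalMin.fderiv_eq_zero ?_)
  filter_upwards [mem_interior_iff_mem_nhds.1 hx] with y hy
  rw [h0]; exact hy

/-- The transport integral up to a fixed time. -/
noncomputable def transportExt (S : RiemSurface) (T : ℝ) (f : Plane × ℝ → ℂ) (p : Plane × ℝ) : ℂ :=
  ∫ t in (0 : ℝ)..T, f (S.extFlow t p)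

/-- Functions with support away from the boundary vanish near the end points of geodesics. -/
theorem IsSimple.eventually_exit_eq_zero (hS : S.IsSimple) {k : ℤ} {ψ : Plane → ℂ}
    (hψ : ψ ∈ C0inf S) {p₀ : Plane × ℝ} (hp₀ : p₀ ∈ S.SM) :
    ∀ᶠ z : ℝ × (Plane × ℝ) in 𝓝 (S.exitTime p₀, p₀), modeFun k ψ (S.extFlow z.1 z.2) = 0 := by
  have hnot : (S.extFlow (S.exitTime p₀) p₀).1 ∉ tsupport ψ := fun h =>
    rho_ne_zero_of_mem_interior (hψ.2.2 h) (hS.rho_exit hp₀)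
  have hc : ContinuousAt (fun z : ℝ × (Plane × ℝ) => (S.extFlow z.1 z.2).1) (S.exitTime p₀, p₀) :=
    S.continuous_extFlow.fst.continuousAt
  filter_upwards [hc.preimage_mem_nhds ((isClosed_tsupport ψ).isOpen_compl.mem_nhds hnot)] with z hz
  rw [modeFun, image_eq_zero_of_notMem_tsupport hz, mul_zero]

/-- The mode vanishes along the flow for times near τ(p₀), and τ is continuous, so near p₀ the upper
limit may be replaced by the constant τ(p₀). Smoothness of u^f then does not involve smoothness of
τ. -/
theorem IsSimple.eventually_transport_eq (hS : S.IsSimple) {k : ℤ} {ψ : Plane → ℂ}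
    (hψ : ψ ∈ C0inf S) {p₀ : Plane × ℝ} (hp₀ : p₀ ∈ S.SM) :
    ∀ᶠ p in 𝓝 p₀, p ∈ S.SM →
      S.transport (modeFun k ψ) p = S.transportExt (S.exitTime p₀) (modeFun k ψ) p := by
  have hev := hS.eventually_exit_eq_zero (k := k) hψ hp₀
  rw [nhds_prod_eq] at hev
  obtain ⟨Pa, ha, Pb, hb, hab⟩ := eventually_prod_iff.1 hev
  obtain ⟨δ, hδ, Hδ⟩ := Metric.eventually_nhds_iff.1 ha
  filter_upwards [hb, hS.eventually_exitTime_lt hp₀ (T := S.exitTime p₀ + δ) (by linarith),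
    hS.eventually_lt_exitTime hp₀ (T := S.exitTime p₀ - δ) (by linarith)] with p h1 h2 h3 hp
  have hcont : Continuous fun t => modeFun k ψ (S.extFlow t p) :=
    (contDiff_modeFun k hψ.1).continuous.comp (continuous_extFlow_curve p)
  have e1 : S.transport (modeFun k ψ) p =
      ∫ t in (0 : ℝ)..S.exitTime p, modeFun k ψ (S.extFlow t p) := by
    refine intervalIntegral.integral_congr fun t ht => ?_
    rw [uIcc_of_le (hS.exitTime_nonneg hp)] at ht
    simp only [flow_eq hp ht]
  have e2 : ∫ t in S.exitTime p₀..S.exitTime p, modeFun k ψ (S.extFlow t p) = 0 := by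
    rw [intervalIntegral.integral_congr (g := fun _ => (0 : ℂ)), intervalIntegral.integral_zero]
    intro t ht
    refine hab (Hδ ?_) h1
    have h2' := h2 hp
    have h3' := h3 hp
    rw [mem_uIcc] at ht
    rw [Real.dist_eq, abs_lt]
    rcases ht with ht | ht <;> constructor <;> linarith [ht.1, ht.2]
  rw [e1, transportExt, ← intervalIntegral.integral_add_adjacent_intervals
    (hcont.intervalIntegrable 0 (S.exitTime p₀)) (hcont.intervalIntegrable _ _), e2, add_zero]

theorem contDiff_along_flow {f : Plane × ℝ → ℂ} (hf : ContDiff ℝ ∞ f) :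
    ContDiff ℝ ∞ (fun z : (Plane × ℝ) × ℝ => f (S.extFlow z.2 z.1)) :=
  hf.comp (S.extFlow_smooth.comp (contDiff_snd.prodMk contDiff_fst))

theorem fderiv_along_flow {f : Plane × ℝ → ℂ} (hf : ContDiff ℝ ∞ f) (p : Plane × ℝ) (t : ℝ)
    (ξ : Plane × ℝ) : fderiv ℝ (fun z : (Plane × ℝ) × ℝ => f (S.extFlow z.2 z.1)) (p, t) (ξ, 0) =
      fderiv ℝ f (S.extFlow t p) (S.dFlow t p ξ) := by
  have h1 : HasFDerivAt (fun z : (Plane × ℝ) × ℝ => (z.2, z.1))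
      ((ContinuousLinearMap.snd ℝ (Plane × ℝ) ℝ).prod (ContinuousLinearMap.fst ℝ (Plane × ℝ) ℝ))
      (p, t) :=
    ((ContinuousLinearMap.snd ℝ (Plane × ℝ) ℝ).prod
      (ContinuousLinearMap.fst ℝ (Plane × ℝ) ℝ)).hasFDerivAt
  have h2 := HasFDerivAt.comp (g := fun z : ℝ × (Plane × ℝ) => S.extFlow z.1 z.2) (p, t)
    (S.extFlow_smooth.differentiable (by simp) (t, p)).hasFDerivAt h1
  have h3 := HasFDerivAt.comp (g := f) (p, t)
    (hf.differentiable (by simp) (S.extFlow t p)).hasFDerivAt h2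
  have h4 : fderiv ℝ (fun z : (Plane × ℝ) × ℝ => f (S.extFlow z.2 z.1)) (p, t) = _ := h3.fderiv
  rw [h4]
  rfl

theorem contDiff_transportExt {f : Plane × ℝ → ℂ} (hf : ContDiff ℝ ∞ f) {T : ℝ} (hT : 0 ≤ T) :
    ContDiff ℝ ∞ (S.transportExt T f) :=
  (contDiff_intervalIntegral (contDiff_along_flow hf) hT).1

theorem fderiv_transportExt {f : Plane × ℝ → ℂ} (hf : ContDiff ℝ ∞ f) {T : ℝ} (hT : 0 ≤ T)
    (p ξ : Plane × ℝ) : fderiv ℝ (S.transportExt T f) p ξ =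
      ∫ t in (0 : ℝ)..T, fderiv ℝ f (S.extFlow t p) (S.dFlow t p ξ) := by
  have := fderiv_intervalIntegral_apply (contDiff_along_flow (S := S) hf) hT p ξ
  simp only [fderiv_along_flow hf] at this
  exact this

/-- A flow preserves its own generator: differentiate φ_{s+t} = φ_t ∘ φ_s at s = 0. -/
theorem dFlow_extX (t : ℝ) (p : Plane × ℝ) : S.dFlow t p (S.extX p) = S.extX (S.extFlow t p) := by
  have h1 : HasDerivAt (fun s => (t, S.extFlow s p)) ((0 : ℝ), S.extX p) 0 := by
    have := S.hasDerivAt_extFlow 0 p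
    rw [extFlow_zero] at this
    exact (hasDerivAt_const _ _).prodMk this
  have h2 := HasFDerivAt.comp_hasDerivAt (l := fun z : ℝ × (Plane × ℝ) => S.extFlow z.1 z.2) 0
    (S.extFlow_smooth.differentiable (by simp) (t, S.extFlow 0 p)).hasFDerivAt h1
  have h3 : HasDerivAt (fun s => S.extFlow (s + t) p) (S.extX (S.extFlow t p)) 0 := by
    have := S.hasDerivAt_extFlow (0 + t) p
    rw [zero_add] at this
    exact HasDerivAt.comp_add_const 0 t (by rwa [zero_add])
  have h4 : (fun s => S.extFlow (s + t) p) = fun s => S.extFlow t (S.extFlow s p) := by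
    funext s
    rw [add_comm, extFlow_add]
  rw [h4] at h3
  rw [extFlow_zero] at h2
  exact h2.unique h3

namespace IsSimple

theorem contDiffOn_transport (hS : S.IsSimple) {k : ℤ} {ψ : Plane → ℂ} (hψ : ψ ∈ C0inf S) :
    ContDiffOn ℝ ∞ (S.transport (modeFun k ψ)) S.SM := by
  intro p hp
  refine (contDiff_transportExt (contDiff_modeFun k hψ.1)
    (hS.exitTime_nonneg hp)).contDiffAt.contDiffWithinAt.congr_of_eventuallyEq ?_ ?_
    (f := S.transportExt (S.exitTime p) (modeFun k ψ))
  · filter_upwards [nhdsWithin_le_nhds (hS.eventually_transport_eq hψ hp), self_mem_nhdsWithin]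
      with q hq hqM using hq hqM
  · exact (hS.eventually_transport_eq hψ hp).self_of_nhds hp

theorem along_transport (hS : S.IsSimple) {k : ℤ} {ψ : Plane → ℂ} (hψ : ψ ∈ C0inf S)
    (Y : Plane × ℝ → Plane × ℝ) {p : Plane × ℝ} (hp : p ∈ S.SM) :
    S.along Y (S.transport (modeFun k ψ)) p = ∫ t in (0 : ℝ)..S.exitTime p,
      fderiv ℝ (modeFun k ψ) (S.extFlow t p) (S.dFlow t p (Y p)) := by
  have hf := contDiff_modeFun k hψ.1
  have hτ := hS.exitTime_nonneg hp
  have hev : S.transport (modeFun k ψ) =ᶠ[𝓝[S.SM] p]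
      S.transportExt (S.exitTime p) (modeFun k ψ) := by
    filter_upwards [nhdsWithin_le_nhds (hS.eventually_transport_eq hψ hp), self_mem_nhdsWithin]
      with q hq hqM using hq hqM
  rw [along, hev.fderivWithin_eq ((hS.eventually_transport_eq hψ hp).self_of_nhds hp),
    fderivWithin_eq_fderiv (uniqueDiffOn_SM p hp)
      ((contDiff_transportExt hf hτ).differentiable (by simp) p), fderiv_transportExt hf hτ]

/-- In the direction X the integrand is the t-derivative of f∘φ_t, and f vanishes at the exit point.
-/
theorem along_X_transport (hS : S.IsSimple) {k : ℤ} {ψ : Plane → ℂ} (hψ : ψ ∈ C0inf S)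
    {p : Plane × ℝ} (hp : p ∈ S.SM) :
    S.along S.X (S.transport (modeFun k ψ)) p = -modeFun k ψ p := by
  have hf := contDiff_modeFun k hψ.1
  rw [hS.along_transport hψ S.X hp]
  have hd : ∀ t, HasDerivAt (fun t => modeFun k ψ (S.extFlow t p))
      (fderiv ℝ (modeFun k ψ) (S.extFlow t p) (S.dFlow t p (S.X p))) t := by
    intro t
    rw [← extX_eq (S.norm_lt_of_mem_M hp.1), dFlow_extX]
    exact HasFDerivAt.comp_hasDerivAt (l := modeFun k ψ) t
      (hf.differentiable (by simp) _).hasFDerivAt (S.hasDerivAt_extFlow t p)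
  have hc : Continuous fun t => fderiv ℝ (modeFun k ψ) (S.extFlow t p) (S.dFlow t p (S.X p)) :=
    ((hf.continuous_fderiv (by simp)).comp (continuous_extFlow_curve p)).clm_apply
      (contDiff_dFlow contDiff_id contDiff_const contDiff_const :
        ContDiff ℝ ∞ fun t : ℝ => S.dFlow t p (S.X p)).continuous
  rw [intervalIntegral.integral_eq_sub_of_hasDerivAt (fun t _ => hd t) (hc.intervalIntegrable _ _),
    extFlow_zero, (hS.eventually_exit_eq_zero hψ hp).self_of_nhds, zero_sub]

theorem transport_outflux (hS : S.IsSimple) (f : Plane × ℝ → ℂ) {p : Plane × ℝ}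
    (hp : p ∈ S.outflux) : S.transport f p = 0 := by
  rw [transport, hS.exitTime_eq_zero_of_outflux hp, intervalIntegral.integral_same]

end IsSimple

end RiemSurface

/-! ### Integration by parts in the angle. -/

namespace RiemSurface

variable {S : RiemSurface}

theorem fderiv_modeFun_vertical (k : ℤ) {ψ : Plane → ℂ} (hψ : ContDiff ℝ ∞ ψ) (q : Plane × ℝ) :
    fderiv ℝ (modeFun k ψ) q ((0 : Plane), (1 : ℝ)) = Complex.I * k * modeFun k ψ q := by
  have h1 : HasDerivAt (fun s : ℝ => (q.1, s)) ((0 : Plane), (1 : ℝ)) q.2 :=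
    (hasDerivAt_const _ _).prodMk (hasDerivAt_id _)
  have h2 := HasFDerivAt.comp_hasDerivAt (l := modeFun k ψ) q.2
    ((contDiff_modeFun k hψ).differentiable (by simp) q).hasFDerivAt h1
  have h3 := (hasDerivAt_expPhase (Complex.I * k) q.2).mul_const (ψ q.1)
  rw [modeFun, ← mul_assoc]
  exact h2.unique h3

theorem hasDerivAt_extFlow_angle {f : Plane × ℝ → ℂ} (hf : ContDiff ℝ ∞ f) (x : Plane) (t s : ℝ) :
    HasDerivAt (fun s => f (S.extFlow t (x, s)))
      (fderiv ℝ f (S.extFlow t (x, s)) (S.dFlow t (x, s) (0, 1))) s := by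
  have h1 : HasDerivAt (fun s : ℝ => (t, (x, s))) ((0 : ℝ), ((0 : Plane), (1 : ℝ))) s :=
    (hasDerivAt_const _ _).prodMk ((hasDerivAt_const _ _).prodMk (hasDerivAt_id _))
  have h2 := HasFDerivAt.comp_hasDerivAt (l := fun z : ℝ × (Plane × ℝ) => S.extFlow z.1 z.2) s
    (S.extFlow_smooth.differentiable (by simp) (t, (x, s))).hasFDerivAt h1
  exact HasFDerivAt.comp_hasDerivAt (l := f) s (hf.differentiable (by simp) _).hasFDerivAt h2

theorem IsSimple.eventually_angle_lt (hS : S.IsSimple) {x : Plane} (hx : x ∈ S.M) {t s₀ : ℝ}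
    (ht : t < S.exitTime (x, s₀)) : ∀ᶠ s in 𝓝 s₀, t < S.exitTime (x, s) := by
  have hc : Continuous fun s : ℝ => (x, s) := Continuous.prodMk_right x
  filter_upwards [(hc.continuousAt (x := s₀)).eventually
    (hS.eventually_lt_exitTime (p := (x, s₀)) ⟨hx, trivial⟩ ht)] with s hs
  exact hs ⟨hx, trivial⟩

open Classical in
/-- Integrands supported away from the end points of the geodesics can be cut off at the exit
time. -/
theorem IsSimple.ite_angle (hS : S.IsSimple) {k : ℤ} {ψ : Plane → ℂ} (hψ : ψ ∈ C0inf S) {x : Plane}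
    (hx : x ∈ S.M) {t : ℝ} (G : ℝ → ℂ) (s₀ : ℝ) :
    (t < S.exitTime (x, s₀) →
      (fun s => if t < S.exitTime (x, s) then G s * modeFun k ψ (S.extFlow t (x, s)) else 0) =ᶠ[𝓝 s₀]
        fun s => G s * modeFun k ψ (S.extFlow t (x, s))) ∧
    (¬ t < S.exitTime (x, s₀) →
      (fun s => if t < S.exitTime (x, s) then G s * modeFun k ψ (S.extFlow t (x, s)) else 0) =ᶠ[𝓝 s₀]
        fun _ => 0) := by
  refine ⟨fun h => ?_, fun h => ?_⟩
  · filter_upwards [hS.eventually_angle_lt hx h] with s hs using if_pos hs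
  · have hp : (x, s₀) ∈ S.SM := ⟨hx, trivial⟩
    -- Only t = τ(x, s₀) is delicate: nearby angles may lie on either side of the cutoff, but the
    -- mode vanishes there in any case.
    rcases (not_lt.1 h).eq_or_lt with h | h
    · have hc : Continuous fun s : ℝ => (t, (x, s)) := by fun_prop
      have hev := hS.eventually_exit_eq_zero (k := k) hψ hp
      rw [h] at hev
      filter_upwards [(hc.continuousAt (x := s₀)).eventually hev] with s hs
      split_ifs
      · rw [hs, mul_zero]
      · rfl
    · have hc : Continuous fun s : ℝ => (x, s) := Continuous.prodMk_right x
      filter_upwards [(hc.continuousAt (x := s₀)).eventually (hS.eventually_exitTime_lt hp h)]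
        with s hs
      exact if_neg (not_lt.2 (hs ⟨hx, trivial⟩).le)

open Classical in
theorem IsSimple.contDiff_ite_angle (hS : S.IsSimple) {k : ℤ} {ψ : Plane → ℂ} (hψ : ψ ∈ C0inf S)
    {x : Plane} (hx : x ∈ S.M) {t : ℝ} {G : ℝ → ℂ}
    (hG : ∀ s, t < S.exitTime (x, s) → ContDiffAt ℝ ∞ G s) :
    ContDiff ℝ ∞
      (fun s => if t < S.exitTime (x, s) then G s * modeFun k ψ (S.extFlow t (x, s)) else 0) := by
  refine contDiff_iff_contDiffAt.2 fun s => ?_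
  by_cases h : t < S.exitTime (x, s)
  · refine ContDiffAt.congr_of_eventuallyEq ?_ ((hS.ite_angle hψ hx G s).1 h)
    exact (hG s h).mul ((contDiff_modeFun k hψ.1).comp (S.extFlow_smooth.comp
      (contDiff_const.prodMk (contDiff_const.prodMk contDiff_id)))).contDiffAt
  · exact contDiffAt_const.congr_of_eventuallyEq ((hS.ite_angle hψ hx G s).2 h)

/-- The derivative of a mode along the geodesic flow, in the direction `X_⊥`. -/
theorem IsSimple.fderiv_Xperp_eq (hS : S.IsSimple) (k : ℤ) {ψ : Plane → ℂ} (hψ : ContDiff ℝ ∞ ψ)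
    {x : Plane} (hx : x ∈ S.M) {t s : ℝ} (h0 : 0 < t) (ht : t < S.exitTime (x, s)) :
    HasDerivAt (fun s : ℝ => Complex.exp (-(Complex.I * k) * s) *
        ((S.aExt (x, s) t / S.bExt (x, s) t : ℝ) : ℂ) * modeFun k ψ (S.extFlow t (x, s)))
      ((2 * Real.pi : ℂ) * (S.bExt (x, s) t * S.kernelValue k (x, s) t * ψ (S.extFlow t (x, s)).1) -
        fderiv ℝ (modeFun k ψ) (S.extFlow t (x, s)) (S.dFlow t (x, s) (S.Xperp (x, s))) *
          Complex.exp (-(Complex.I * k) * s)) s := by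
  have hp : (x, s) ∈ S.SM := ⟨hx, trivial⟩
  have htm : t ∈ Icc 0 (S.exitTime (x, s)) := ⟨h0.le, ht.le⟩
  have hb := (hS.bExt_pos hp h0 ht.le).ne'
  have h1 := hasDerivAt_expPhase (-(Complex.I * k)) s
  have h2 : HasDerivAt (fun s : ℝ => ((S.aExt (x, s) t / S.bExt (x, s) t : ℝ) : ℂ)) _ s :=
    (contDiffAt_quotient (frameDet_ne_zero (extFlow_mem_SM hp htm).1)
      hb).differentiableAt_last.hasDerivAt.ofReal_comp
  have h3 := hasDerivAt_extFlow_angle (S := S) (contDiff_modeFun k hψ) x t s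
  refine ((h1.fun_mul h2).fun_mul h3).congr_deriv ?_
  -- The X_⊥-derivative of the mode enters ∂_θ(f∘φ_t) with factor -b and dφ_t(X_⊥)f with factor a.
  -- Weighted by a/b the two contributions cancel, and the vertical terms combine to the Wronskian
  -- times ikf/b.
  rw [dFlow_vertical hp htm, dFlow_Xperp hp htm, map_add, map_add, map_smul, map_smul, map_smul,
    map_smul, fderiv_modeFun_vertical k hψ]
  have hw : (S.aExt (x, s) t : ℂ) * S.bExt' (x, s) t - S.aExt' (x, s) t * S.bExt (x, s) t = 1 := by
    exact_mod_cast wronskian hp htm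
  rw [kernelValue, qExt]
  have hexp : Complex.exp (Complex.I * k * (((S.extFlow t (x, s)).2 - s : ℝ) : ℂ)) =
      Complex.exp (Complex.I * k * (S.extFlow t (x, s)).2) * Complex.exp (-(Complex.I * k) * s) := by
    rw [← Complex.exp_add]
    congr 1
    push_cast
    ring
  rw [hexp]
  set R' := deriv (fun s : ℝ => S.aExt (x, s) t / S.bExt (x, s) t) s
  have hbC : (S.bExt (x, s) t : ℂ) ≠ 0 := by exact_mod_cast hb
  have hpi : (Real.pi : ℂ) ≠ 0 := by exact_mod_cast Real.pi_ne_zero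
  simp only [modeFun, Complex.real_smul]
  set F := fderiv ℝ (modeFun k ψ) (S.extFlow t (x, s)) (S.Xperp (S.extFlow t (x, s)))
  push_cast
  set A := (S.aExt (x, s) t : ℂ)
  set A' := (S.aExt' (x, s) t : ℂ)
  set B := (S.bExt (x, s) t : ℂ)
  set B' := (S.bExt' (x, s) t : ℂ)
  set e := Complex.exp (-(Complex.I * k) * s)
  set e' := Complex.exp (Complex.I * k * (S.extFlow t (x, s)).2)
  set y := ψ (S.extFlow t (x, s)).1
  field_simp
  linear_combination (e * Complex.I * k * e' * y) * hw

end RiemSurface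

namespace RiemSurface

variable {S : RiemSurface}

/-- The region of polar coordinates `(s, t)` of the interior points, seen from `x`. -/
def polarRegion (S : RiemSurface) (x : Plane) : Set (ℝ × ℝ) :=
  {z | 0 < z.2 ∧ z.2 < S.exitTime (x, z.1)}

theorem IsSimple.continuous_exitTime_angle (hS : S.IsSimple) {x : Plane} (hx : x ∈ S.M) :
    Continuous fun s : ℝ => S.exitTime (x, s) :=
  hS.continuousOn_exitTime.comp_continuous (Continuous.prodMk_right x) fun _ => ⟨hx, trivial⟩

theorem IsSimple.isOpen_polarRegion (hS : S.IsSimple) {x : Plane} (hx : x ∈ S.M) :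
    IsOpen (S.polarRegion x) :=
  (isOpen_lt continuous_const continuous_snd).inter
    (isOpen_lt continuous_snd ((hS.continuous_exitTime_angle hx).comp continuous_fst))

/-- The integrand of `X_⊥ u^f`, weighted by the conjugate character. -/
noncomputable def perpIntegrand (S : RiemSurface) (k : ℤ) (ψ : Plane → ℂ) (x : Plane) (s t : ℝ) : ℂ :=
  fderiv ℝ (modeFun k ψ) (S.extFlow t (x, s)) (S.dFlow t (x, s) (S.Xperp (x, s))) *
    Complex.exp (-(Complex.I * k) * s)

theorem continuous_perpIntegrand (k : ℤ) {ψ : Plane → ℂ} (hψ : ContDiff ℝ ∞ ψ) (x : Plane) :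
    Continuous fun z : ℝ × ℝ => S.perpIntegrand k ψ x z.1 z.2 := by
  have hp : ContDiff ℝ ∞ (fun z : ℝ × ℝ => (x, z.1)) := contDiff_const.prodMk contDiff_fst
  refine Continuous.mul ?_ ?_
  · refine (((contDiff_modeFun k hψ).continuous_fderiv (by simp)).comp
      (S.extFlow_smooth.continuous.comp (continuous_snd.prodMk hp.continuous))).clm_apply ?_
    exact (contDiff_dFlow (S := S) contDiff_snd hp (S.Xperp_smooth.comp hp)).continuous
  · fun_prop

open Classical in
/-- Integration by parts in the angle. -/
theorem IsSimple.integral_angle (hS : S.IsSimple) {k : ℤ} {ψ : Plane → ℂ} (hψ : ψ ∈ C0inf S)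
    {x : Plane} (hx : x ∈ S.M) {t : ℝ} (h0 : 0 < t) :
    ∫ s in (0 : ℝ)..2 * Real.pi, (if t < S.exitTime (x, s) then S.perpIntegrand k ψ x s t else 0) =
      ∫ s in (0 : ℝ)..2 * Real.pi, (if t < S.exitTime (x, s) then (2 * Real.pi : ℂ) *
        (S.bExt (x, s) t * S.kernelValue k (x, s) t * ψ (S.extFlow t (x, s)).1) else 0) := by
  set G : ℝ → ℂ := fun s => Complex.exp (-(Complex.I * k) * s) *
    ((S.aExt (x, s) t / S.bExt (x, s) t : ℝ) : ℂ) with hG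
  -- The integrand equals Q - P'. Both P and Q are smooth across the cutoff, as the mode vanishes
  -- near the exit, and P is 2π-periodic, so the integral of P' is zero.
  set P : ℝ → ℂ := fun s => if t < S.exitTime (x, s) then
    G s * modeFun k ψ (S.extFlow t (x, s)) else 0 with hP
  set Q : ℝ → ℂ := fun s => if t < S.exitTime (x, s) then (2 * Real.pi : ℂ) *
        (S.bExt (x, s) t * S.kernelValue k (x, s) t * ψ (S.extFlow t (x, s)).1) else 0 with hQ
  have hcurve : ContDiff ℝ ∞ (fun s : ℝ => (t, (x, s))) :=
    contDiff_const.prodMk (contDiff_const.prodMk contDiff_id)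
  have hofReal : ∀ {f : ℝ → ℝ} {s : ℝ}, ContDiffAt ℝ ∞ f s →
      ContDiffAt ℝ ∞ (fun z => (f z : ℂ)) s := fun {f} s hf =>
    Complex.ofRealCLM.contDiff.contDiffAt.comp s hf
  have hdata : ∀ s, t < S.exitTime (x, s) →
      S.frameDet (S.extFlow t (x, s)).1 ≠ 0 ∧ S.bExt (x, s) t ≠ 0 := fun s hs =>
    ⟨frameDet_ne_zero (extFlow_mem_SM (p := (x, s)) ⟨hx, trivial⟩ ⟨h0.le, hs.le⟩).1,
      (hS.bExt_pos (p := (x, s)) ⟨hx, trivial⟩ h0 hs.le).ne'⟩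
  have hGs : ∀ s, t < S.exitTime (x, s) → ContDiffAt ℝ ∞ G s := by
    intro s hs
    have h1 := contDiffAt_quotient (hdata s hs).1 (hdata s hs).2
    have h2 : ContDiffAt ℝ ∞ (fun s : ℝ => S.aExt (x, s) t / S.bExt (x, s) t) s :=
      ContDiffAt.comp (g := fun z : ℝ × (Plane × ℝ) => S.aExt z.2 z.1 / S.bExt z.2 z.1)
        (f := fun s : ℝ => (t, (x, s))) s h1 hcurve.contDiffAt
    have h3 : ContDiff ℝ ∞ (fun s : ℝ => Complex.exp (-(Complex.I * k) * s)) :=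
      (contDiff_const.mul Complex.ofRealCLM.contDiff).cexp
    exact h3.contDiffAt.mul (hofReal h2)
  have hPs : ContDiff ℝ ∞ P := hS.contDiff_ite_angle hψ hx hGs
  have hQs : ContDiff ℝ ∞ Q := by
    -- The amplitude ψ is e^{-ikα} times the mode, which brings Q into the form treated by
    -- `contDiff_ite_angle`.
    set G' : ℝ → ℂ := fun s => (2 * Real.pi : ℂ) * (S.bExt (x, s) t * S.kernelValue k (x, s) t) *
      Complex.exp (-(Complex.I * k) * (S.extFlow t (x, s)).2) with hG'
    have hG's : ∀ s, t < S.exitTime (x, s) → ContDiffAt ℝ ∞ G' s := by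
      intro s hs
      have h1 := contDiffAt_kernelValue (S := S) k (hdata s hs).1 (hdata s hs).2
      have h2 : ContDiffAt ℝ ∞ (fun s : ℝ => S.kernelValue k (x, s) t) s :=
        ContDiffAt.comp (g := fun z : ℝ × (Plane × ℝ) => S.kernelValue k z.2 z.1)
          (f := fun s : ℝ => (t, (x, s))) s h1 hcurve.contDiffAt
      have h3 : ContDiffAt ℝ ∞ (fun s : ℝ => S.bExt (x, s) t) s :=
        ContDiffAt.comp (g := fun z : ℝ × (Plane × ℝ) => S.bExt z.2 z.1)
          (f := fun s : ℝ => (t, (x, s))) s (contDiffAt_bExt (hdata s hs).1) hcurve.contDiffAt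
      have h4 : ContDiff ℝ ∞ (fun s : ℝ => (S.extFlow t (x, s)).2) :=
        (S.extFlow_smooth.comp hcurve).snd
      exact (contDiffAt_const.mul ((hofReal h3).mul h2)).mul
        (contDiffAt_const.mul (hofReal h4.contDiffAt)).cexp
    have h := hS.contDiff_ite_angle (k := k) hψ hx hG's
    have e : Q = fun s => if t < S.exitTime (x, s) then
        G' s * modeFun k ψ (S.extFlow t (x, s)) else 0 := by
      funext s
      simp only [hQ, hG', modeFun]
      split_ifs
      · have : Complex.exp (-(Complex.I * k) * (S.extFlow t (x, s)).2) *
            Complex.exp (Complex.I * k * (S.extFlow t (x, s)).2) = 1 := by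
          rw [← Complex.exp_add]; simp
        linear_combination -((2 * Real.pi : ℂ) * (S.bExt (x, s) t * S.kernelValue k (x, s) t *
          ψ (S.extFlow t (x, s)).1)) * this
      · rfl
    rw [e]; exact h
  have hkey : ∀ s, (if t < S.exitTime (x, s) then S.perpIntegrand k ψ x s t else 0) =
      Q s - deriv P s := by
    intro s
    by_cases hs : t < S.exitTime (x, s)
    · rw [((hS.ite_angle hψ hx G s).1 hs).deriv_eq, (hS.fderiv_Xperp_eq k hψ.1 hx h0 hs).deriv]
      simp only [hQ, if_pos hs, perpIntegrand]
      ring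
    · rw [((hS.ite_angle hψ hx G s).2 hs).deriv_eq]
      simp only [hQ, if_neg hs, deriv_const, sub_zero]
  have hdP : Continuous (deriv P) := hPs.continuous_deriv (by simp)
  have hper : P (2 * Real.pi) = P 0 := by
    have e1 : (x, 2 * Real.pi) = (x, (0 : ℝ)) + ((0 : Plane), ((1 : ℤ) : ℝ) * (2 * Real.pi)) := by
      simp
    have e2 : Complex.exp (-(Complex.I * k) * ((2 * Real.pi : ℝ) : ℂ)) = 1 := by
      rw [Complex.exp_eq_one_iff]
      exact ⟨-k, by push_cast; ring⟩
    have e3 : ∀ q : Plane × ℝ, modeFun k ψ (q + ((0 : Plane), ((1 : ℤ) : ℝ) * (2 * Real.pi))) =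
        modeFun k ψ q := by
      intro q
      have e4 : q + ((0 : Plane), ((1 : ℤ) : ℝ) * (2 * Real.pi)) = (q.1, q.2 + 2 * Real.pi) := by
        ext <;> simp
      rw [e4, modeFun_add_angle]
      have : Complex.exp (Complex.I * k * ((2 * Real.pi : ℝ) : ℂ)) = 1 := by
        rw [Complex.exp_eq_one_iff]
        exact ⟨k, by push_cast; ring⟩
      rw [this, one_mul]
    simp only [hP, hG, e2, e1, exitTime_shift, aExt_shift, bExt_shift, extFlow_shift, e3,
      Complex.ofReal_zero, mul_zero, Complex.exp_zero]
  simp only [hkey]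
  rw [intervalIntegral.integral_sub (hQs.continuous.intervalIntegrable _ _)
    (hdP.intervalIntegrable _ _), intervalIntegral.integral_deriv_eq_sub
    (fun s _ => hPs.differentiable (by simp) s) (hdP.intervalIntegrable _ _), hper, sub_self,
    sub_zero]

end RiemSurface

theorem ContinuousLinearMap.det_eq_det2 (A : Plane →L[ℝ] Plane) :
    A.det = det2 (A (1, 0)) (A (0, 1)) := by
  rw [ContinuousLinearMap.det, ← LinearMap.det_toMatrix (Module.Basis.finTwoProd ℝ),
    Matrix.det_fin_two]
  simp [LinearMap.toMatrix_apply, det2]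
  ring

open Classical in
/-- Fubini for the region under the graph of a nonnegative continuous function. -/
theorem integral_region_swap {F : ℝ → ℝ → ℂ} (hF : Continuous fun z : ℝ × ℝ => F z.1 z.2)
    {τ : ℝ → ℝ} (hτ : Continuous τ) (hτ0 : ∀ s, 0 ≤ τ s) {A R : ℝ} (hA : 0 ≤ A)
    (hR : ∀ s ∈ Icc 0 A, τ s ≤ R) :
    ∫ s in (0 : ℝ)..A, ∫ t in (0 : ℝ)..τ s, F s t =
      ∫ t in Ioc 0 R, ∫ s in (0 : ℝ)..A, if t < τ s then F s t else 0 := by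
  have hinner : ∀ s ∈ Ioc 0 A, ∫ t in (0 : ℝ)..τ s, F s t =
      ∫ t in Ioc 0 R, if t < τ s then F s t else 0 := by
    intro s hs
    have h1 : (fun t => if t < τ s then F s t else 0) = (Iio (τ s)).indicator (F s) := by
      funext t
      simp only [indicator, mem_Iio]
    rw [h1, setIntegral_indicator measurableSet_Iio, intervalIntegral.integral_of_le (hτ0 s),
      integral_Ioc_eq_integral_Ioo]
    congr 2
    ext t
    simp only [mem_inter_iff, mem_Ioc, mem_Iio, mem_Ioo]
    exact ⟨fun h => ⟨⟨h.1, h.2.le.trans (hR s (Ioc_subset_Icc_self hs))⟩, h.2⟩,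
      fun h => ⟨h.1.1, h.2⟩⟩
  have hU : MeasurableSet {z : ℝ × ℝ | z.2 < τ z.1} :=
    (isOpen_lt continuous_snd (hτ.comp continuous_fst)).measurableSet
  have hint : Integrable (Function.uncurry fun s t => if t < τ s then F s t else 0)
      ((volume.restrict (Ioc 0 A)).prod (volume.restrict (Ioc 0 R))) := by
    have h1 : (Function.uncurry fun s t => if t < τ s then F s t else 0) =
        {z : ℝ × ℝ | z.2 < τ z.1}.indicator (fun z => F z.1 z.2) := by
      funext z
      simp only [Function.uncurry, indicator, mem_ofPred_eq]
    rw [h1, Measure.prod_restrict]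
    refine Integrable.indicator ?_ hU
    exact (hF.continuousOn.integrableOn_compact (isCompact_Icc.prod isCompact_Icc)).mono_set
      (prod_mono Ioc_subset_Icc_self Ioc_subset_Icc_self)
  rw [intervalIntegral.integral_of_le hA, setIntegral_congr_fun measurableSet_Ioc hinner,
    integral_integral_swap hint]
  simp only [intervalIntegral.integral_of_le hA]

/-! ### The area measure in polar coordinates and the integral formula for W_k. -/

namespace RiemSurface

variable {S : RiemSurface}

/-- The point with polar coordinates `(s, t)` around `x`. -/
noncomputable def polarPoint (S : RiemSurface) (x : Plane) (z : ℝ × ℝ) : Plane :=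
  (S.extFlow z.2 (x, z.1)).1

/-- The differential of `polarPoint`. -/
noncomputable def polarDeriv (S : RiemSurface) (x : Plane) (z : ℝ × ℝ) : Plane →L[ℝ] Plane :=
  ContinuousLinearMap.snd ℝ Plane Plane ∘L fderiv ℝ S.polarMap (x, z) ∘L
    ContinuousLinearMap.inr ℝ Plane Plane

theorem hasFDerivAt_polarPoint (x : Plane) (z : ℝ × ℝ) :
    HasFDerivAt (S.polarPoint x) (S.polarDeriv x z) z := by
  have h1 : HasFDerivAt (fun z : Plane => (x, z)) (ContinuousLinearMap.inr ℝ Plane Plane) z :=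
    hasFDerivAt_prodMk_right x z
  exact (ContinuousLinearMap.snd ℝ Plane Plane).hasFDerivAt.comp z
    (((contDiff_polarMap (S := S)).differentiable (by simp) (x, z)).hasFDerivAt.comp z h1)

theorem continuous_areaDensity : Continuous S.areaDensity := by
  have h : ∀ v w : Plane, Continuous fun x => S.g x v w := fun v w =>
    (S.g_smooth.continuous.clm_apply continuous_const).clm_apply continuous_const
  exact (((h _ _).mul (h _ _)).sub ((h _ _).pow 2)).sqrt

theorem integral_area (G : Plane → ℂ) :
    ∫ y, G y ∂S.area = ∫ y in S.M, S.areaDensity y • G y := by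
  rw [area, integral_withDensity_eq_integral_toReal_smul
    continuous_areaDensity.measurable.ennreal_ofReal (by simp)]
  refine integral_congr_ae (Eventually.of_forall fun y => ?_)
  have h : 0 ≤ S.areaDensity y := Real.sqrt_nonneg _
  simp only [ENNReal.toReal_ofReal h]

/-- This is dM = b dt dθ: the columns of the differential are the base components of -bX_⊥ and X,
whose determinant is -b times that of the frame, and the area density is the reciprocal of the
absolute frame determinant. -/
theorem IsSimple.abs_det_polarDeriv (hS : S.IsSimple) {x : Plane} (hx : x ∈ S.M) {z : ℝ × ℝ}
    (h0 : 0 < z.2) (h1 : z.2 ≤ S.exitTime (x, z.1)) :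
    |(S.polarDeriv x z).det| * S.areaDensity (S.polarPoint x z) = S.bExt (x, z.1) z.2 := by
  have hp : (x, z.1) ∈ S.SM := ⟨hx, trivial⟩
  have hm := extFlow_mem_SM hp ⟨h0.le, h1⟩
  have happ : ∀ v : Plane, S.polarDeriv x z v = (v.2 • S.extX (S.extFlow z.2 (x, z.1)) +
      S.dFlow z.2 (x, z.1) (0, v.1)).1 := by
    intro v
    have : S.polarDeriv x z v = (fderiv ℝ S.polarMap (x, z) (0, v)).2 := rfl
    rw [this, fderiv_polarMap]
  have hd := det2_X_Xperp (S := S) (S.extFlow z.2 (x, z.1))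
  have h00 : S.dFlow z.2 (x, z.1) (0, 0) = 0 := map_zero _
  have hdet : (S.polarDeriv x z).det = -S.bExt (x, z.1) z.2 * S.frameDet (S.polarPoint x z) := by
    rw [ContinuousLinearMap.det_eq_det2, happ, happ]
    simp only [dFlow_vertical hp ⟨h0.le, h1⟩, extX_eq (S.norm_lt_of_mem_M hm.1), zero_smul,
      zero_add, one_smul, h00, add_zero]
    rw [polarPoint, ← neg_neg (S.frameDet _), ← hd]
    simp only [det2, Prod.fst_add, Prod.smul_fst, Prod.smul_snd, smul_eq_mul,
      smul_zero, add_zero]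
    ring
  have ha := areaDensity_mul_abs_frameDet (S := S) hm.1
  rw [hdet, abs_mul, abs_neg, abs_of_pos (hS.bExt_pos hp h0 h1), mul_assoc, polarPoint,
    mul_comm |_|, ha, mul_one]

/-- The region of polar coordinates with normalized angles. -/
def polarDomain (S : RiemSurface) (x : Plane) : Set (ℝ × ℝ) :=
  {z | z.1 ∈ Ico 0 (2 * Real.pi)} ∩ S.polarRegion x

namespace IsSimple

theorem measurableSet_polarDomain (hS : S.IsSimple) {x : Plane} (hx : x ∈ S.M) :
    MeasurableSet (S.polarDomain x) :=
  (measurable_fst measurableSet_Ico).inter (hS.isOpen_polarRegion hx).measurableSet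

theorem polarPoint_eq_flow {x : Plane} (hx : x ∈ S.M) {z : ℝ × ℝ} (hz : z ∈ S.polarDomain x) :
    (S.flow (x, z.1) z.2).1 = S.polarPoint x z := by
  rw [flow_eq (p := (x, z.1)) ⟨hx, trivial⟩ ⟨hz.2.1.le, hz.2.2.le⟩, polarPoint]

theorem polarPoint_mem {x : Plane} (hx : x ∈ S.M) {z : ℝ × ℝ} (hz : z ∈ S.polarDomain x) :
    S.polarPoint x z ∈ S.M :=
  (extFlow_mem_SM (p := (x, z.1)) ⟨hx, trivial⟩ ⟨hz.2.1.le, hz.2.2.le⟩).1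

theorem injOn_polarPoint (hS : S.IsSimple) {x : Plane} (hx : x ∈ S.M) :
    InjOn (S.polarPoint x) (S.polarDomain x) := by
  intro z hz z' hz' h
  have hne : S.polarPoint x z ≠ x := by
    rw [← polarPoint_eq_flow hx hz]
    exact hS.no_loop (x, z.1) ⟨hx, trivial⟩ z.2 hz.2.1 hz.2.2.le
  exact (hS.exp_bijective x hx _ (polarPoint_mem hx hz) hne).unique
    ⟨hz.1, hz.2.1, hz.2.2.le, polarPoint_eq_flow hx hz⟩
    ⟨hz'.1, hz'.2.1, hz'.2.2.le, (polarPoint_eq_flow hx hz').trans h.symm⟩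

/-- Change of variables for an injective map. The image misses x, which is a null set, and possibly
points reached only at the exit time; these lie on the boundary, where G vanishes, so the measure of
the boundary plays no role. -/
theorem integral_area_polar (hS : S.IsSimple) {x : Plane} (hx : x ∈ S.M) {G : Plane → ℂ}
    (hG : Continuous G) (hG0 : ∀ y, S.rho y = 0 → G y = 0) :
    IntegrableOn (fun z => S.bExt (x, z.1) z.2 • G (S.polarPoint x z)) (S.polarDomain x) ∧
    ∫ z in S.polarDomain x, S.bExt (x, z.1) z.2 • G (S.polarPoint x z) = ∫ y, G y ∂S.area := by
  have hmeas := hS.measurableSet_polarDomain hx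
  have hder : ∀ z ∈ S.polarDomain x,
      HasFDerivWithinAt (S.polarPoint x) (S.polarDeriv x z) (S.polarDomain x) z := fun z _ =>
    (hasFDerivAt_polarPoint x z).hasFDerivWithinAt
  have hinj := hS.injOn_polarPoint hx
  have hcongr : ∀ z ∈ S.polarDomain x, S.bExt (x, z.1) z.2 • G (S.polarPoint x z) =
      |(S.polarDeriv x z).det| • (S.areaDensity (S.polarPoint x z) • G (S.polarPoint x z)) := by
    intro z hz
    rw [smul_smul, hS.abs_det_polarDeriv hx hz.2.1 hz.2.2.le]
  have hgc : Continuous fun y => S.areaDensity y • G y := continuous_areaDensity.smul hG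
  have hsub : S.polarPoint x '' S.polarDomain x ⊆ S.M := by
    rintro _ ⟨z, hz, rfl⟩
    exact polarPoint_mem hx hz
  constructor
  · rw [integrableOn_congr_fun hcongr hmeas,
      ← integrableOn_image_iff_integrableOn_abs_det_fderiv_smul volume hmeas hder hinj
        (fun y => S.areaDensity y • G y)]
    exact (hgc.continuousOn.integrableOn_compact S.compact).mono_set hsub
  · rw [setIntegral_congr_fun hmeas hcongr,
      ← integral_image_eq_integral_abs_det_fderiv_smul volume hmeas hder hinj
        (fun y => S.areaDensity y • G y), integral_area]
    symm
    refine setIntegral_eq_of_subset_of_ae_sdiff_eq_zero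
      S.compact.measurableSet.nullMeasurableSet hsub ?_
    filter_upwards [(countable_singleton x).ae_notMem volume] with y hy hyM
    obtain ⟨θ, hθ, t, h0, ht, hexp⟩ := hS.exists_polar hx hyM.1 hy
    have hτ : t = S.exitTime (x, θ) := by
      by_contra hne
      exact hyM.2 ⟨(θ, t), ⟨hθ, h0, lt_of_le_of_ne ht hne⟩, hexp⟩
    rw [hG0 y, smul_zero]
    rw [← hexp, hτ]
    exact hS.rho_exit (p := (x, θ)) ⟨hx, trivial⟩

/-- On modes supported in the interior, `W_k` is the integral operator with the kernel `K`. -/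
theorem W_modeFun (hS : S.IsSimple) {k : ℤ} {ψ : Plane → ℂ} (hψ : ψ ∈ C0inf S)
    {K : Plane × Plane → ℂ} (hK : Continuous K) (hKer : ∀ z, S.IsKernelAt k z (K z))
    {p : Plane × ℝ} (hp : p ∈ S.SM) :
    S.W k (modeFun k ψ) p =
      Complex.exp (Complex.I * k * p.2) * ∫ y, K (p.1, y) * ψ y ∂S.area := by
  classical
  obtain ⟨x, θ⟩ := p
  have hx : x ∈ S.M := hp.1
  have hτc := hS.continuous_exitTime_angle hx
  have hpi := Real.two_pi_pos
  -- R bounds the exit times from x, so the polar domain lies in a rectangle on which Fubini's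
  -- theorem applies.
  obtain ⟨R, hR⟩ := isCompact_Icc.exists_bound_of_continuousOn
    (s := Icc 0 (2 * Real.pi)) hτc.continuousOn
  set G : Plane → ℂ := fun y => K (x, y) * ψ y with hGdef
  have hGc : Continuous G := (hK.comp (Continuous.prodMk_right x)).mul hψ.1.continuous
  have hG0 : ∀ y, S.rho y = 0 → G y = 0 := by
    intro y hy
    have : y ∉ tsupport ψ := fun h => rho_ne_zero_of_mem_interior (hψ.2.2 h) hy
    rw [hGdef]
    simp only [image_eq_zero_of_notMem_tsupport this, mul_zero]
  obtain ⟨hint, hpol⟩ := hS.integral_area_polar hx hGc hG0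
  have e1 : ∀ s : ℝ, S.along S.Xperp (S.transport (modeFun k ψ)) (x, s) *
      Complex.exp (-(Complex.I * k * s)) =
      ∫ t in (0 : ℝ)..S.exitTime (x, s), S.perpIntegrand k ψ x s t := by
    intro s
    rw [hS.along_transport hψ S.Xperp (p := (x, s)) ⟨hx, trivial⟩,
      ← intervalIntegral.integral_mul_const]
    simp only [perpIntegrand, neg_mul]
  set Q : ℝ × ℝ → ℂ := (S.polarRegion x).indicator fun z =>
    (2 * Real.pi : ℂ) * (S.bExt (x, z.1) z.2 • G (S.polarPoint x z)) with hQ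
  have e2 : ∀ t ∈ Ioc 0 R, (∫ s in (0 : ℝ)..2 * Real.pi,
      if t < S.exitTime (x, s) then S.perpIntegrand k ψ x s t else 0) =
      ∫ s in Ico 0 (2 * Real.pi), Q (s, t) := by
    intro t ht
    rw [hS.integral_angle hψ hx ht.1, intervalIntegral.integral_of_le hpi.le,
      ← integral_Ico_eq_integral_Ioc]
    refine integral_congr_ae (Eventually.of_forall fun s => ?_)
    simp only [hQ, indicator, polarRegion, mem_ofPred_eq, ht.1, true_and]
    split_ifs with h
    · rw [← hKer (x, S.polarPoint x (s, t)) s t hx ht.1 h rfl, Complex.real_smul, mul_assoc (S.bExt (x, s) t : ℂ)]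
      rfl
    · rfl
  have hregion : (Ico 0 (2 * Real.pi) ×ˢ Ioc 0 R) ∩ S.polarRegion x = S.polarDomain x := by
    ext z
    simp only [polarDomain, polarRegion, mem_inter_iff, mem_prod, mem_ofPred_eq, mem_Ioc]
    constructor
    · rintro ⟨⟨h1, -⟩, h2⟩
      exact ⟨h1, h2⟩
    · rintro ⟨h1, h2⟩
      have := (le_abs_self _).trans (hR z.1 (Ico_subset_Icc_self h1))
      exact ⟨⟨h1, h2.1, h2.2.le.trans this⟩, h2⟩
  have hrm := (hS.isOpen_polarRegion hx).measurableSet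
  have hQint : Integrable Q ((volume.restrict (Ico 0 (2 * Real.pi))).prod
      (volume.restrict (Ioc 0 R))) := by
    rw [Measure.prod_restrict, hQ]
    change IntegrableOn _ _ _
    rw [integrableOn_indicator_iff hrm, inter_comm, hregion]
    exact hint.const_mul _
  -- The angle integral is made the inner one so that the integration by parts can be done for fixed
  -- t; the result is then read as an integral over the polar domain and transferred to M.
  have e3 : ∫ s in (0 : ℝ)..2 * Real.pi, ∫ t in (0 : ℝ)..S.exitTime (x, s),
      S.perpIntegrand k ψ x s t = (2 * Real.pi : ℂ) * ∫ y, G y ∂S.area := by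
    rw [integral_region_swap (continuous_perpIntegrand k hψ.1 x) hτc
      (fun s => hS.exitTime_nonneg (p := (x, s)) ⟨hx, trivial⟩) hpi.le
      (fun s hs => (le_abs_self _).trans (hR s hs)), setIntegral_congr_fun measurableSet_Ioc e2,
      ← integral_prod_symm Q hQint, Measure.prod_restrict, hQ, setIntegral_indicator hrm, hregion,
      integral_const_mul, ← hpol]
    rfl
  rw [W, fourierPart]
  simp only [e1]
  rw [e3, ← mul_assoc (1 / (2 * Real.pi) : ℂ)]
  have hpiC : (2 * Real.pi : ℂ) ≠ 0 := by exact_mod_cast hpi.ne'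
  rw [one_div_mul_cancel hpiC, one_mul]

end IsSimple

end RiemSurface

theorem integral_norm_le_mul_norm_Lp {α : Type*} [MeasurableSpace α] {μ : Measure α}
    [IsFiniteMeasure μ] (F : Lp ℂ 2 μ) :
    ∫ x, ‖F x‖ ∂μ ≤ (μ univ ^ (1 / 2 : ℝ)).toReal * ‖F‖ := by
  have hm := Lp.aestronglyMeasurable F
  have h := eLpNorm_le_eLpNorm_mul_rpow_measure_univ (μ := μ) (p := 1) (q := 2) one_le_two hm
  rw [integral_norm_eq_lintegral_enorm hm, ← eLpNorm_one_eq_lintegral_enorm, Lp.norm_def,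
    ← ENNReal.toReal_mul, mul_comm]
  refine ENNReal.toReal_mono (ENNReal.mul_ne_top (Lp.eLpNorm_ne_top F) ?_) (h.trans_eq ?_)
  · exact ENNReal.rpow_ne_top_of_nonneg (by norm_num) (measure_ne_top μ univ)
  · congr 2
    norm_num

/-! ### The smoothing operator on L²(SM). -/

namespace RiemSurface

variable {S : RiemSurface}

theorem isFiniteMeasure_area : IsFiniteMeasure S.area :=
  isFiniteMeasure_withDensity_ofReal
    (continuous_areaDensity.continuousOn.integrableOn_compact S.compact).hasFiniteIntegral

theorem isFiniteMeasure_liouville : IsFiniteMeasure S.liouville := by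
  have := isFiniteMeasure_area (S := S)
  unfold liouville
  infer_instance

theorem ae_liouville_mem : ∀ᵐ q ∂S.liouville, q ∈ S.M ×ˢ Icc 0 (2 * Real.pi) := by
  have h1 : ∀ᵐ y ∂S.area, y ∈ S.M :=
    (withDensity_absolutelyContinuous _ _).ae_le (ae_restrict_mem S.compact.measurableSet)
  have h2 : ∀ᵐ s ∂(volume.restrict (Ioc 0 (2 * Real.pi))), s ∈ Icc 0 (2 * Real.pi) :=
    (ae_restrict_mem measurableSet_Ioc).mono fun s hs => Ioc_subset_Icc_self hs
  have := isFiniteMeasure_area (S := S)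
  filter_upwards [Measure.quasiMeasurePreserving_fst.ae h1,
    Measure.quasiMeasurePreserving_snd.ae h2] with q hq1 hq2 using ⟨hq1, hq2⟩

/-- The weight against which the kernel is integrated. -/
noncomputable def modeWeight (k : ℤ) (F : Plane × ℝ → ℂ) (q : Plane × ℝ) : ℂ :=
  Complex.exp (-(Complex.I * k) * q.2) * F q

theorem norm_modeWeight (k : ℤ) (F : Plane × ℝ → ℂ) (q : Plane × ℝ) :
    ‖modeWeight k F q‖ = ‖F q‖ := by
  have : -(Complex.I * k) * (q.2 : ℂ) = ((-(k * q.2) : ℝ) : ℂ) * Complex.I := by push_cast; ring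
  rw [modeWeight, norm_mul, this, Complex.norm_exp_ofReal_mul_I, one_mul]

theorem integrable_modeWeight (k : ℤ) (F : Lp ℂ 2 S.liouville) :
    Integrable (modeWeight k F) S.liouville := by
  have := isFiniteMeasure_liouville (S := S)
  have hF : Integrable F S.liouville := (Lp.memLp F).integrable one_le_two
  have hc : Continuous fun q : Plane × ℝ => Complex.exp (-(Complex.I * k) * q.2) := by fun_prop
  exact hF.mono (hc.aestronglyMeasurable.mul hF.aestronglyMeasurable)
    (Eventually.of_forall fun q => (norm_modeWeight k F q).le)

/-- The kernel lifted to the circle bundle. -/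
noncomputable def liftedKernel (k : ℤ) (K : Plane × Plane → ℂ) (z : (Plane × ℝ) × (Plane × ℝ)) : ℂ :=
  Complex.exp (Complex.I * k * z.1.2) * ((1 / (2 * Real.pi) : ℂ) * K (z.1.1, z.2.1))

theorem contDiff_liftedKernel (k : ℤ) {K : Plane × Plane → ℂ} (hK : ContDiff ℝ ∞ K) :
    ContDiff ℝ ∞ (liftedKernel k K) :=
  ((contDiff_expPhase k).comp contDiff_fst.snd).mul
    (contDiff_const.mul (hK.comp (contDiff_fst.fst.prodMk contDiff_snd.fst)))

/-- The integral operator with kernel `K`, acting on functions on the circle bundle. -/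
noncomputable def kernelOp (S : RiemSurface) (k : ℤ) (K : Plane × Plane → ℂ) (F : Plane × ℝ → ℂ)
    (p : Plane × ℝ) : ℂ :=
  ∫ q, modeWeight k F q • liftedKernel k K (p, q) ∂S.liouville

theorem contDiff_kernelOp (k : ℤ) {K : Plane × Plane → ℂ} (hK : ContDiff ℝ ∞ K)
    (F : Lp ℂ 2 S.liouville) : ContDiff ℝ ∞ (S.kernelOp k K F) :=
  contDiff_weighted (contDiff_liftedKernel k hK) (S.compact.prod isCompact_Icc) ae_liouville_mem
    (integrable_modeWeight k F)

theorem kernelOp_eq_exp_mul (k : ℤ) (K : Plane × Plane → ℂ) (F : Plane × ℝ → ℂ) (p : Plane × ℝ) :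
    S.kernelOp k K F p = Complex.exp (Complex.I * k * p.2) *
      ∫ q, modeWeight k F q * ((1 / (2 * Real.pi) : ℂ) * K (p.1, q.1)) ∂S.liouville := by
  rw [kernelOp, ← integral_const_mul]
  simp only [liftedKernel, smul_eq_mul, mul_left_comm]

theorem kernelOp_mem_Omega (k : ℤ) {K : Plane × Plane → ℂ} (hK : ContDiff ℝ ∞ K)
    (F : Lp ℂ 2 S.liouville) : S.kernelOp k K F ∈ S.Omega k := by
  refine ⟨(contDiff_kernelOp k hK F).contDiffOn, fun p _ => ?_⟩
  simp only [kernelOp_eq_exp_mul k K F, ← mul_assoc]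
  exact (hasDerivAt_expPhase (Complex.I * k) p.2).mul_const _

/-- The weight cancels the phase of F, and the integral over the angle gives 2π, offset by the
factor 1/(2π) in `liftedKernel`. Integrating over SM lets the operator act on L² classes directly,
without choosing an amplitude φ. -/
theorem kernelOp_mode (k : ℤ) (K : Plane × Plane → ℂ) {F : Plane × ℝ → ℂ} {φ : Plane → ℂ}
    (hF : S.IsMode k F φ) (p : Plane × ℝ) :
    S.kernelOp k K F p =
      Complex.exp (Complex.I * k * p.2) * ∫ y, K (p.1, y) * φ y ∂S.area := by
  have := isFiniteMeasure_area (S := S)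
  rw [kernelOp_eq_exp_mul]
  congr 1
  have h1 : ∫ q, modeWeight k F q * ((1 / (2 * Real.pi) : ℂ) * K (p.1, q.1)) ∂S.liouville =
      ∫ q, (1 / (2 * Real.pi) : ℂ) * (K (p.1, q.1) * φ q.1) ∂S.liouville := by
    refine integral_congr_ae ?_
    filter_upwards [hF] with q hq
    have : Complex.exp (-(Complex.I * k) * q.2) * Complex.exp (Complex.I * k * q.2) = 1 := by
      rw [← Complex.exp_add]; simp
    rw [modeWeight, hq]
    linear_combination (1 / (2 * Real.pi) : ℂ) * K (p.1, q.1) * φ q.1 * this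
  rw [h1, liouville, integral_fun_fst (fun y => (1 / (2 * Real.pi) : ℂ) * (K (p.1, y) * φ y)),
    integral_const_mul]
  have hpi : (2 * Real.pi : ℂ) ≠ 0 := by exact_mod_cast Real.two_pi_pos.ne'
  have h2 : (volume.restrict (Ioc 0 (2 * Real.pi))).real univ = 2 * Real.pi := by
    simp [Real.two_pi_pos.le]
  rw [h2, Complex.real_smul, ← mul_assoc]
  push_cast
  rw [mul_one_div_cancel hpi, one_mul]

theorem kernelOp_add (k : ℤ) {K : Plane × Plane → ℂ} (hK : ContDiff ℝ ∞ K)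
    (F G : Lp ℂ 2 S.liouville) :
    S.kernelOp k K (F + G : Lp ℂ 2 S.liouville) = S.kernelOp k K F + S.kernelOp k K G := by
  funext p
  have hint : ∀ F : Lp ℂ 2 S.liouville,
      Integrable (fun q => modeWeight k F q • liftedKernel k K (p, q)) S.liouville := fun F =>
    integrable_weighted ((contDiff_liftedKernel k hK).continuous.comp (Continuous.prodMk_right p))
    (S.compact.prod isCompact_Icc) ae_liouville_mem (integrable_modeWeight k F)
  rw [Pi.add_apply, kernelOp, kernelOp, kernelOp, ← integral_add (hint F) (hint G)]
  refine integral_congr_ae ?_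
  filter_upwards [Lp.coeFn_add F G] with q hq
  simp only [modeWeight, hq, Pi.add_apply, mul_add, add_smul]

theorem kernelOp_smul (k : ℤ) (K : Plane × Plane → ℂ) (z : ℂ) (F : Lp ℂ 2 S.liouville) :
    S.kernelOp k K (z • F : Lp ℂ 2 S.liouville) = z • S.kernelOp k K F := by
  funext p
  rw [Pi.smul_apply, kernelOp, kernelOp, ← integral_smul]
  refine integral_congr_ae ?_
  filter_upwards [Lp.coeFn_smul z F] with q hq
  simp only [modeWeight, hq, Pi.smul_apply, smul_eq_mul]
  ring

theorem kernelOp_shift (k : ℤ) (K : Plane × Plane → ℂ) (F : Plane × ℝ → ℂ) (p : Plane × ℝ) (n : ℤ) :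
    S.kernelOp k K F (p + (0, n * (2 * Real.pi))) = S.kernelOp k K F p := by
  rw [kernelOp_eq_exp_mul, kernelOp_eq_exp_mul, Prod.fst_add, add_zero, Prod.snd_add]
  congr 1
  rw [Complex.exp_eq_exp_iff_exists_int]
  exact ⟨k * n, by push_cast; ring⟩

/-- Smoothing: all derivatives are bounded by the `L²` norm. -/
theorem exists_bound_iteratedFDerivWithin_kernelOp (k : ℤ) {K : Plane × Plane → ℂ}
    (hK : ContDiff ℝ ∞ K) (n : ℕ) : ∃ C : ℝ, ∀ F : Lp ℂ 2 S.liouville, ∀ p ∈ S.SM,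
      ‖iteratedFDerivWithin ℝ n (S.kernelOp k K F) S.SM p‖ ≤ C * ‖F‖ := by
  have := isFiniteMeasure_liouville (S := S)
  obtain ⟨-, B, hB⟩ := contDiff_weighted_nat (μ := S.liouville) (S.compact.prod isCompact_Icc)
    ae_liouville_mem (S := S.M ×ˢ Icc 0 (2 * Real.pi)) (S.compact.prod isCompact_Icc) n
    (contDiff_liftedKernel k hK)
  refine ⟨|B| * (S.liouville univ ^ (1 / 2 : ℝ)).toReal, fun F p hp => ?_⟩
  have hsm := contDiff_kernelOp k hK F
  rw [iteratedFDerivWithin_eq_iteratedFDeriv uniqueDiffOn_SM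
    (hsm.of_le (by exact_mod_cast le_top)).contDiffAt hp]
  -- The angle ranges over ℝ, so `SM` is not compact; periodicity moves p to M × [0, 2π], where the
  -- uniform bound holds.
  obtain ⟨m, hm⟩ := exists_shift p.2 0
  rw [zero_add] at hm
  have hshift : iteratedFDeriv ℝ n (S.kernelOp k K F) (p + (0, m * (2 * Real.pi))) =
      iteratedFDeriv ℝ n (S.kernelOp k K F) p := by
    rw [← iteratedFDeriv_comp_add_right]
    simp only [kernelOp_shift]
  rw [← hshift]
  have hmem : p + (0, m * (2 * Real.pi)) ∈ S.M ×ˢ Icc 0 (2 * Real.pi) := by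
    refine ⟨?_, Ico_subset_Icc_self hm⟩
    rw [Prod.fst_add, add_zero]
    exact hp.1
  refine (hB (integrable_modeWeight k F) _ hmem).trans ?_
  simp only [norm_modeWeight]
  calc B * ∫ q, ‖F q‖ ∂S.liouville ≤ |B| * ∫ q, ‖F q‖ ∂S.liouville := by
        gcongr
        exact le_abs_self B
    _ ≤ |B| * ((S.liouville univ ^ (1 / 2 : ℝ)).toReal * ‖F‖) := by
        gcongr
        exact integral_norm_le_mul_norm_Lp F
    _ = _ := by ring

theorem memLp_modeFun (k : ℤ) {ψ : Plane → ℂ} (hψ : ψ ∈ C0inf S) :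
    MemLp (modeFun k ψ) 2 S.liouville := by
  have := isFiniteMeasure_liouville (S := S)
  obtain ⟨C, hC⟩ := hψ.2.1.exists_bound_of_continuous hψ.1.continuous
  refine MemLp.of_bound (contDiff_modeFun k hψ.1).continuous.aestronglyMeasurable C
    (Eventually.of_forall fun q => ?_)
  have : Complex.I * k * (q.2 : ℂ) = ((k * q.2 : ℝ) : ℂ) * Complex.I := by push_cast; ring
  rw [modeFun, norm_mul, this, Complex.norm_exp_ofReal_mul_I, one_mul]
  exact hC q.1

end RiemSurface

/-! ### The theorem. -/

theorem proposition5p3 (S : RiemSurface) (hS : S.IsSimple)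
    (h : Plane × ℝ → ℂ) (hh : h ∈ S.Omega 1) (hne : ∀ p ∈ S.SM, h p ≠ 0) (k : ℤ) :
    ∃ (K : Plane × Plane → ℂ) (T : S.H k →ₗ[ℂ] S.Omega k),
      -- `T` extends `W_k`, which is well defined on `h^k C_0^∞(M)` with values in `Ω_k`
      (∀ φ ∈ S.C0inf, ∀ f : Plane × ℝ → ℂ, (f = fun p => h p ^ k * φ p.1) →
        -- `u^f` is smooth and solves `X u = -f`, `u = 0` on `∂₋SM`
        ContDiffOn ℝ ∞ (S.transport f) S.SM ∧
        (∀ p ∈ S.SM, S.along S.X (S.transport f) p = -f p) ∧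
        (∀ p ∈ S.outflux, S.transport f p = 0) ∧
        ∃ F : S.H k, (F : Plane × ℝ → ℂ) =ᵐ[S.liouville] f ∧
          ∀ p ∈ S.SM, (T F : Plane × ℝ → ℂ) p = S.W k f p) ∧
      -- `T` is bounded from `L²(SM)` to `C^∞(SM)`
      (∀ n : ℕ, ∃ C : ℝ, ∀ F : S.H k, ∀ p ∈ S.SM,
        ‖iteratedFDerivWithin ℝ n (T F : Plane × ℝ → ℂ) S.SM p‖ ≤ C * ‖F‖) ∧
      -- `T` is the integral operator with the smooth kernel `K`
      ContDiffOn ℝ ∞ K (S.M ×ˢ S.M) ∧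
      (∀ (F : S.H k) (φ : Plane → ℂ), S.IsMode k F φ → ∀ p ∈ S.SM,
        (T F : Plane × ℝ → ℂ) p =
          Complex.exp (Complex.I * k * p.2) * ∫ y, K (p.1, y) * φ y ∂S.area) ∧
      -- the kernel in exponential polar coordinates
      (∀ p ∈ S.SM, ∀ t, 0 < t → t < S.exitTime p →
        DifferentiableAt ℝ (fun s : ℝ => S.a (p.1, s) t / S.b (p.1, s) t) p.2 ∧
        K (p.1, (S.flow p t).1) = -(1 / (2 * Real.pi) : ℂ) * (S.q k p t / S.b p t)) := by
  obtain ⟨K, hK, hKer⟩ := hS.exists_kernel k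
  let T : S.H k →ₗ[ℂ] S.Omega k :=
    { toFun := fun F => ⟨S.kernelOp k K (F : Lp ℂ 2 S.liouville),
        RiemSurface.kernelOp_mem_Omega k hK _⟩
      map_add' := fun F G => Subtype.ext (RiemSurface.kernelOp_add k hK _ _)
      map_smul' := fun z F => Subtype.ext (RiemSurface.kernelOp_smul k K z _) }
  have hT : ∀ (F : S.H k) (φ : Plane → ℂ), S.IsMode k F φ → ∀ p : Plane × ℝ,
      (T F : Plane × ℝ → ℂ) p =
        Complex.exp (Complex.I * k * p.2) * ∫ y, K (p.1, y) * φ y ∂S.area :=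
    fun F φ hF p => RiemSurface.kernelOp_mode k K hF p
  refine ⟨K, T, ?_, ?_, hK.contDiffOn, fun F φ hF p _ => hT F φ hF p, ?_⟩
  · rintro φ hφ f rfl
    obtain ⟨ψ, hψ, hf⟩ := RiemSurface.exists_mode_of_Omega hh hne k hφ
    have hmem := RiemSurface.memLp_modeFun k hψ
    have hF : S.IsMode k (hmem.toLp : Lp ℂ 2 S.liouville) ψ := hmem.coeFn_toLp
    rw [hf]
    exact ⟨hS.contDiffOn_transport hψ, fun p hp => hS.along_X_transport hψ hp,
      fun p hp => hS.transport_outflux _ hp, ⟨hmem.toLp, ψ, hF⟩, hF, fun p hp => by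
        rw [hS.W_modeFun hψ hK.continuous hKer hp]
        exact hT ⟨hmem.toLp, ψ, hF⟩ ψ hF p⟩
  · intro n
    obtain ⟨C, hC⟩ := RiemSurface.exists_bound_iteratedFDerivWithin_kernelOp (S := S) k hK n
    exact ⟨C, fun F p hp => hC F p hp⟩
  · intro p hp t h0 ht
    obtain ⟨h1, h2⟩ := hS.q_eq_qExt k hp h0 ht
    have htm : t ∈ Icc 0 (S.exitTime p) := ⟨h0.le, ht.le⟩
    refine ⟨h1, ?_⟩
    rw [h2, RiemSurface.b_eq_bExt hp htm, RiemSurface.flow_eq hp htm]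
    exact hKer (p.1, (S.extFlow t p).1) p.2 t hp.1 h0 ht rfl
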